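/- Let $\mathbb H_2=L^2([0,1],\mathbb R^2)$ and let $\mu_2$ be the law on $\mathbb H_2$ of a two-dimensional Brownian bridge from $0$ to $0$ on $[0,1]$. Let $g_t(x,y)=\sum_{k\ge1}e^{-\lambda_k t/2}e_k(x)e_k(y)$, with $e_k(x)=\sqrt2\sin(k\pi x)$ and $\lambda_k=k^2\pi^2$, be the heat kernel of $\partial_t=\frac12\partial_x^2$ on $[0,1]$ with Dirichlet boundary conditions, and put $q_t(r)=\int_0^t g_{2\tau}(r,r)\,d\tau$ and $z(t,r)=\int_0^1 g_t(r,r')z(r')\,dr'$ for $z\in\mathbb H_2$, $t>0$, $r\in[0,1]$. For $z\in\mathbb H_2$ let $v(z)=(v_t(z))_{t\ge0}$ be the solution of the two-dimensional stochastic heat equation $$\partial_t v=\tfrac12\partial_x^2v+\xi,\qquad v(0,\cdot)=z,\qquad v(t,0)=v(t,1)=0,$$ with $\xi=(\xi_1,\xi_2)$ a pair of independent space-time white noises on $\mathbb R_+\times[0,1]$, that is, $v_i(t,x)=z_i(t,x)+\int_0^t\int_0^1 g_{t-s}(x,x')\,\xi_i(ds,dx')$; and set $\mathbf Q_tF(z)=\mathbb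 E[F(v_t(z))]$. Let $D(\Lambda^2)=W^{1,2}(\mu_2)$ be the Sobolev space obtained by closing in $L^2(\mu_2)$ the gradient $\overline\nabla$ of $\mathbb H_2$ defined on smooth bounded cylindrical functionals, with the form $\Lambda^2(F,G)=\frac12\int\langle\overline\nabla F,\overline\nabla G\rangle_{\mathbb H_2}\,d\mu_2$ and the norm $F\mapsto\big(\Lambda^2(F,F)+\|F\|_{L^2(\mu_2)}^2\big)^{1/2}$. Let $h\in C^2_c(0,1)$, and let $\rho\ge0$ be a smooth even function on $\mathbb R$ supported in $[-1,1]$ with $\int\rho=1$; put $\rho_\eta(y)=\eta^{-1}\rho(y/\eta)$. For $0<\eta<\varepsilon$ define $$f_{\varepsilon,\eta}(x)=\frac14\Big(\frac{\mathbf 1_{\{x\ge\varepsilon\}}}{x^3}-\frac2\varepsilon\frac{\rho_\eta(x)}{x}\Big),\qquad G_{\varepsilon,\eta}(z)=\int_0^1h_r\,f_{\varepsilon,\eta}(\|z_r\|)\,dr,$$ and let $$V_{\varepsilon,\eta}(z)=\int_0^\infty e^{-t}\,\mathbf Q_tG_{\varepsilon,\eta}(z)\,dt$$ be the one-potential of the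 additive functional $\int_0^tG_{\varepsilon,\eta}(v_s)\,ds$. For $q>0$ and $m,a\in\mathbb R^2$ write $E_q(m,a)=e^{-\|a-m\|^2/(2q)}-e^{-\|m\|^2/(2q)}$, and define for $\varepsilon>0$ $$V_\varepsilon(z)=\int_0^\infty dt\,e^{-t}\int_0^1dr\,\frac{h_r}{8\pi q_t(r)}\int_{\mathbb R^2}da\,\frac{\mathbf 1_{\{\|a\|\ge\varepsilon\}}}{\|a\|^3}\,E_{q_t(r)}(z(t,r),a),$$ $$V(z)=\int_0^\infty dt\,e^{-t}\int_0^1dr\,\frac{h_r}{8\pi q_t(r)}\int_{\mathbb R_+^2}\frac{da}{\|a\|^3}\sum_{\alpha\in\{-1,1\}^2}E_{q_t(r)}(z(t,r),\alpha a),\qquad \alpha a=(\alpha_1a_1,\alpha_2a_2).$$ Then $V_{\varepsilon,\eta}$ ($0<\eta<\varepsilon$), $V_\varepsilon$ ($\varepsilon>0$) and $V$ all belong to $D(\Lambda^2)$. Moreover, for every $\varepsilon>0$, $\lim_{\eta\to0}V_{\varepsilon,\eta}=V_\varepsilon$ in $D(\Lambda^2)$, and $\lim_{\varepsilon\to0}V_\varepsilon=V$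 in $D(\Lambda^2)$. -/

import Mathlib

open MeasureTheory ProbabilityTheory Filter Topology Set
open scoped unitInterval

noncomputable section

namespace RandomString

/-! ### The state space -/

/-- The Euclidean plane. -/
abbrev Plane : Type := EuclideanSpace ℝ (Fin 2)

/-- The Hilbert space `L²([0,1], ℝ²)`, with its `L²` inner product. -/
abbrev H2 : Type := Lp Plane 2 (volume : Measure I)

instance instMeasurableSpaceH2 : MeasurableSpace H2 := borel H2

instance instBorelSpaceH2 : BorelSpace H2 := ⟨rfl⟩

open Classical in
/-- The element of `L²([0,1], ℝ²)` represented by a square integrable path. -/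
def pathClass (w : I → Plane) : H2 :=
  if hw : MemLp w 2 (volume : Measure I) then hw.toLp w else 0

/-! ### The Dirichlet heat kernel on `[0,1]` (for `∂ₜ = ½ ∂ₓ²`) and the associated covariance -/

/-- The `k`-th Dirichlet eigenfunction `√2 sin (k π x)`. -/
def eigenfun (k : ℕ) (x : ℝ) : ℝ := √2 * Real.sin (k * Real.pi * x)

/-- The `k`-th Dirichlet eigenvalue `k² π²`. -/
def eigenval (k : ℕ) : ℝ := (k : ℝ) ^ 2 * Real.pi ^ 2

/-- `g t x y = ∑_{k ≥ 1} exp (-λ_k t / 2) e_k(x) e_k(y)`, for `t > 0`. -/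
def heatKernel (t x y : ℝ) : ℝ :=
  ∑' k : ℕ, Real.exp (-(eigenval (k + 1) / 2) * t) * eigenfun (k + 1) x * eigenfun (k + 1) y

/-- `q t r = ∫_0^t g (2 τ) r r dτ`. -/
def heatVar (t r : ℝ) : ℝ := ∫ τ in (0 : ℝ)..t, heatKernel (2 * τ) r r

/-- `z(t,x) = ∫_0^1 g t x y z(y) dy`, for `t > 0`. -/
def heatFlow (z : H2) (t x : ℝ) : Plane := ∫ y : I, heatKernel t x y • z y

/-! ### Brownian bridge -/

/-- `B` is a standard one-dimensional Brownian bridge from `0` to `0` over `[0,1]`. -/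
structure IsBrownianBridge {Ω : Type*} [MeasurableSpace Ω] (B : I → Ω → ℝ) (P : Measure Ω) :
    Prop where
  isGaussianProcess : IsGaussianProcess B P
  integral_eq_zero : ∀ r, ∫ ω, B r ω ∂P = 0
  covariance_eq : ∀ r s : I, cov[B r, B s; P] = min (r : ℝ) s - r * s
  continuous_paths : ∀ᵐ ω ∂P, Continuous fun r => B r ω

/-- `β = (β⁰, β¹)` is a two-dimensional Brownian bridge from `0` to `0` over `[0,1]`. -/
structure IsPlanarBrownianBridge {Ω : Type*} [MeasurableSpace Ω] (β : Fin 2 → I → Ω → ℝ)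
    (P : Measure Ω) : Prop where
  isBrownianBridge : ∀ i, IsBrownianBridge (β i) P
  indep : IndepFun (fun ω r => β 0 r ω) (fun ω r => β 1 r ω) P

/-- The law on `L²([0,1], ℝ²)` of a process `β` with values in the plane. -/
def lawH2 {Ω : Type*} [MeasurableSpace Ω] (β : Fin 2 → I → Ω → ℝ) (P : Measure Ω) :
    Measure H2 :=
  P.map fun ω => pathClass fun r => !₂[β 0 r ω, β 1 r ω]

/-! ### White noise and the stochastic heat equation -/

/-- Lebesgue measure on `(0,∞) × [0,1]`. -/
def spaceTime : Measure (ℝ × I) := (volume.restrict (Ioi (0 : ℝ))).prod volume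

/-- `ξ` is a space-time white noise on `ℝ₊ × [0,1]`: a centred Gaussian family indexed by
`L²(ℝ₊ × [0,1])` whose covariance is the inner product. `ξ φ` is the Wiener integral
`∫ φ(s,y) ξ(ds,dy)`. -/
structure IsWhiteNoise {Ω : Type*} [MeasurableSpace Ω] (ξ : Lp ℝ 2 spaceTime → Ω → ℝ)
    (P : Measure Ω) : Prop where
  measurable : ∀ φ, Measurable (ξ φ)
  isGaussianProcess : IsGaussianProcess ξ P
  integral_eq_zero : ∀ φ, ∫ ω, ξ φ ω ∂P = 0
  covariance_eq : ∀ φ ψ, cov[ξ φ, ξ ψ; P] = inner ℝ φ ψ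

/-- `ξ = (ξ⁰, ξ¹)` is a pair of independent space-time white noises. -/
structure IsPlanarWhiteNoise {Ω : Type*} [MeasurableSpace Ω]
    (ξ : Fin 2 → Lp ℝ 2 spaceTime → Ω → ℝ) (P : Measure Ω) : Prop where
  isWhiteNoise : ∀ i, IsWhiteNoise (ξ i) P
  indep : IndepFun (fun ω φ => ξ 0 φ ω) (fun ω φ => ξ 1 φ ω) P

/-- `v` is the (mild) solution of `∂ₜ v = ½ ∂ₓ² v + ξ` on `[0,1]`, with homogeneous Dirichlet
boundary conditions and `v(0, ·) = z`: for all `t > 0`, `x ∈ [0,1]`,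
`v_i(t,x) = z_i(t,x) + ∫_0^t ∫_0^1 g_{t-s}(x,y) ξ_i(ds,dy)` almost surely. -/
structure IsMildSolution {Ω : Type*} [MeasurableSpace Ω]
    (ξ : Fin 2 → Lp ℝ 2 spaceTime → Ω → ℝ) (P : Measure Ω) (z : H2)
    (v : ℝ → I → Ω → Plane) : Prop where
  measurable : ∀ t, 0 ≤ t → Measurable fun p : I × Ω => v t p.1 p.2
  initial : ∀ᵐ x : I, ∀ᵐ ω ∂P, v 0 x ω = z x
  mild : ∀ t, 0 < t → ∀ x : I, ∃ φ : Lp ℝ 2 spaceTime,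
    (φ =ᵐ[spaceTime] fun p => if p.1 < t then heatKernel (t - p.1) x p.2 else 0) ∧
    ∀ i : Fin 2, ∀ᵐ ω ∂P, v t x ω i = heatFlow z t x i + ξ i φ ω

/-- The semigroup `Q_t F (z) = 𝔼[F (v_t(z))]`, where `v z` is the solution started from `z`. -/
def semigroup {Ω : Type*} [MeasurableSpace Ω] (P : Measure Ω) (v : H2 → ℝ → I → Ω → Plane)
    (t : ℝ) (F : H2 → ℝ) (z : H2) : ℝ :=
  ∫ ω, F (pathClass fun x => v z t x ω) ∂P

/-- The one-potential `∫_0^∞ e^{-t} Q_t F (z) dt`. -/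
def onePotential {Ω : Type*} [MeasurableSpace Ω] (P : Measure Ω) (v : H2 → ℝ → I → Ω → Plane)
    (F : H2 → ℝ) (z : H2) : ℝ :=
  ∫ t in Ioi (0 : ℝ), Real.exp (-t) * semigroup P v t F z

/-! ### The Dirichlet form `Λ²` and its domain `W^{1,2}(μ)` -/

/-- The smooth bounded cylindrical functionals `z ↦ ψ(⟨l₁,z⟩, …, ⟨l_m,z⟩)`, where `ψ` is smooth
and bounded together with all its derivatives. -/
def IsCylindrical (F : H2 → ℝ) : Prop :=
  ∃ (m : ℕ) (l : Fin m → H2) (ψ : (Fin m → ℝ) → ℝ), ContDiff ℝ (⊤ : ℕ∞) ψ ∧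
    (∀ n : ℕ, ∃ C : ℝ, ∀ x, ‖iteratedFDeriv ℝ n ψ x‖ ≤ C) ∧
    ∀ z, F z = ψ fun j => inner ℝ (l j) z

/-- `F ∈ W^{1,2}(μ)` with gradient `D ∈ L²(μ; L²([0,1], ℝ²))`: the pair `(F, D)` belongs to the
closure in `L²(μ) × L²(μ; L²([0,1], ℝ²))` of the graph of the gradient on smooth bounded
cylindrical functionals. For the law `μ` of the planar Brownian bridge the gradient is closable,
so that `D` is determined by `F` up to equality `μ`-a.e. -/
def HasSobolevGradient (μ : Measure H2) (F : H2 → ℝ) (D : H2 → H2) : Prop :=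
  MemLp F 2 μ ∧ MemLp D 2 μ ∧
    ∃ Φ : ℕ → H2 → ℝ, (∀ n, IsCylindrical (Φ n)) ∧
      Tendsto (fun n => eLpNorm (fun z => Φ n z - F z) 2 μ) atTop (𝓝 0) ∧
      Tendsto (fun n => eLpNorm (fun z => gradient (Φ n) z - D z) 2 μ) atTop (𝓝 0)

/-- `F` belongs to the domain `D(Λ²) = W^{1,2}(μ)`. -/
def MemDirichletDomain (μ : Measure H2) (F : H2 → ℝ) : Prop := ∃ D, HasSobolevGradient μ F D

/-- `Λ²(F,G) = ½ ∫ ⟨∇F, ∇G⟩ dμ`, as a function of the gradients. -/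
def dirichletForm (μ : Measure H2) (DF DG : H2 → H2) : ℝ :=
  1 / 2 * ∫ z, inner ℝ (DF z) (DG z) ∂μ

/-- `F s → F₀` in `D(Λ²)` as `s ↓ 0`: `F₀`, and `F s` for small `s > 0`, belong to `D(Λ²)`, and
`Λ²(F s - F₀, F s - F₀) + ‖F s - F₀‖²_{L²(μ)} → 0`. -/
def TendstoInDirichletDomain (μ : Measure H2) (F : ℝ → H2 → ℝ) (F₀ : H2 → ℝ) : Prop :=
  ∃ (D : ℝ → H2 → H2) (D₀ : H2 → H2),
    HasSobolevGradient μ F₀ D₀ ∧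
    (∀ᶠ s in 𝓝[>] (0 : ℝ), HasSobolevGradient μ (F s) (D s)) ∧
    Tendsto (fun s => dirichletForm μ (fun z => D s z - D₀ z) (fun z => D s z - D₀ z)
      + ∫ z, (F s z - F₀ z) ^ 2 ∂μ) (𝓝[>] (0 : ℝ)) (𝓝 0)

/-! ### The functionals -/

/-- `ρ_η(y) = ρ(y/η)/η`. -/
def rescale (ρ : ℝ → ℝ) (η y : ℝ) : ℝ := 1 / η * ρ (y / η)

/-- `f_{ε,η}(x) = ¼ (1_{x ≥ ε} / x³ - (2/ε) ρ_η(x) / x)`. -/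
def fReg (ρ : ℝ → ℝ) (ε η x : ℝ) : ℝ :=
  1 / 4 * ((if ε ≤ x then 1 / x ^ 3 else 0) - 2 / ε * (rescale ρ η x / x))

/-- `G_{ε,η}(z) = ∫_0^1 h(r) f_{ε,η}(‖z(r)‖) dr`. -/
def GReg (h ρ : ℝ → ℝ) (ε η : ℝ) (z : H2) : ℝ := ∫ r : I, h r * fReg ρ ε η ‖z r‖

/-- The one-potential `V_{ε,η}` of `∫_0^t G_{ε,η}(v_s) ds`. -/
def VReg {Ω : Type*} [MeasurableSpace Ω] (P : Measure Ω) (v : H2 → ℝ → I → Ω → Plane)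
    (h ρ : ℝ → ℝ) (ε η : ℝ) : H2 → ℝ :=
  onePotential P v (GReg h ρ ε η)

/-- `exp(-‖a - m‖² / (2q)) - exp(-‖m‖² / (2q))`. -/
def gaussDiff (q : ℝ) (m a : Plane) : ℝ :=
  Real.exp (-‖a - m‖ ^ 2 / (2 * q)) - Real.exp (-‖m‖ ^ 2 / (2 * q))

/-- The functional `V_ε`. -/
def VEps (h : ℝ → ℝ) (ε : ℝ) (z : H2) : ℝ :=
  ∫ t in Ioi (0 : ℝ), Real.exp (-t) * ∫ r : I, h r / (8 * Real.pi * heatVar t r) *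
    ∫ a : Plane, (if ε ≤ ‖a‖ then 1 / ‖a‖ ^ 3 else 0) *
      gaussDiff (heatVar t r) (heatFlow z t r) a

/-- `α a = (α₁ a₁, α₂ a₂)` for a pair of signs `α`. -/
def flip (α : Fin 2 → ℤˣ) (a : Plane) : Plane := !₂[((α 0 : ℤ) : ℝ) * a 0, ((α 1 : ℤ) : ℝ) * a 1]

/-- The functional `V`; the innermost integral is over the quadrant `ℝ₊²`. -/
def VLim (h : ℝ → ℝ) (z : H2) : ℝ :=
  ∫ t in Ioi (0 : ℝ), Real.exp (-t) * ∫ r : I, h r / (8 * Real.pi * heatVar t r) *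
    ∫ a in {a : Plane | ∀ i, 0 ≤ a i}, 1 / ‖a‖ ^ 3 *
      ∑ α : Fin 2 → ℤˣ, gaussDiff (heatVar t r) (heatFlow z t r) (flip α a)

end RandomString

end

noncomputable section

namespace RandomString

/-! ### The spectral expansion of the heat kernel -/

theorem integral_unitInterval {E : Type*} [NormedAddCommGroup E] [NormedSpace ℝ E] (f : ℝ → E) :
    ∫ y : I, f y = ∫ y in (0 : ℝ)..1, f y := by
  rw [intervalIntegral.integral_of_le zero_le_one, ← integral_Icc_eq_integral_Ioc]
  exact integral_subtype_comap measurableSet_Icc f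

theorem continuous_eigenfun (k : ℕ) : Continuous (eigenfun k) := by
  unfold eigenfun; fun_prop

theorem abs_eigenfun_le (k : ℕ) (x : ℝ) : |eigenfun k x| ≤ √2 := by
  rw [eigenfun, abs_mul, abs_of_nonneg (Real.sqrt_nonneg 2)]
  exact mul_le_of_le_one_right (Real.sqrt_nonneg 2) (Real.abs_sin_le_one _)

theorem eigenfun_sq (k : ℕ) (x : ℝ) :
    eigenfun k x ^ 2 = 2 * Real.sin (k * Real.pi * x) ^ 2 := by
  rw [eigenfun, mul_pow, Real.sq_sqrt zero_le_two]

theorem eigenval_ge (k : ℕ) : 2 * ((k : ℝ) + 1) ≤ eigenval (k + 1) := by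
  have h := Real.pi_gt_three
  have h9 : 2 ≤ Real.pi ^ 2 := by nlinarith
  have hk : (k : ℝ) + 1 ≤ ((k : ℝ) + 1) ^ 2 := by nlinarith [(Nat.cast_nonneg k : (0 : ℝ) ≤ k)]
  unfold eigenval
  push_cast
  nlinarith [(Nat.cast_nonneg k : (0 : ℝ) ≤ k)]

theorem eigenval_pos (k : ℕ) : 0 < eigenval (k + 1) :=
  lt_of_lt_of_le (by positivity) (eigenval_ge k)

/-- The factor `exp (-λ_{k+1} t / 2)`. -/
def heatDecay (k : ℕ) (t : ℝ) : ℝ := Real.exp (-(eigenval (k + 1) / 2) * t)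

theorem heatDecay_pos (k : ℕ) (t : ℝ) : 0 < heatDecay k t := Real.exp_pos _

theorem heatDecay_le_one (k : ℕ) {t : ℝ} (ht : 0 ≤ t) : heatDecay k t ≤ 1 := by
  rw [heatDecay, Real.exp_le_one_iff]
  nlinarith [eigenval_pos k]

theorem heatDecay_anti (k : ℕ) {s t : ℝ} (hst : s ≤ t) : heatDecay k t ≤ heatDecay k s := by
  rw [heatDecay, heatDecay, Real.exp_le_exp]
  nlinarith [eigenval_pos k]

theorem heatDecay_mul (k : ℕ) (s t : ℝ) : heatDecay k s * heatDecay k t = heatDecay k (s + t) := by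
  rw [heatDecay, heatDecay, heatDecay, ← Real.exp_add]; ring_nf

theorem summable_heatDecay {t : ℝ} (ht : 0 < t) : Summable fun k => heatDecay k t := by
  refine Summable.of_nonneg_of_le (fun k => (heatDecay_pos k t).le) (fun k => ?_)
    (Real.summable_exp_nat_mul_iff.2 (neg_lt_zero.2 ht))
  rw [heatDecay, Real.exp_le_exp]
  nlinarith [eigenval_ge k]

/-- The `k`-th coefficient of `heatKernel t x` in the basis of Dirichlet eigenfunctions. -/
def heatCoef (k : ℕ) (t x : ℝ) : ℝ := heatDecay k t * eigenfun (k + 1) x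

theorem abs_heatCoef_le (k : ℕ) (t x : ℝ) : |heatCoef k t x| ≤ heatDecay k t * √2 := by
  rw [heatCoef, abs_mul, abs_of_pos (heatDecay_pos k t)]
  exact mul_le_mul_of_nonneg_left (abs_eigenfun_le _ _) (heatDecay_pos k t).le

theorem continuous_heatCoef (k : ℕ) : Continuous fun p : ℝ × ℝ => heatCoef k p.1 p.2 := by
  unfold heatCoef heatDecay
  exact (by fun_prop : Continuous fun p : ℝ × ℝ => Real.exp (-(eigenval (k + 1) / 2) * p.1)).mul
    ((continuous_eigenfun _).comp continuous_snd)

theorem heatKernel_eq (t x y : ℝ) :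
    heatKernel t x y = ∑' k, heatCoef k t x * eigenfun (k + 1) y := rfl

theorem norm_heatKernel_term_le (k : ℕ) (t x y : ℝ) :
    ‖heatCoef k t x * eigenfun (k + 1) y‖ ≤ heatDecay k t * 2 := by
  rw [norm_mul, Real.norm_eq_abs, Real.norm_eq_abs]
  calc |heatCoef k t x| * |eigenfun (k + 1) y| ≤ heatDecay k t * √2 * √2 :=
        mul_le_mul (abs_heatCoef_le k t x) (abs_eigenfun_le _ _) (abs_nonneg _)
          (mul_nonneg (heatDecay_pos k t).le (Real.sqrt_nonneg 2))
    _ = _ := by rw [mul_assoc, Real.mul_self_sqrt zero_le_two]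

theorem summable_heatKernel {t : ℝ} (ht : 0 < t) (x y : ℝ) :
    Summable fun k => heatCoef k t x * eigenfun (k + 1) y :=
  Summable.of_norm_bounded ((summable_heatDecay ht).mul_right 2)
    fun k => norm_heatKernel_term_le k t x y

theorem continuous_heatKernel {t : ℝ} (ht : 0 < t) (x : ℝ) : Continuous (heatKernel t x) := by
  refine continuous_tsum (fun k => ?_) ((summable_heatDecay ht).mul_right 2)
    fun k y => norm_heatKernel_term_le k t x y
  exact continuous_const.mul (continuous_eigenfun _)

theorem hasSum_integral_heatKernel_smul {E : Type*} [NormedAddCommGroup E] [NormedSpace ℝ E]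
    {t : ℝ} (ht : 0 < t) (x : ℝ) {w : I → E} (hw : Integrable w) :
    HasSum (fun k => heatCoef k t x • ∫ y : I, eigenfun (k + 1) y • w y)
      (∫ y : I, heatKernel t x y • w y) := by
  have hint : ∀ k : ℕ, Integrable fun y : I => (heatCoef k t x * eigenfun (k + 1) y) • w y := by
    intro k
    refine hw.bdd_smul (heatDecay k t * 2) ?_
      (Eventually.of_forall fun y => norm_heatKernel_term_le k t x y)
    exact (continuous_const.mul
      ((continuous_eigenfun _).comp continuous_subtype_val)).aestronglyMeasurable
  have hsum := hasSum_integral_of_summable_integral_norm hint ?_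
  · have e1 : (fun k => heatCoef k t x • ∫ y : I, eigenfun (k + 1) y • w y) =
        fun k => ∫ y : I, (heatCoef k t x * eigenfun (k + 1) y) • w y := by
      funext k
      rw [← integral_smul]
      simp_rw [mul_smul]
    have e2 : (fun y : I => heatKernel t x y • w y) =
        fun y : I => ∑' k, (heatCoef k t x * eigenfun (k + 1) y) • w y := by
      funext y
      rw [heatKernel_eq, ((summable_heatKernel ht x y).hasSum.smul_const (w y)).tsum_eq]
    rw [e1, e2]
    exact hsum
  · refine Summable.of_nonneg_of_le (fun k => integral_nonneg fun y => norm_nonneg _) (fun k => ?_)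
      (((summable_heatDecay ht).mul_right 2).mul_right (∫ y : I, ‖w y‖))
    rw [← integral_const_mul]
    refine integral_mono (hint k).norm (hw.norm.const_mul _) fun y => ?_
    rw [norm_smul]
    exact mul_le_mul_of_nonneg_right (norm_heatKernel_term_le k t x y) (norm_nonneg _)

theorem integral_cos_nat_mul_pi {n : ℤ} (hn : n ≠ 0) :
    ∫ y in (0 : ℝ)..1, Real.cos (n * Real.pi * y) = 0 := by
  have hc : (n : ℝ) * Real.pi ≠ 0 := mul_ne_zero (Int.cast_ne_zero.2 hn) Real.pi_ne_zero
  rw [intervalIntegral.integral_comp_mul_left _ hc, integral_cos]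
  simp [Real.sin_int_mul_pi]

theorem integral_eigenfun_mul (j k : ℕ) :
    ∫ y : I, eigenfun (j + 1) y * eigenfun (k + 1) y = if j = k then 1 else 0 := by
  rw [integral_unitInterval fun y => eigenfun (j + 1) y * eigenfun (k + 1) y]
  have h : ∀ y : ℝ, eigenfun (j + 1) y * eigenfun (k + 1) y =
      Real.cos (((j : ℤ) - k : ℤ) * Real.pi * y) - Real.cos (((j : ℤ) + k + 2 : ℤ) * Real.pi * y) := by
    intro y
    have e1 : ((((j : ℤ) - k : ℤ) : ℝ) * Real.pi * y) =
      ((j + 1 : ℕ) : ℝ) * Real.pi * y - ((k + 1 : ℕ) : ℝ) * Real.pi * y := by push_cast; ring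
    have e2 : ((((j : ℤ) + k + 2 : ℤ) : ℝ) * Real.pi * y) =
      ((j + 1 : ℕ) : ℝ) * Real.pi * y + ((k + 1 : ℕ) : ℝ) * Real.pi * y := by push_cast; ring
    rw [e1, e2, Real.cos_sub, Real.cos_add, eigenfun, eigenfun]
    linear_combination (Real.sin (((j + 1 : ℕ) : ℝ) * Real.pi * y) *
      Real.sin (((k + 1 : ℕ) : ℝ) * Real.pi * y)) * Real.mul_self_sqrt (zero_le_two (α := ℝ))
  simp_rw [h]
  rw [intervalIntegral.integral_sub (Continuous.intervalIntegrable (by fun_prop) _ _)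
    (Continuous.intervalIntegrable (by fun_prop) _ _),
    integral_cos_nat_mul_pi (n := (j : ℤ) + k + 2) (by omega)]
  split_ifs with hjk
  · subst hjk; simp
  · rw [integral_cos_nat_mul_pi (by omega), sub_zero]

theorem integrable_of_continuous {E : Type*} [NormedAddCommGroup E] {f : I → E}
    (hf : Continuous f) : Integrable f :=
  hf.integrable_of_hasCompactSupport (HasCompactSupport.of_compactSpace f)

theorem integral_eigenfun_mul_heatKernel {t : ℝ} (ht : 0 < t) (x : ℝ) (j : ℕ) :
    ∫ y : I, eigenfun (j + 1) y * heatKernel t x y = heatCoef j t x := by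
  have h := hasSum_integral_heatKernel_smul ht x (w := fun y : I => eigenfun (j + 1) y)
    (integrable_of_continuous ((continuous_eigenfun _).comp continuous_subtype_val))
  simp only [smul_eq_mul, integral_eigenfun_mul] at h
  have h2 := h.unique (hasSum_single j fun k hk => by simp [hk])
  simp only [if_true, mul_one] at h2
  rw [← h2]
  simp_rw [mul_comm]

theorem integral_heatKernel_sq {t : ℝ} (ht : 0 < t) (x : ℝ) :
    ∫ y : I, heatKernel t x y ^ 2 = heatKernel (2 * t) x x := by
  have h := hasSum_integral_heatKernel_smul ht x (w := fun y : I => heatKernel t x y)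
    (integrable_of_continuous ((continuous_heatKernel ht x).comp continuous_subtype_val))
  simp only [smul_eq_mul, integral_eigenfun_mul_heatKernel ht] at h
  simp_rw [sq, ← h.tsum_eq, heatKernel_eq]
  refine tsum_congr fun k => ?_
  rw [heatCoef, heatCoef, two_mul, ← heatDecay_mul]
  ring

/-! ### The heat flow on `L²([0,1], ℝ²)` -/

/-- The function `e_{k+1}` in the direction of the `i`-th coordinate. -/
def modeFun (k : ℕ) (i : Fin 2) (y : I) : Plane := EuclideanSpace.single i (eigenfun (k + 1) y)

theorem continuous_modeFun (k : ℕ) (i : Fin 2) : Continuous (modeFun k i) := by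
  have : modeFun k i = fun y : I => eigenfun (k + 1) y • EuclideanSpace.single i (1 : ℝ) := by
    funext y; ext j; simp [modeFun]
  rw [this]
  exact ((continuous_eigenfun _).comp continuous_subtype_val).smul continuous_const

theorem memLp_of_continuous {E : Type*} [NormedAddCommGroup E] {f : I → E}
    (hf : Continuous f) (p : ENNReal) : MemLp f p volume :=
  hf.memLp_of_hasCompactSupport (HasCompactSupport.of_compactSpace f)

/-- `modeFun k i` as an element of `L²([0,1], ℝ²)`. -/
def mode (k : ℕ) (i : Fin 2) : H2 := (memLp_of_continuous (continuous_modeFun k i) 2).toLp _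

theorem coeFn_mode (k : ℕ) (i : Fin 2) : mode k i =ᵐ[volume] modeFun k i := MemLp.coeFn_toLp _

theorem integrable_coeFn (z : H2) : Integrable (z : I → Plane) :=
  (Lp.memLp z).integrable one_le_two

theorem inner_mode (k : ℕ) (i : Fin 2) (z : H2) :
    inner ℝ (mode k i) z = ∫ y : I, eigenfun (k + 1) y * z y i := by
  rw [L2.inner_def]
  refine integral_congr_ae ?_
  filter_upwards [coeFn_mode k i] with y hy
  rw [hy, modeFun, EuclideanSpace.inner_single_left]
  simp

theorem orthonormal_mode : Orthonormal ℝ fun p : ℕ × Fin 2 => mode p.1 p.2 := by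
  rw [orthonormal_iff_ite]
  rintro ⟨j, i⟩ ⟨k, l⟩
  rw [inner_mode]
  have : ∫ y : I, eigenfun (j + 1) y * mode k l y i =
      ∫ y : I, if l = i then eigenfun (j + 1) y * eigenfun (k + 1) y else 0 := by
    refine integral_congr_ae ?_
    filter_upwards [coeFn_mode k l] with y hy
    rw [hy, modeFun]
    by_cases h : l = i
    · simp [h]
    · simp [h, Ne.symm h]
  rw [this]
  by_cases h : l = i
  · simp [h, integral_eigenfun_mul]
  · simp [h, Ne.symm h]

/-- The coefficient of `z` along `e_{k+1}`. -/
def modeMap (k : ℕ) : H2 →L[ℝ] Plane :=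
  ∑ i, (innerSL ℝ (mode k i)).smulRight (EuclideanSpace.single i (1 : ℝ))

theorem modeMap_apply (k : ℕ) (z : H2) (i : Fin 2) : modeMap k z i = inner ℝ (mode k i) z := by
  fin_cases i <;> simp [modeMap, Fin.sum_univ_two]

theorem integral_plane_apply {α : Type*} [MeasurableSpace α] {μ : Measure α} {f : α → Plane}
    (hf : Integrable f μ) (i : Fin 2) : (∫ y, f y ∂μ) i = ∫ y, f y i ∂μ :=
  ((EuclideanSpace.proj i : Plane →L[ℝ] ℝ).integral_comp_comm hf).symm

theorem integrable_bdd_smul {E : Type*} [NormedAddCommGroup E] [NormedSpace ℝ E] {w : I → E}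
    (hw : Integrable w) {f : ℝ → ℝ} (hf : Continuous f) : Integrable fun y : I => f y • w y := by
  obtain ⟨C, hC⟩ := (isCompact_univ (X := I)).exists_bound_of_continuousOn
    (hf.comp continuous_subtype_val).continuousOn
  exact hw.bdd_smul C (hf.comp continuous_subtype_val).aestronglyMeasurable
    (Eventually.of_forall fun y => hC y (mem_univ y))

theorem modeMap_eq (k : ℕ) (z : H2) : modeMap k z = ∫ y : I, eigenfun (k + 1) y • z y := by
  ext i
  rw [modeMap_apply, inner_mode,
    integral_plane_apply (integrable_bdd_smul (integrable_coeFn z) (continuous_eigenfun _))]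
  simp

theorem norm_modeMap_le (k : ℕ) : ‖modeMap k‖ ≤ 2 := by
  refine (norm_sum_le _ _).trans ?_
  rw [Fin.sum_univ_two]
  have h : ∀ i, ‖(innerSL ℝ (mode k i)).smulRight (EuclideanSpace.single i (1 : ℝ) : Plane)‖ = 1 := by
    intro i
    rw [ContinuousLinearMap.norm_smulRight_apply, innerSL_apply_norm]
    have := orthonormal_mode.1 (k, i)
    simp [this]
  rw [h, h]; norm_num

/-- The evaluation of the heat flow at time `t` and place `x`, as a continuous linear map. -/
def flowMap (p : ℝ × I) : H2 →L[ℝ] Plane := ∑' k, heatCoef k p.1 p.2 • modeMap k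

theorem norm_flowMap_term_le (k : ℕ) {p : ℝ × I} {t : ℝ} (ht : t ≤ p.1) :
    ‖heatCoef k p.1 p.2 • modeMap k‖ ≤ heatDecay k t * √2 * 2 := by
  rw [norm_smul]
  exact mul_le_mul ((abs_heatCoef_le k _ _).trans (mul_le_mul_of_nonneg_right
    (heatDecay_anti k ht) (Real.sqrt_nonneg 2))) (norm_modeMap_le k) (norm_nonneg _)
      (mul_nonneg (heatDecay_pos k t).le (Real.sqrt_nonneg 2))

theorem summable_flowMap {p : ℝ × I} (hp : 0 < p.1) :
    Summable fun k => heatCoef k p.1 p.2 • modeMap k :=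
  Summable.of_norm_bounded (((summable_heatDecay hp).mul_right _).mul_right _)
    fun k => norm_flowMap_term_le k le_rfl

theorem norm_flowMap_le {t : ℝ} (ht : 0 < t) : ∃ C : ℝ, 0 ≤ C ∧ ∀ p : ℝ × I, t ≤ p.1 →
    ‖flowMap p‖ ≤ C := by
  refine ⟨∑' k, heatDecay k t * √2 * 2, tsum_nonneg fun k => mul_nonneg (mul_nonneg
    (heatDecay_pos k t).le (Real.sqrt_nonneg 2)) zero_le_two, fun p hp => ?_⟩
  exact tsum_of_norm_bounded (((summable_heatDecay ht).mul_right _).mul_right _).hasSum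
    fun k => norm_flowMap_term_le k hp

theorem flowMap_apply {t : ℝ} (ht : 0 < t) (x : I) (z : H2) :
    flowMap (t, x) z = heatFlow z t x := by
  have h := hasSum_integral_heatKernel_smul ht x (integrable_coeFn z)
  have h2 := ((ContinuousLinearMap.apply ℝ Plane z).hasSum (summable_flowMap (p := (t, x)) ht).hasSum)
  rw [heatFlow, ← h.tsum_eq]
  simp_rw [← modeMap_eq]
  exact h2.tsum_eq.symm

theorem aestronglyMeasurable_flowMap {μ : Measure (ℝ × I)} (hμ : ∀ᵐ p ∂μ, 0 < p.1) :
    AEStronglyMeasurable flowMap μ := by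
  refine aestronglyMeasurable_of_tendsto_ae atTop
    (f := fun n p => ∑ k ∈ Finset.range n, heatCoef k p.1 p.2 • modeMap k) (fun n => ?_) ?_
  · refine Continuous.aestronglyMeasurable ?_
    refine continuous_finsetSum _ fun k _ => Continuous.fun_smul ?_ continuous_const
    exact (continuous_heatCoef k).comp
      (continuous_fst.prodMk (continuous_subtype_val.comp continuous_snd))
  · filter_upwards [hμ] with p hp
    exact (summable_flowMap hp).hasSum.tendsto_sum_nat

/-- The `n`-th partial sum of the heat flow, as an element of `L²([0,1], ℝ²)`. -/
def flowSum (n : ℕ) (t : ℝ) (z : H2) : H2 :=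
  ∑ p ∈ Finset.range n ×ˢ Finset.univ, (heatDecay p.1 t * inner ℝ (mode p.1 p.2) z) • mode p.1 p.2

theorem norm_flowSum_le (n : ℕ) {t : ℝ} (ht : 0 ≤ t) (z : H2) : ‖flowSum n t z‖ ≤ ‖z‖ := by
  rw [← sq_le_sq₀ (norm_nonneg _) (norm_nonneg _)]
  refine le_trans ?_ (orthonormal_mode.sum_inner_products_le (s := Finset.range n ×ˢ Finset.univ) z)
  rw [← real_inner_self_eq_norm_sq, flowSum, orthonormal_mode.inner_sum]
  refine Finset.sum_le_sum fun p _ => ?_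
  simp only [RCLike.conj_to_real]
  rw [Real.norm_eq_abs, sq_abs]
  have h1 := heatDecay_le_one p.1 ht
  have h0 := (heatDecay_pos p.1 t).le
  nlinarith [mul_le_one₀ h1 h0 h1, sq_nonneg (inner ℝ (mode p.1 p.2) z)]

theorem coeFn_flowSum (n : ℕ) (t : ℝ) (z : H2) : flowSum n t z =ᵐ[volume] fun x : I =>
    ∑ k ∈ Finset.range n, heatCoef k t x • modeMap k z := by
  have h : ∀ᵐ x : I, ∀ p : ℕ × Fin 2, mode p.1 p.2 x = modeFun p.1 p.2 x :=
    ae_all_iff.2 fun p => coeFn_mode p.1 p.2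
  refine (Lp.coeFn_finsetSum _ _).trans ?_
  have h2 : ∀ᵐ x : I, ∀ p : ℕ × Fin 2, ((heatDecay p.1 t * inner ℝ (mode p.1 p.2) z) •
      mode p.1 p.2 : H2) x = (heatDecay p.1 t * inner ℝ (mode p.1 p.2) z) • mode p.1 p.2 x :=
    ae_all_iff.2 fun p => Lp.coeFn_smul _ _
  filter_upwards [h, h2] with x hx hx2
  rw [Finset.sum_apply]
  simp_rw [hx2, hx]
  rw [Finset.sum_product]
  refine Finset.sum_congr rfl fun k _ => ?_
  ext i
  fin_cases i <;> simp [Fin.sum_univ_two, modeFun, heatCoef, modeMap_apply] <;> ring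

theorem lintegral_heatFlow_sq_le {t : ℝ} (ht : 0 < t) (z : H2) :
    ∫⁻ x : I, ‖flowMap (t, x) z‖ₑ ^ 2 ≤ ‖z‖ₑ ^ 2 := by
  have hlim : ∀ x : I, Tendsto (fun n => ‖∑ k ∈ Finset.range n, heatCoef k t x • modeMap k z‖ₑ ^ 2)
      atTop (𝓝 (‖flowMap (t, x) z‖ₑ ^ 2)) := by
    intro x
    have h2 := ((ContinuousLinearMap.apply ℝ Plane z).hasSum
      (summable_flowMap (p := (t, x)) ht).hasSum).tendsto_sum_nat
    exact ((ENNReal.continuous_pow 2).tendsto _).comp ((continuous_enorm.tendsto _).comp h2)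
  have hmeas : ∀ n, Measurable fun x : I =>
      ‖∑ k ∈ Finset.range n, heatCoef k t x • modeMap k z‖ₑ ^ 2 := by
    intro n
    refine (Continuous.measurable ?_)
    refine (ENNReal.continuous_pow 2).comp (continuous_enorm.comp ?_)
    refine continuous_finsetSum _ fun k _ => Continuous.fun_smul ?_ continuous_const
    exact (continuous_heatCoef k).comp (continuous_const.prodMk continuous_subtype_val)
  calc ∫⁻ x : I, ‖flowMap (t, x) z‖ₑ ^ 2
      = ∫⁻ x : I, liminf (fun n => ‖∑ k ∈ Finset.range n, heatCoef k t x • modeMap k z‖ₑ ^ 2)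
        atTop := lintegral_congr fun x => (hlim x).liminf_eq.symm
    _ ≤ liminf (fun n => ∫⁻ x : I, ‖∑ k ∈ Finset.range n, heatCoef k t x • modeMap k z‖ₑ ^ 2)
        atTop := lintegral_liminf_le hmeas
    _ ≤ ‖z‖ₑ ^ 2 := by
      refine liminf_le_of_frequently_le' (Frequently.of_forall fun n => ?_)
      have h : ∫⁻ x : I, ‖∑ k ∈ Finset.range n, heatCoef k t x • modeMap k z‖ₑ ^ 2
          = ‖flowSum n t z‖ₑ ^ 2 := by
        rw [Lp.enorm_def, eLpNorm_eq_lintegral_rpow_enorm_toReal two_ne_zero ENNReal.ofNat_ne_top]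
        rw [← ENNReal.rpow_natCast, ← ENNReal.rpow_mul]
        simp only [ENNReal.toReal_ofNat, Nat.cast_ofNat, one_div, inv_mul_cancel₀ (two_ne_zero (α := ℝ)),
          ENNReal.rpow_one]
        refine lintegral_congr_ae ?_
        filter_upwards [coeFn_flowSum n t z] with x hx
        rw [hx]; norm_cast
      rw [h]
      refine pow_le_pow_left' ?_ 2
      rw [enorm_le_iff_norm_le]
      exact norm_flowSum_le n ht.le z

/-! ### The covariance `heatVar` -/

theorem summable_inv_eigenval : Summable fun k : ℕ => 2 / eigenval (k + 1) := by
  have h : Summable fun k : ℕ => 2 * (1 / ((k + 1 : ℕ) : ℝ) ^ 2) :=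
    ((summable_nat_add_iff 1).2 (Real.summable_one_div_nat_pow.2 one_lt_two)).mul_left 2
  refine h.of_nonneg_of_le (fun k => (div_pos two_pos (eigenval_pos k)).le) fun k => ?_
  rw [div_eq_mul_one_div]
  refine mul_le_mul_of_nonneg_left (one_div_le_one_div_of_le (by positivity) ?_) zero_le_two
  have := Real.pi_gt_three
  rw [eigenval]
  exact le_mul_of_one_le_right (sq_nonneg _) (by nlinarith)

theorem integral_exp_neg_mul {c : ℝ} (hc : c ≠ 0) (t : ℝ) :
    ∫ τ in (0 : ℝ)..t, Real.exp (-c * τ) = (1 - Real.exp (-c * t)) / c := by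
  rw [intervalIntegral.integral_comp_mul_left _ (neg_ne_zero.2 hc), integral_exp]
  simp only [mul_zero, Real.exp_zero, smul_eq_mul]
  field_simp
  ring

theorem one_sub_exp_div_eigenval_nonneg (k : ℕ) {t : ℝ} (ht : 0 ≤ t) :
    0 ≤ (1 - Real.exp (-eigenval (k + 1) * t)) / eigenval (k + 1) := by
  have h := eigenval_pos k
  refine div_nonneg (sub_nonneg.2 (Real.exp_le_one_iff.2 ?_)) h.le
  nlinarith

theorem hasSum_heatVar {t : ℝ} (ht : 0 ≤ t) (r : ℝ) :
    HasSum (fun k => (1 - Real.exp (-eigenval (k + 1) * t)) / eigenval (k + 1) *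
      eigenfun (k + 1) r ^ 2) (heatVar t r) := by
  have hint : ∀ k : ℕ, Integrable (fun τ => Real.exp (-eigenval (k + 1) * τ) *
      eigenfun (k + 1) r ^ 2) (volume.restrict (Ioc 0 t)) := fun k =>
    (Continuous.integrableOn_Ioc (by fun_prop))
  have hval : ∀ k : ℕ, ∫ τ in Ioc 0 t, Real.exp (-eigenval (k + 1) * τ) *
      eigenfun (k + 1) r ^ 2 = (1 - Real.exp (-eigenval (k + 1) * t)) / eigenval (k + 1) *
      eigenfun (k + 1) r ^ 2 := by
    intro k
    rw [integral_mul_const, ← intervalIntegral.integral_of_le ht,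
      integral_exp_neg_mul (eigenval_pos k).ne']
  have h := hasSum_integral_of_summable_integral_norm hint ?_
  · simp_rw [hval] at h
    suffices e : heatVar t r = ∫ τ in Ioc 0 t, ∑' k : ℕ, Real.exp (-eigenval (k + 1) * τ) *
        eigenfun (k + 1) r ^ 2 by
      rw [e]
      exact h
    rw [heatVar, intervalIntegral.integral_of_le ht]
    refine integral_congr_ae (Eventually.of_forall fun τ => ?_)
    simp only [heatKernel_eq, heatCoef, heatDecay]
    refine tsum_congr fun k => ?_
    rw [show -(eigenval (k + 1) / 2) * (2 * τ) = -eigenval (k + 1) * τ by ring]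
    ring
  · refine Summable.of_nonneg_of_le (fun k => integral_nonneg fun τ => norm_nonneg _) (fun k => ?_)
      summable_inv_eigenval
    have e : ∀ τ, ‖Real.exp (-eigenval (k + 1) * τ) * eigenfun (k + 1) r ^ 2‖ =
        Real.exp (-eigenval (k + 1) * τ) * eigenfun (k + 1) r ^ 2 := fun τ =>
      Real.norm_of_nonneg (by positivity)
    simp_rw [e]
    rw [hval, div_mul_eq_mul_div, div_le_div_iff_of_pos_right (eigenval_pos k), eigenfun_sq]
    nlinarith [Real.exp_pos (-eigenval (k + 1) * t), Real.sin_sq_le_one (((k + 1 : ℕ) : ℝ) * Real.pi * r),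
      sq_nonneg (Real.sin (((k + 1 : ℕ) : ℝ) * Real.pi * r))]

theorem heatVar_mono {s t : ℝ} (hs : 0 ≤ s) (hst : s ≤ t) (r : ℝ) : heatVar s r ≤ heatVar t r := by
  refine hasSum_le (fun k => ?_) (hasSum_heatVar hs r) (hasSum_heatVar (hs.trans hst) r)
  have h := eigenval_pos k
  refine mul_le_mul_of_nonneg_right ?_ (sq_nonneg _)
  rw [div_le_div_iff_of_pos_right h]
  refine sub_le_sub_left (Real.exp_le_exp.2 ?_) _
  nlinarith

theorem sq_sin_le_sin_succ_add_sin (θ : ℝ) (k : ℕ) :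
    Real.sin θ ^ 2 ≤ 2 * (Real.sin ((k + 1 : ℕ) * θ) ^ 2 + Real.sin (k * θ) ^ 2) := by
  have h : Real.sin θ = Real.sin ((k + 1 : ℕ) * θ) * Real.cos (k * θ) -
      Real.cos ((k + 1 : ℕ) * θ) * Real.sin (k * θ) := by
    rw [← Real.sin_sub]; push_cast; ring_nf
  set a := Real.sin ((k + 1 : ℕ) * θ)
  set b := Real.sin (k * θ)
  set c := Real.cos (k * θ)
  set d := Real.cos ((k + 1 : ℕ) * θ)
  have hc : c ^ 2 ≤ 1 := Real.cos_sq_le_one _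
  have hd : d ^ 2 ≤ 1 := Real.cos_sq_le_one _
  rw [h]
  nlinarith [sq_nonneg (a * c + d * b), mul_le_mul_of_nonneg_left hc (sq_nonneg a),
    mul_le_mul_of_nonneg_left hd (sq_nonneg b)]

theorem sum_sin_sq_ge (θ : ℝ) (N : ℕ) :
    N * Real.sin θ ^ 2 / 4 ≤ ∑ k ∈ Finset.range N, Real.sin ((k + 1 : ℕ) * θ) ^ 2 := by
  have h : N * Real.sin θ ^ 2 ≤ ∑ k ∈ Finset.range N,
      2 * (Real.sin ((k + 1 : ℕ) * θ) ^ 2 + Real.sin (k * θ) ^ 2) := by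
    have := Finset.sum_le_sum fun k (_ : k ∈ Finset.range N) => sq_sin_le_sin_succ_add_sin θ k
    simpa using this
  have h2 : ∑ k ∈ Finset.range N, Real.sin (k * θ) ^ 2 ≤
      ∑ k ∈ Finset.range N, Real.sin ((k + 1 : ℕ) * θ) ^ 2 := by
    have := Finset.sum_range_succ' (fun k : ℕ => Real.sin (k * θ) ^ 2) N
    rw [Finset.sum_range_succ] at this
    simp only [Nat.cast_zero, zero_mul, Real.sin_zero] at this
    nlinarith [sq_nonneg (Real.sin (N * θ))]
  rw [← Finset.mul_sum, Finset.sum_add_distrib] at h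
  linarith

theorem half_le_one_sub_exp_neg {x : ℝ} (h0 : 0 ≤ x) (h1 : x ≤ 1) : x / 2 ≤ 1 - Real.exp (-x) := by
  have h2 : Real.exp (-x) ≤ 1 / (1 + x) := by
    rw [Real.exp_neg, ← one_div]
    exact one_div_le_one_div_of_le (by linarith) (by linarith [Real.add_one_le_exp x])
  have h3 : 1 / (1 + x) ≤ 1 - x / 2 := by
    rw [div_le_iff₀ (by linarith)]; nlinarith
  linarith

theorem heatVar_ge_nat_mul {t : ℝ} (ht : 0 ≤ t) (r : ℝ) {N : ℕ}
    (hN : (N : ℝ) ^ 2 * Real.pi ^ 2 * t ≤ 1) :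
    t * (N * Real.sin (Real.pi * r) ^ 2 / 4) ≤ heatVar t r := by
  refine le_trans (mul_le_mul_of_nonneg_left (sum_sin_sq_ge _ N) ht) ?_
  refine le_trans ?_ (sum_le_hasSum (Finset.range N) (fun k _ =>
    mul_nonneg (one_sub_exp_div_eigenval_nonneg k ht) (sq_nonneg _)) (hasSum_heatVar ht r))
  rw [Finset.mul_sum]
  refine Finset.sum_le_sum fun k hk => ?_
  have hk' : ((k + 1 : ℕ) : ℝ) ≤ N := Nat.cast_le.2 (Finset.mem_range.1 hk)
  have hle : eigenval (k + 1) * t ≤ 1 := by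
    refine le_trans ?_ hN
    rw [eigenval]
    gcongr
  have h := half_le_one_sub_exp_neg (mul_nonneg (eigenval_pos k).le ht) hle
  have h' : t / 2 ≤ (1 - Real.exp (-eigenval (k + 1) * t)) / eigenval (k + 1) := by
    rw [le_div_iff₀ (eigenval_pos k), neg_mul]
    linarith
  rw [eigenfun_sq, ← mul_assoc _ Real.pi r]
  nlinarith [sq_nonneg (Real.sin (((k + 1 : ℕ) : ℝ) * Real.pi * r))]

theorem heatVar_ge_of_le {t : ℝ} (ht : 0 < t) (ht1 : t ≤ 1 / Real.pi ^ 2) (r : ℝ) :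
    √t * Real.sin (Real.pi * r) ^ 2 / (8 * Real.pi) ≤ heatVar t r := by
  have hs : 0 < √t := Real.sqrt_pos.2 ht
  have hpi := Real.pi_pos
  have hss : √t * √t = t := Real.mul_self_sqrt ht.le
  have hps : Real.pi * √t ≤ 1 := by
    rw [le_div_iff₀ (by positivity)] at ht1
    by_contra! hlt
    nlinarith
  set x := 1 / (Real.pi * √t) with hx
  have hx1 : 1 ≤ x := by rw [hx, le_div_iff₀ (by positivity)]; linarith
  have hfl : (⌊x⌋₊ : ℝ) ≤ x := Nat.floor_le (by positivity)
  have hfg : x / 2 ≤ ⌊x⌋₊ := by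
    have h1 : (1 : ℝ) ≤ ⌊x⌋₊ := by exact_mod_cast (Nat.one_le_floor_iff x).2 hx1
    linarith [Nat.lt_floor_add_one x]
  have hxx : x * (Real.pi * √t) = 1 := by rw [hx]; field_simp
  refine le_trans ?_ (heatVar_ge_nat_mul ht.le r (N := ⌊x⌋₊) ?_)
  · calc √t * Real.sin (Real.pi * r) ^ 2 / (8 * Real.pi)
        = t * (x / 2 * Real.sin (Real.pi * r) ^ 2 / 4) := by
          have h1 : √t * x = 1 / Real.pi := by rw [hx]; field_simp
          linear_combination (-√t * Real.sin (Real.pi * r) ^ 2 / 8) * h1 +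
            (x * Real.sin (Real.pi * r) ^ 2 / 8) * hss
      _ ≤ _ := by gcongr
  · calc (⌊x⌋₊ : ℝ) ^ 2 * Real.pi ^ 2 * t ≤ x ^ 2 * Real.pi ^ 2 * t := by gcongr
      _ = (x * (Real.pi * √t)) ^ 2 := by nth_rewrite 1 [← hss]; ring
      _ ≤ 1 := by rw [hxx]; norm_num

theorem heatVar_ge {t : ℝ} (ht : 0 < t) (r : ℝ) :
    min (√t) 1 * Real.sin (Real.pi * r) ^ 2 / (8 * Real.pi ^ 2) ≤ heatVar t r := by
  have hpi := Real.pi_gt_three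
  have hsin := sq_nonneg (Real.sin (Real.pi * r))
  rcases le_total t (1 / Real.pi ^ 2) with h | h
  · refine le_trans ?_ (heatVar_ge_of_le ht h r)
    refine div_le_div₀ (by positivity) ?_ (by positivity) (by nlinarith)
    exact mul_le_mul_of_nonneg_right (min_le_left _ _) hsin
  · refine le_trans ?_ (heatVar_mono (by positivity) h r)
    refine le_trans ?_ (heatVar_ge_of_le (by positivity) le_rfl r)
    have : √(1 / Real.pi ^ 2) = 1 / Real.pi := by
      rw [Real.sqrt_eq_iff_eq_sq (by positivity) (by positivity)]; ring
    rw [this]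
    have e : 1 / Real.pi * Real.sin (Real.pi * r) ^ 2 / (8 * Real.pi) =
        1 * Real.sin (Real.pi * r) ^ 2 / (8 * Real.pi ^ 2) := by field_simp
    rw [e]
    gcongr
    exact min_le_right _ _

/-- The inverse standard deviation `(heatVar t r)^{-1/2}`. -/
def invStd (p : ℝ × I) : ℝ := (√(heatVar p.1 p.2))⁻¹

theorem invStd_nonneg (p : ℝ × I) : 0 ≤ invStd p := inv_nonneg.2 (Real.sqrt_nonneg _)

theorem aemeasurable_invStd {μ : Measure (ℝ × I)} (hμ : ∀ᵐ p ∂μ, 0 < p.1) :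
    AEMeasurable invStd μ := by
  refine AEMeasurable.inv (AEMeasurable.sqrt ?_)
  refine AEMeasurable.congr (f := fun p : ℝ × I => ∑' k : ℕ,
    (1 - Real.exp (-eigenval (k + 1) * p.1)) / eigenval (k + 1) * eigenfun (k + 1) p.2 ^ 2) ?_ ?_
  · refine (Measurable.tsum fun k => ?_).aemeasurable
    have := (continuous_eigenfun (k + 1)).comp (continuous_subtype_val.comp
      (continuous_snd : Continuous fun p : ℝ × I => p.2))
    refine Measurable.mul (by fun_prop) (this.measurable.pow_const 2)
  · filter_upwards [hμ] with p hp
    exact (hasSum_heatVar hp.le _).tsum_eq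

theorem invStd_sq_mul {p : ℝ × I} (hp : 0 < heatVar p.1 p.2) : invStd p ^ 2 = 1 / heatVar p.1 p.2 := by
  rw [invStd, inv_pow, Real.sq_sqrt hp.le, one_div]

theorem heatVar_pos {t : ℝ} (ht : 0 < t) {r : ℝ} (hr : Real.sin (Real.pi * r) ≠ 0) :
    0 < heatVar t r := by
  refine lt_of_lt_of_le ?_ (heatVar_ge ht r)
  have : 0 < min (√t) 1 := lt_min (Real.sqrt_pos.2 ht) one_pos
  positivity

theorem invStd_le {c : ℝ} (hc : 0 < c) : ∃ C : ℝ, 0 < C ∧ ∀ p : ℝ × I, 0 < p.1 →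
    c ≤ Real.sin (Real.pi * p.2) ^ 2 → invStd p ≤ C * max 1 (p.1 ^ (-(1 / 4) : ℝ)) := by
  have hpi := Real.pi_pos
  refine ⟨(√(c / (8 * Real.pi ^ 2)))⁻¹, by positivity, fun p hp hr => ?_⟩
  have hm : 0 < min (√p.1) 1 := lt_min (Real.sqrt_pos.2 hp) one_pos
  have h : min (√p.1) 1 * (c / (8 * Real.pi ^ 2)) ≤ heatVar p.1 p.2 := by
    refine le_trans ?_ (heatVar_ge hp p.2)
    rw [← mul_div_assoc]
    gcongr
  have h2 : √(min (√p.1) 1) * √(c / (8 * Real.pi ^ 2)) ≤ √(heatVar p.1 p.2) := by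
    rw [← Real.sqrt_mul hm.le]
    exact Real.sqrt_le_sqrt h
  have h3 : (√(min (√p.1) 1))⁻¹ ≤ max 1 (p.1 ^ (-(1 / 4) : ℝ)) := by
    rcases le_total (√p.1) 1 with h1 | h1
    · rw [min_eq_left h1]
      refine le_trans (le_of_eq ?_) (le_max_right _ _)
      rw [Real.sqrt_eq_rpow, Real.sqrt_eq_rpow, ← Real.rpow_mul hp.le, ← Real.rpow_neg hp.le]
      norm_num
    · rw [min_eq_right h1]; simp
  calc invStd p ≤ (√(min (√p.1) 1) * √(c / (8 * Real.pi ^ 2)))⁻¹ := by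
        rw [invStd]
        exact inv_anti₀ (by positivity) h2
    _ = (√(c / (8 * Real.pi ^ 2)))⁻¹ * (√(min (√p.1) 1))⁻¹ := by rw [mul_inv, mul_comm]
    _ ≤ _ := by gcongr

/-! ### Second differences of the Gaussian -/

/-- The second symmetric difference `f (x - u) + f (x + u) - 2 f x`. -/
def secDiff {F : Type*} [AddCommGroup F] [Module ℝ F] (f : Plane → F) (u x : Plane) : F :=
  f (x - u) + f (x + u) - (2 : ℝ) • f x

/-- The function `exp (-‖x‖² / 2)`. -/
def gaussFun (x : Plane) : ℝ := Real.exp (-(‖x‖ ^ 2 / 2))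

/-- The derivative of `gaussFun`. -/
def gaussDeriv (x : Plane) : Plane →L[ℝ] ℝ := -(gaussFun x) • innerSL ℝ x

theorem gaussFun_pos (x : Plane) : 0 < gaussFun x := Real.exp_pos _

theorem gaussFun_le_one (x : Plane) : gaussFun x ≤ 1 :=
  Real.exp_le_one_iff.2 (neg_nonpos.2 (by positivity))

theorem norm_gaussDeriv (x : Plane) : ‖gaussDeriv x‖ = gaussFun x * ‖x‖ := by
  rw [gaussDeriv, norm_smul, norm_neg, Real.norm_of_nonneg (gaussFun_pos x).le, innerSL_apply_norm]

theorem continuous_gaussFun : Continuous gaussFun := by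
  unfold gaussFun; fun_prop

theorem continuous_gaussDeriv : Continuous gaussDeriv :=
  (continuous_gaussFun.neg).smul (innerSL ℝ).continuous

theorem hasFDerivAt_gaussFun (x : Plane) : HasFDerivAt gaussFun (gaussDeriv x) x := by
  have h0 : HasFDerivAt (fun y : Plane => ‖y‖ ^ 2) (2 • innerSL ℝ x) x :=
    (hasStrictFDerivAt_norm_sq x).hasFDerivAt
  have h1 : HasFDerivAt (fun y : Plane => -(‖y‖ ^ 2 / 2)) (-((1 / 2 : ℝ) • (2 • innerSL ℝ x))) x :=
    (h0.const_mul (1 / 2 : ℝ)).neg.congr_of_eventuallyEq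
      (Eventually.of_forall fun y => by simp only [Pi.neg_apply]; ring)
  refine h1.exp.congr_fderiv ?_
  ext w
  simp [gaussDeriv, gaussFun]

theorem continuous_secDiff {F : Type*} [NormedAddCommGroup F] [NormedSpace ℝ F] {f : Plane → F}
    (hf : Continuous f) : Continuous fun p : Plane × Plane => secDiff f p.1 p.2 := by
  unfold secDiff; fun_prop

theorem gaussFun_sub (x u : Plane) :
    gaussFun (x - u) = gaussFun x * (Real.exp (-(‖u‖ ^ 2 / 2)) * Real.exp (inner ℝ x u)) := by
  rw [gaussFun, gaussFun, ← Real.exp_add, ← Real.exp_add, norm_sub_sq_real]; ring_nf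

theorem gaussFun_add (x u : Plane) :
    gaussFun (x + u) = gaussFun x * (Real.exp (-(‖u‖ ^ 2 / 2)) * Real.exp (-inner ℝ x u)) := by
  rw [gaussFun, gaussFun, ← Real.exp_add, ← Real.exp_add, norm_add_sq_real]; ring_nf

theorem abs_exp_sub_exp_neg_le (c : ℝ) : |Real.exp c - Real.exp (-c)| ≤ 2 * |c| * Real.exp |c| := by
  wlog hc : 0 ≤ c generalizing c
  · have := this (-c) (by linarith)
    rwa [neg_neg, abs_sub_comm, abs_neg] at this
  have h : Real.exp (-c) = Real.exp c * Real.exp (-(2 * c)) := by rw [← Real.exp_add]; ring_nf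
  have h2 := Real.add_one_le_exp (-(2 * c))
  rw [abs_of_nonneg hc, abs_of_nonneg (sub_nonneg.2 (Real.exp_le_exp.2 (by linarith))), h]
  nlinarith [Real.exp_pos c]

theorem exp_add_exp_neg_sub_two (c : ℝ) :
    0 ≤ Real.exp c + Real.exp (-c) - 2 ∧ Real.exp c + Real.exp (-c) - 2 ≤ c ^ 2 * Real.exp |c| := by
  have h : Real.exp c + Real.exp (-c) - 2 = (Real.exp (c / 2) - Real.exp (-(c / 2))) ^ 2 := by
    have h1 : Real.exp c = Real.exp (c / 2) ^ 2 := by rw [← Real.exp_nat_mul]; ring_nf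
    have h2 : Real.exp (-c) = Real.exp (-(c / 2)) ^ 2 := by rw [← Real.exp_nat_mul]; ring_nf
    have h3 : Real.exp (c / 2) * Real.exp (-(c / 2)) = 1 := by rw [← Real.exp_add]; simp
    rw [h1, h2]; linear_combination 2 * h3
  rw [h]
  refine ⟨sq_nonneg _, ?_⟩
  have h2 := abs_exp_sub_exp_neg_le (c / 2)
  rw [← sq_abs (Real.exp _ - _)]
  refine (pow_le_pow_left₀ (abs_nonneg _) h2 2).trans (le_of_eq ?_)
  rw [abs_div, abs_two, mul_pow, ← Real.exp_nat_mul, mul_pow, div_pow, sq_abs]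
  push_cast
  ring_nf

theorem exp_sub_sq_le {y : ℝ} (hy : 0 ≤ y) :
    (1 + y) ^ 4 * Real.exp (y - y ^ 2 / 2) ≤ 24 * Real.exp 3 := by
  have h := Real.pow_div_factorial_le_exp (1 + y) (by linarith) 4
  have h4 : ((4 : ℕ).factorial : ℝ) = 24 := by norm_num [Nat.factorial]
  rw [h4, div_le_iff₀ (by norm_num)] at h
  calc (1 + y) ^ 4 * Real.exp (y - y ^ 2 / 2) ≤ (Real.exp (1 + y) * 24) * Real.exp (2 - y) := by
        refine mul_le_mul h (Real.exp_le_exp.2 (by nlinarith [sq_nonneg (y - 2)])) (by positivity)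
          (by positivity)
    _ = 24 * Real.exp 3 := by
        rw [mul_comm _ (24 : ℝ), mul_assoc, ← Real.exp_add]; ring_nf

theorem abs_secDiff_gaussFun_le_of_le_one {u x : Plane} (hu : ‖u‖ ≤ 1) :
    |secDiff gaussFun u x| ≤ ‖u‖ ^ 2 * (1 + ‖x‖ ^ 2) * Real.exp (‖x‖ - ‖x‖ ^ 2 / 2) := by
  have hc : |inner ℝ x u| ≤ ‖x‖ * ‖u‖ := abs_real_inner_le_norm x u
  have hc1 : |inner ℝ x u| ≤ ‖x‖ := hc.trans (mul_le_of_le_one_right (norm_nonneg _) hu)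
  set c := inner ℝ x u
  have hE : Real.exp |c| ≤ Real.exp ‖x‖ := Real.exp_le_exp.2 hc1
  obtain ⟨h1, h2⟩ := exp_add_exp_neg_sub_two c
  have hb := Real.add_one_le_exp (-(‖u‖ ^ 2 / 2))
  have hb1 : Real.exp (-(‖u‖ ^ 2 / 2)) ≤ 1 := Real.exp_le_one_iff.2 (neg_nonpos.2 (by positivity))
  have e : secDiff gaussFun u x = gaussFun x *
      ((Real.exp c + Real.exp (-c) - 2) -
        (1 - Real.exp (-(‖u‖ ^ 2 / 2))) * (Real.exp c + Real.exp (-c))) := by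
    rw [secDiff, gaussFun_sub, gaussFun_add, smul_eq_mul]; ring
  have hs : Real.exp c + Real.exp (-c) ≤ 2 * Real.exp |c| := by
    have := Real.exp_le_exp.2 (le_abs_self c)
    have := Real.exp_le_exp.2 (neg_le_abs c)
    linarith
  have hc2 : c ^ 2 ≤ ‖x‖ ^ 2 * ‖u‖ ^ 2 := by
    rw [← mul_pow, ← sq_abs]; exact pow_le_pow_left₀ (abs_nonneg _) hc 2
  have key : |(Real.exp c + Real.exp (-c) - 2) -
        (1 - Real.exp (-(‖u‖ ^ 2 / 2))) * (Real.exp c + Real.exp (-c))| ≤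
      ‖u‖ ^ 2 * (1 + ‖x‖ ^ 2) * Real.exp ‖x‖ := by
    refine (abs_sub _ _).trans ?_
    rw [abs_of_nonneg h1, abs_of_nonneg (mul_nonneg (by linarith) (by positivity))]
    have t1 : c ^ 2 * Real.exp |c| ≤ ‖x‖ ^ 2 * ‖u‖ ^ 2 * Real.exp ‖x‖ :=
      mul_le_mul hc2 hE (by positivity) (by positivity)
    have t2 : (1 - Real.exp (-(‖u‖ ^ 2 / 2))) * (Real.exp c + Real.exp (-c)) ≤
        ‖u‖ ^ 2 / 2 * (2 * Real.exp ‖x‖) :=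
      mul_le_mul (by linarith) (by linarith) (by positivity) (by positivity)
    linarith
  rw [e, abs_mul, abs_of_pos (gaussFun_pos x), sub_eq_add_neg ‖x‖, Real.exp_add]
  calc _ ≤ gaussFun x * (‖u‖ ^ 2 * (1 + ‖x‖ ^ 2) * Real.exp ‖x‖) :=
        mul_le_mul_of_nonneg_left key (gaussFun_pos x).le
    _ = _ := by rw [gaussFun]; ring

theorem norm_secDiff_gaussDeriv_le_of_le_one {u x : Plane} (hu : ‖u‖ ≤ 1) :
    ‖secDiff gaussDeriv u x‖ ≤
      ‖u‖ ^ 2 * (‖x‖ * (3 + ‖x‖ ^ 2)) * Real.exp (‖x‖ - ‖x‖ ^ 2 / 2) := by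
  have e : secDiff gaussDeriv u x = (-(secDiff gaussFun u x)) • innerSL ℝ x +
      (gaussFun (x - u) - gaussFun (x + u)) • innerSL ℝ u := by
    ext w
    simp [secDiff, gaussDeriv]
    ring
  have hc : |inner ℝ x u| ≤ ‖x‖ * ‖u‖ := abs_real_inner_le_norm x u
  have hc1 : |inner ℝ x u| ≤ ‖x‖ := hc.trans (mul_le_of_le_one_right (norm_nonneg _) hu)
  have h1 := abs_secDiff_gaussFun_le_of_le_one (x := x) hu
  have hb1 : Real.exp (-(‖u‖ ^ 2 / 2)) ≤ 1 := Real.exp_le_one_iff.2 (neg_nonpos.2 (by positivity))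
  have h2 : |gaussFun (x - u) - gaussFun (x + u)| ≤
      2 * ‖x‖ * ‖u‖ * Real.exp (‖x‖ - ‖x‖ ^ 2 / 2) := by
    rw [gaussFun_sub, gaussFun_add, ← mul_sub, ← mul_sub, abs_mul, abs_mul,
      abs_of_pos (gaussFun_pos x), abs_of_pos (Real.exp_pos _), sub_eq_add_neg ‖x‖, Real.exp_add]
    calc gaussFun x * (Real.exp (-(‖u‖ ^ 2 / 2)) * |Real.exp (inner ℝ x u) - Real.exp (-inner ℝ x u)|)
        ≤ gaussFun x * (1 * (2 * (‖x‖ * ‖u‖) * Real.exp ‖x‖)) := by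
          refine mul_le_mul_of_nonneg_left (mul_le_mul hb1 ?_ (abs_nonneg _) zero_le_one)
            (gaussFun_pos x).le
          refine (abs_exp_sub_exp_neg_le _).trans ?_
          refine mul_le_mul (by linarith) (Real.exp_le_exp.2 hc1) (by positivity) (by positivity)
      _ = _ := by rw [gaussFun]; ring
  rw [e]
  refine (norm_add_le _ _).trans ?_
  rw [norm_smul, norm_smul, norm_neg, innerSL_apply_norm, innerSL_apply_norm, Real.norm_eq_abs,
    Real.norm_eq_abs]
  have h1' := mul_le_mul_of_nonneg_right h1 (norm_nonneg x)
  have h2' := mul_le_mul_of_nonneg_right h2 (norm_nonneg u)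
  linarith

/-- The modulus `min r² r^{1/4}` bounding the second differences of the Gaussian. -/
def modulus (r : ℝ) : ℝ := min (r ^ 2) (r ^ (1 / 4 : ℝ))

theorem modulus_of_le_one {r : ℝ} (h0 : 0 ≤ r) (h1 : r ≤ 1) : modulus r = r ^ 2 := by
  refine min_eq_left ?_
  rw [← Real.rpow_natCast]
  exact Real.rpow_le_rpow_of_exponent_ge' h0 h1 (by norm_num) (by norm_num)

theorem modulus_of_one_le {r : ℝ} (h1 : 1 ≤ r) : modulus r = r ^ (1 / 4 : ℝ) := by
  refine min_eq_right ?_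
  rw [← Real.rpow_natCast]
  exact Real.rpow_le_rpow_of_exponent_le h1 (by norm_num)

theorem modulus_nonneg {r : ℝ} (h : 0 ≤ r) : 0 ≤ modulus r :=
  le_min (sq_nonneg r) (Real.rpow_nonneg h _)

theorem rpow_quarter_mul_norm_gaussDeriv_le {u x w : Plane} (hw : ‖x‖ ≤ ‖w‖ + ‖u‖) (hu : 1 ≤ ‖u‖) :
    (1 + ‖x‖) ^ (1 / 4 : ℝ) * ‖gaussDeriv w‖ ≤ 48 * Real.exp 3 * ‖u‖ ^ (1 / 4 : ℝ) := by
  have h1 : (1 + ‖x‖) ^ (1 / 4 : ℝ) ≤ (1 + ‖w‖) * (2 * ‖u‖ ^ (1 / 4 : ℝ)) := by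
    calc (1 + ‖x‖) ^ (1 / 4 : ℝ) ≤ ((1 + ‖w‖) * (2 * ‖u‖)) ^ (1 / 4 : ℝ) := by
          refine Real.rpow_le_rpow (by positivity) ?_ (by norm_num)
          nlinarith [norm_nonneg w]
      _ = (1 + ‖w‖) ^ (1 / 4 : ℝ) * (2 ^ (1 / 4 : ℝ) * ‖u‖ ^ (1 / 4 : ℝ)) := by
          rw [Real.mul_rpow (by positivity) (by positivity),
            Real.mul_rpow (by positivity) (by positivity)]
      _ ≤ _ := by
          have a1 : (1 + ‖w‖) ^ (1 / 4 : ℝ) ≤ (1 + ‖w‖) ^ (1 : ℝ) :=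
            Real.rpow_le_rpow_of_exponent_le (by linarith [norm_nonneg w]) (by norm_num)
          have a2 : (2 : ℝ) ^ (1 / 4 : ℝ) ≤ 2 ^ (1 : ℝ) :=
            Real.rpow_le_rpow_of_exponent_le (by norm_num) (by norm_num)
          rw [Real.rpow_one] at a1 a2
          gcongr
  have h2 : (1 + ‖w‖) * (gaussFun w * ‖w‖) ≤ 24 * Real.exp 3 := by
    refine le_trans ?_ (exp_sub_sq_le (norm_nonneg w))
    have : gaussFun w ≤ Real.exp (‖w‖ - ‖w‖ ^ 2 / 2) :=
      Real.exp_le_exp.2 (by linarith [norm_nonneg w])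
    calc (1 + ‖w‖) * (gaussFun w * ‖w‖) = ((1 + ‖w‖) * ‖w‖) * gaussFun w := by ring
      _ ≤ (1 + ‖w‖) ^ 4 * Real.exp (‖w‖ - ‖w‖ ^ 2 / 2) := by
        refine mul_le_mul ?_ this (gaussFun_pos w).le (by positivity)
        have := norm_nonneg w
        have : (1 + ‖w‖) ^ 2 ≤ (1 + ‖w‖) ^ 4 := pow_le_pow_right₀ (by linarith) (by norm_num)
        nlinarith
  rw [norm_gaussDeriv]
  calc _ ≤ (1 + ‖w‖) * (2 * ‖u‖ ^ (1 / 4 : ℝ)) * (gaussFun w * ‖w‖) :=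
        mul_le_mul_of_nonneg_right h1 (mul_nonneg (gaussFun_pos w).le (norm_nonneg w))
    _ = 2 * ‖u‖ ^ (1 / 4 : ℝ) * ((1 + ‖w‖) * (gaussFun w * ‖w‖)) := by ring
    _ ≤ 2 * ‖u‖ ^ (1 / 4 : ℝ) * (24 * Real.exp 3) := by gcongr
    _ = _ := by ring

theorem abs_secDiff_gaussFun_le (u x : Plane) :
    |secDiff gaussFun u x| ≤ 200 * Real.exp 3 * modulus ‖u‖ := by
  have hE : 1 ≤ Real.exp 3 := Real.one_le_exp (by norm_num)
  rcases le_total ‖u‖ 1 with hu | hu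
  · rw [modulus_of_le_one (norm_nonneg u) hu]
    refine (abs_secDiff_gaussFun_le_of_le_one hu).trans ?_
    have h := exp_sub_sq_le (norm_nonneg x)
    have h2 : (1 + ‖x‖ ^ 2) ≤ (1 + ‖x‖) ^ 4 := by
      have := norm_nonneg x
      have : (1 + ‖x‖) ^ 2 ≤ (1 + ‖x‖) ^ 4 := pow_le_pow_right₀ (by linarith) (by norm_num)
      nlinarith
    calc _ = ‖u‖ ^ 2 * ((1 + ‖x‖ ^ 2) * Real.exp (‖x‖ - ‖x‖ ^ 2 / 2)) := by ring
      _ ≤ ‖u‖ ^ 2 * (24 * Real.exp 3) := by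
        refine mul_le_mul_of_nonneg_left (le_trans ?_ h) (sq_nonneg _)
        exact mul_le_mul_of_nonneg_right h2 (Real.exp_pos _).le
      _ ≤ _ := by nlinarith [sq_nonneg ‖u‖, mul_nonneg (sq_nonneg ‖u‖) (Real.exp_pos 3).le]
  · rw [modulus_of_one_le hu]
    have h1 : 1 ≤ ‖u‖ ^ (1 / 4 : ℝ) := Real.one_le_rpow hu (by norm_num)
    have h2 : |secDiff gaussFun u x| ≤ 2 := by
      rw [secDiff, smul_eq_mul, abs_le]
      have := gaussFun_pos (x - u); have := gaussFun_pos (x + u); have := gaussFun_pos x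
      have := gaussFun_le_one (x - u); have := gaussFun_le_one (x + u); have := gaussFun_le_one x
      constructor <;> linarith
    nlinarith

theorem norm_secDiff_gaussDeriv_le (u x : Plane) :
    (1 + ‖x‖) ^ (1 / 4 : ℝ) * ‖secDiff gaussDeriv u x‖ ≤ 200 * Real.exp 3 * modulus ‖u‖ := by
  have hx := norm_nonneg x
  rcases le_total ‖u‖ 1 with hu | hu
  · rw [modulus_of_le_one (norm_nonneg u) hu]
    have h := exp_sub_sq_le hx
    have a1 : (1 + ‖x‖) ^ (1 / 4 : ℝ) ≤ (1 + ‖x‖) := by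
      have := Real.rpow_le_rpow_of_exponent_le (x := 1 + ‖x‖) (by linarith)
        (by norm_num : (1 / 4 : ℝ) ≤ 1)
      rwa [Real.rpow_one] at this
    have h2 : (1 + ‖x‖) * (‖x‖ * (3 + ‖x‖ ^ 2)) ≤ 3 * (1 + ‖x‖) ^ 4 := by
      have e : 3 * (1 + ‖x‖) ^ 4 - (1 + ‖x‖) * (‖x‖ * (3 + ‖x‖ ^ 2)) =
        (1 + ‖x‖) * (3 + 6 * ‖x‖ + 9 * ‖x‖ ^ 2 + 2 * ‖x‖ ^ 3) := by ring
      nlinarith [mul_nonneg (by linarith : 0 ≤ 1 + ‖x‖)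
        (by positivity : 0 ≤ 3 + 6 * ‖x‖ + 9 * ‖x‖ ^ 2 + 2 * ‖x‖ ^ 3)]
    calc _ ≤ (1 + ‖x‖) * (‖u‖ ^ 2 * (‖x‖ * (3 + ‖x‖ ^ 2)) * Real.exp (‖x‖ - ‖x‖ ^ 2 / 2)) :=
          mul_le_mul a1 (norm_secDiff_gaussDeriv_le_of_le_one hu) (norm_nonneg _) (by linarith)
      _ = ‖u‖ ^ 2 * (((1 + ‖x‖) * (‖x‖ * (3 + ‖x‖ ^ 2))) * Real.exp (‖x‖ - ‖x‖ ^ 2 / 2)) := by ring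
      _ ≤ ‖u‖ ^ 2 * ((3 * (1 + ‖x‖) ^ 4) * Real.exp (‖x‖ - ‖x‖ ^ 2 / 2)) := by gcongr
      _ ≤ _ := by nlinarith [mul_le_mul_of_nonneg_left h (sq_nonneg ‖u‖),
        mul_nonneg (sq_nonneg ‖u‖) (Real.exp_pos 3).le]
  · rw [modulus_of_one_le hu]
    have b1 := rpow_quarter_mul_norm_gaussDeriv_le (x := x) (w := x - u)
      (by simpa using norm_add_le (x - u) u) hu
    have b2 := rpow_quarter_mul_norm_gaussDeriv_le (x := x) (w := x + u)
      (by simpa using norm_sub_le (x + u) u) hu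
    have b3 := rpow_quarter_mul_norm_gaussDeriv_le (x := x) (w := x)
      (by linarith [norm_nonneg u]) hu
    have hn : ‖secDiff gaussDeriv u x‖ ≤ ‖gaussDeriv (x - u)‖ + ‖gaussDeriv (x + u)‖ +
        2 * ‖gaussDeriv x‖ := by
      rw [secDiff]
      refine (norm_sub_le _ _).trans ?_
      rw [norm_smul, Real.norm_ofNat]
      linarith [norm_add_le (gaussDeriv (x - u)) (gaussDeriv (x + u))]
    have hp : 0 ≤ (1 + ‖x‖) ^ (1 / 4 : ℝ) := by positivity
    have hp2 : 0 ≤ Real.exp 3 * ‖u‖ ^ (1 / 4 : ℝ) := by positivity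
    nlinarith [mul_le_mul_of_nonneg_left hn hp]

theorem continuous_modulus : Continuous modulus :=
  (continuous_pow 2).min (Real.continuous_rpow_const (by norm_num))

theorem integrable_modulus : Integrable fun a : Plane => 1 / ‖a‖ ^ 3 * modulus ‖a‖ := by
  rw [integrable_fun_norm_addHaar volume (f := fun r => 1 / r ^ 3 * modulus r)]
  have hm : Measurable fun r : ℝ => r ^ (Module.finrank ℝ Plane - 1) • (1 / r ^ 3 * modulus r) := by
    have := continuous_modulus.measurable
    fun_prop
  rw [← Ioc_union_Ioi_eq_Ioi zero_le_one]
  refine IntegrableOn.union ?_ ?_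
  · refine Measure.integrableOn_of_bounded (M := 1) (by simp) hm.aestronglyMeasurable ?_
    refine (ae_restrict_iff' measurableSet_Ioc).2 (Eventually.of_forall fun r hr => ?_)
    rw [modulus_of_le_one hr.1.le hr.2, finrank_euclideanSpace_fin]
    have : (r : ℝ) ^ (2 - 1) • (1 / r ^ 3 * r ^ 2) = 1 := by
      have := hr.1.ne'
      norm_num; field_simp
    rw [this]; simp
  · refine (integrableOn_Ioi_rpow_of_lt (a := -(7 / 4)) (by norm_num) one_pos).congr_fun ?_
      measurableSet_Ioi
    intro r hr
    have hr0 : (0 : ℝ) < r := one_pos.trans hr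
    simp only [finrank_euclideanSpace_fin, smul_eq_mul, Nat.add_one_sub_one]
    rw [pow_one, modulus_of_one_le (le_of_lt hr), show (-(7 / 4) : ℝ) = 1 / 4 - (2 : ℕ) by norm_num,
      Real.rpow_sub_natCast hr0.ne']
    field_simp

/-- `∫ ‖a‖⁻³ min(‖a‖², ‖a‖^{1/4}) da`. -/
def modulusConst : ℝ := ∫ a : Plane, 1 / ‖a‖ ^ 3 * modulus ‖a‖

theorem modulusConst_nonneg : 0 ≤ modulusConst :=
  integral_nonneg fun a => mul_nonneg (by positivity) (modulus_nonneg (norm_nonneg a))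

theorem modulus_smul_eq {s : ℝ} (hs : 0 < s) (a : Plane) :
    1 / ‖a‖ ^ 3 * modulus ‖s • a‖ = s ^ 3 * (1 / ‖s • a‖ ^ 3 * modulus ‖s • a‖) := by
  rw [← mul_assoc, norm_smul, Real.norm_of_nonneg hs.le, mul_pow]
  congr 1
  field_simp

theorem modulus_zero : modulus 0 = 0 := by
  rw [modulus_of_le_one le_rfl zero_le_one]; norm_num

theorem integrable_modulus_smul {s : ℝ} (hs : 0 ≤ s) :
    Integrable fun a : Plane => 1 / ‖a‖ ^ 3 * modulus ‖s • a‖ := by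
  rcases hs.eq_or_lt with rfl | hs
  · simp [modulus_zero]
  · simp_rw [modulus_smul_eq hs]
    exact (integrable_modulus.comp_smul hs.ne').const_mul _

theorem integral_modulus_smul {s : ℝ} (hs : 0 ≤ s) :
    ∫ a : Plane, 1 / ‖a‖ ^ 3 * modulus ‖s • a‖ = s * modulusConst := by
  rcases hs.eq_or_lt with rfl | hs
  · simp [modulus_zero]
  · simp_rw [modulus_smul_eq hs]
    rw [integral_const_mul, Measure.integral_comp_smul volume
      (fun a : Plane => 1 / ‖a‖ ^ 3 * modulus ‖a‖), finrank_euclideanSpace_fin,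
      abs_of_nonneg (by positivity), smul_eq_mul, ← modulusConst]
    field_simp

/-! ### Gaussian averages of radial kernels -/

/-- `k` is measurable and `|k(x)| ≤ C / x³`. -/
structure KernelBound (k : ℝ → ℝ) (C : ℝ) : Prop where
  measurable : Measurable k
  abs_le : ∀ x, 0 ≤ x → |k x| ≤ C * (1 / x ^ 3)

theorem KernelBound.nonneg {k : ℝ → ℝ} {C : ℝ} (hk : KernelBound k C) : 0 ≤ C := by
  have := (abs_nonneg _).trans (hk.abs_le 1 zero_le_one)
  simpa using this

theorem KernelBound.sub {k k' : ℝ → ℝ} {C C' : ℝ} (hk : KernelBound k C) (hk' : KernelBound k' C') :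
    KernelBound (fun x => k x - k' x) (C + C') :=
  ⟨hk.measurable.sub hk'.measurable, fun x hx => by
    have h1 := hk.abs_le x hx; have h2 := hk'.abs_le x hx
    rw [add_mul]; exact (abs_sub _ _).trans (add_le_add h1 h2)⟩

/-- The compensated Gaussian average of the radial kernel `k`. -/
def gaussAvg (k : ℝ → ℝ) (s : ℝ) (m : Plane) : ℝ :=
  s ^ 2 / (4 * Real.pi) * ∫ a : Plane, k ‖a‖ * secDiff gaussFun (s • a) (s • m)

/-- The derivative of `gaussAvg k s`. -/
def gaussAvgDeriv (k : ℝ → ℝ) (s : ℝ) (m : Plane) : Plane →L[ℝ] ℝ :=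
  (s ^ 3 / (4 * Real.pi)) • ∫ a : Plane, k ‖a‖ • secDiff gaussDeriv (s • a) (s • m)

theorem abs_gaussAvg_integrand_le {k : ℝ → ℝ} {C : ℝ} (hk : KernelBound k C) (s : ℝ)
    (m a : Plane) : ‖k ‖a‖ * secDiff gaussFun (s • a) (s • m)‖ ≤
      C * (200 * Real.exp 3) * (1 / ‖a‖ ^ 3 * modulus ‖s • a‖) := by
  rw [norm_mul, Real.norm_eq_abs, Real.norm_eq_abs]
  calc _ ≤ C * (1 / ‖a‖ ^ 3) * (200 * Real.exp 3 * modulus ‖s • a‖) :=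
        mul_le_mul (hk.abs_le _ (norm_nonneg a)) (abs_secDiff_gaussFun_le _ _) (abs_nonneg _)
          (mul_nonneg hk.nonneg (by positivity))
    _ = _ := by ring

theorem rpow_mul_norm_gaussAvgDeriv_integrand_le {k : ℝ → ℝ} {C : ℝ} (hk : KernelBound k C) (s : ℝ)
    (m a : Plane) :
    (1 + ‖s • m‖) ^ (1 / 4 : ℝ) * ‖k ‖a‖ • secDiff gaussDeriv (s • a) (s • m)‖ ≤
      C * (200 * Real.exp 3) * (1 / ‖a‖ ^ 3 * modulus ‖s • a‖) := by
  rw [norm_smul (k ‖a‖), Real.norm_eq_abs, mul_left_comm]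
  calc |k ‖a‖| * ((1 + ‖s • m‖) ^ (1 / 4 : ℝ) * ‖secDiff gaussDeriv (s • a) (s • m)‖)
      ≤ C * (1 / ‖a‖ ^ 3) * (200 * Real.exp 3 * modulus ‖s • a‖) :=
        mul_le_mul (hk.abs_le _ (norm_nonneg a)) (norm_secDiff_gaussDeriv_le _ _) (by positivity)
          (mul_nonneg hk.nonneg (by positivity))
    _ = _ := by ring

theorem norm_gaussAvgDeriv_integrand_le {k : ℝ → ℝ} {C : ℝ} (hk : KernelBound k C) (s : ℝ)
    (m a : Plane) : ‖k ‖a‖ • secDiff gaussDeriv (s • a) (s • m)‖ ≤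
      C * (200 * Real.exp 3) * (1 / ‖a‖ ^ 3 * modulus ‖s • a‖) := by
  refine le_trans ?_ (rpow_mul_norm_gaussAvgDeriv_integrand_le hk s m a)
  refine le_mul_of_one_le_left (norm_nonneg _) (Real.one_le_rpow ?_ (by norm_num))
  linarith [norm_nonneg (s • m)]

theorem stronglyMeasurable_gaussAvg_integrand {F : Type*} [NormedAddCommGroup F] [NormedSpace ℝ F]
    {f : Plane → F} (hf : Continuous f) {k : ℝ → ℝ} (hk : Measurable k) :
    StronglyMeasurable fun p : (ℝ × Plane) × Plane =>
      k ‖p.2‖ • secDiff f (p.1.1 • p.2) (p.1.1 • p.1.2) := by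
  refine StronglyMeasurable.smul (hk.comp (by fun_prop)).stronglyMeasurable ?_
  exact ((continuous_secDiff hf).comp (g := fun p : Plane × Plane => secDiff f p.1 p.2)
    (f := fun p : (ℝ × Plane) × Plane => (p.1.1 • p.2, p.1.1 • p.1.2))
      (by fun_prop)).stronglyMeasurable

theorem stronglyMeasurable_gaussAvg {k : ℝ → ℝ} (hk : Measurable k) :
    StronglyMeasurable fun p : ℝ × Plane => gaussAvg k p.1 p.2 := by
  have h := (stronglyMeasurable_gaussAvg_integrand continuous_gaussFun hk).integral_prod_right'
    (ν := volume)
  exact (by fun_prop : Continuous fun p : ℝ × Plane => p.1 ^ 2 / (4 * Real.pi)).stronglyMeasurable.mul h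

theorem stronglyMeasurable_gaussAvgDeriv {k : ℝ → ℝ} (hk : Measurable k) :
    StronglyMeasurable fun p : ℝ × Plane => gaussAvgDeriv k p.1 p.2 := by
  have h := (stronglyMeasurable_gaussAvg_integrand continuous_gaussDeriv hk).integral_prod_right'
    (ν := volume)
  exact (by fun_prop : Continuous fun p : ℝ × Plane => p.1 ^ 3 / (4 * Real.pi)).stronglyMeasurable.smul h

theorem aestronglyMeasurable_gaussAvg_integrand {F : Type*} [NormedAddCommGroup F] [NormedSpace ℝ F]
    {f : Plane → F} (hf : Continuous f) {k : ℝ → ℝ} (hk : Measurable k) (s : ℝ) (m : Plane) :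
    AEStronglyMeasurable (fun a : Plane => k ‖a‖ • secDiff f (s • a) (s • m)) volume :=
  ((stronglyMeasurable_gaussAvg_integrand hf hk).comp_measurable
    (measurable_prodMk_left (x := (s, m)))).aestronglyMeasurable

theorem integrable_gaussAvg_integrand {k : ℝ → ℝ} {C : ℝ} (hk : KernelBound k C) {s : ℝ}
    (hs : 0 ≤ s) (m : Plane) :
    Integrable fun a : Plane => k ‖a‖ * secDiff gaussFun (s • a) (s • m) :=
  ((integrable_modulus_smul hs).const_mul _).mono'
    (aestronglyMeasurable_gaussAvg_integrand continuous_gaussFun hk.measurable s m)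
    (Eventually.of_forall fun a => abs_gaussAvg_integrand_le hk s m a)

theorem integrable_gaussAvgDeriv_integrand {k : ℝ → ℝ} {C : ℝ} (hk : KernelBound k C) {s : ℝ}
    (hs : 0 ≤ s) (m : Plane) :
    Integrable fun a : Plane => k ‖a‖ • secDiff gaussDeriv (s • a) (s • m) :=
  ((integrable_modulus_smul hs).const_mul _).mono'
    (aestronglyMeasurable_gaussAvg_integrand continuous_gaussDeriv hk.measurable s m)
    (Eventually.of_forall fun a => norm_gaussAvgDeriv_integrand_le hk s m a)

/-- The constant in the bounds on `gaussAvg` and `gaussAvgDeriv`. -/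
def avgConst : ℝ := 200 * Real.exp 3 * modulusConst / (4 * Real.pi)

theorem avgConst_nonneg : 0 ≤ avgConst :=
  div_nonneg (mul_nonneg (by positivity) modulusConst_nonneg) (by positivity)

theorem abs_gaussAvg_le {k : ℝ → ℝ} {C : ℝ} (hk : KernelBound k C) {s : ℝ} (hs : 0 ≤ s)
    (m : Plane) : |gaussAvg k s m| ≤ C * avgConst * s ^ 3 := by
  have h := norm_integral_le_of_norm_le ((integrable_modulus_smul hs).const_mul _)
    (Eventually.of_forall fun a => abs_gaussAvg_integrand_le hk s m a)
  rw [integral_const_mul, integral_modulus_smul hs, Real.norm_eq_abs] at h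
  rw [gaussAvg, abs_mul, abs_of_nonneg (by positivity)]
  refine (mul_le_mul_of_nonneg_left h (by positivity)).trans (le_of_eq ?_)
  rw [avgConst]; ring

theorem rpow_mul_norm_gaussAvgDeriv_le {k : ℝ → ℝ} {C : ℝ} (hk : KernelBound k C) {s : ℝ}
    (hs : 0 ≤ s) (m : Plane) :
    (1 + s * ‖m‖) ^ (1 / 4 : ℝ) * ‖gaussAvgDeriv k s m‖ ≤ C * avgConst * s ^ 4 := by
  have hsm : s * ‖m‖ = ‖s • m‖ := by rw [norm_smul, Real.norm_of_nonneg hs]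
  have h := norm_integral_le_of_norm_le ((integrable_modulus_smul hs).const_mul _)
    (f := fun a : Plane => ((1 + ‖s • m‖) ^ (1 / 4 : ℝ)) • (k ‖a‖ • secDiff gaussDeriv (s • a) (s • m)))
    (g := fun a => C * (200 * Real.exp 3) * (1 / ‖a‖ ^ 3 * modulus ‖s • a‖))
    (Eventually.of_forall fun a => by
      rw [norm_smul, Real.norm_of_nonneg (by positivity)]
      exact rpow_mul_norm_gaussAvgDeriv_integrand_le hk s m a)
  rw [integral_smul, norm_smul, Real.norm_of_nonneg (by positivity), integral_const_mul,
    integral_modulus_smul hs] at h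
  rw [hsm, gaussAvgDeriv, norm_smul (s ^ 3 / (4 * Real.pi)),
    Real.norm_of_nonneg (by positivity), mul_left_comm]
  refine (mul_le_mul_of_nonneg_left h (by positivity)).trans (le_of_eq ?_)
  rw [avgConst]; ring

theorem norm_gaussAvgDeriv_le {k : ℝ → ℝ} {C : ℝ} (hk : KernelBound k C) {s : ℝ} (hs : 0 ≤ s)
    (m : Plane) : ‖gaussAvgDeriv k s m‖ ≤ C * avgConst * s ^ 4 := by
  refine le_trans ?_ (rpow_mul_norm_gaussAvgDeriv_le hk hs m)
  refine le_mul_of_one_le_left (norm_nonneg _) (Real.one_le_rpow ?_ (by norm_num))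
  linarith [mul_nonneg hs (norm_nonneg m)]

theorem hasFDerivAt_secDiff_gaussFun (s : ℝ) (a m : Plane) :
    HasFDerivAt (fun m => secDiff gaussFun (s • a) (s • m))
      (s • secDiff gaussDeriv (s • a) (s • m)) m := by
  have h0 : HasFDerivAt (fun m : Plane => s • m) (s • ContinuousLinearMap.id ℝ Plane) m :=
    (hasFDerivAt_id m).const_smul s
  have h1 := (hasFDerivAt_gaussFun (s • m - s • a)).comp m (h0.sub_const (s • a))
  have h2 := (hasFDerivAt_gaussFun (s • m + s • a)).comp m (h0.add_const (s • a))
  have h3 := ((hasFDerivAt_gaussFun (s • m)).comp m h0).const_smul (2 : ℝ)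
  refine ((h1.add h2).sub h3).congr_fderiv ?_
  ext w
  simp [secDiff]
  ring

theorem hasFDerivAt_gaussAvg {k : ℝ → ℝ} {C : ℝ} (hk : KernelBound k C) {s : ℝ} (hs : 0 ≤ s)
    (m : Plane) : HasFDerivAt (gaussAvg k s) (gaussAvgDeriv k s m) m := by
  have h := hasFDerivAt_integral_of_dominated_of_fderiv_le (μ := volume) (𝕜 := ℝ)
    (F := fun m (a : Plane) => k ‖a‖ * secDiff gaussFun (s • a) (s • m))
    (F' := fun m a => s • (k ‖a‖ • secDiff gaussDeriv (s • a) (s • m)))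
    (bound := fun a => s * (C * (200 * Real.exp 3) * (1 / ‖a‖ ^ 3 * modulus ‖s • a‖)))
    (s := univ) (x₀ := m) univ_mem
    (Eventually.of_forall fun m =>
      aestronglyMeasurable_gaussAvg_integrand continuous_gaussFun hk.measurable s m)
    (integrable_gaussAvg_integrand hk hs m)
    ((aestronglyMeasurable_gaussAvg_integrand continuous_gaussDeriv hk.measurable s m).const_smul s)
    (Eventually.of_forall fun a m _ => by
      rw [norm_smul, Real.norm_of_nonneg hs]
      exact mul_le_mul_of_nonneg_left (norm_gaussAvgDeriv_integrand_le hk s m a) hs)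
    (((integrable_modulus_smul hs).const_mul _).const_mul s)
    (Eventually.of_forall fun a m _ => by
      have := (hasFDerivAt_secDiff_gaussFun s a m).const_mul (k ‖a‖)
      rwa [smul_comm] at this)
  have h2 := h.const_mul (s ^ 2 / (4 * Real.pi))
  refine h2.congr_fderiv ?_
  rw [gaussAvgDeriv, integral_smul, smul_smul]
  congr 1; ring

theorem continuous_gaussAvgDeriv {k : ℝ → ℝ} {C : ℝ} (hk : KernelBound k C) {s : ℝ} (hs : 0 ≤ s) :
    Continuous (gaussAvgDeriv k s) := by
  refine Continuous.fun_const_smul (continuous_of_dominated (fun m => aestronglyMeasurable_gaussAvg_integrand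
    continuous_gaussDeriv hk.measurable s m) (fun m => Eventually.of_forall fun a =>
      norm_gaussAvgDeriv_integrand_le hk s m a) ((integrable_modulus_smul hs).const_mul _)
      (Eventually.of_forall fun a => ?_)) _
  refine Continuous.fun_const_smul ?_ _
  exact (continuous_secDiff continuous_gaussDeriv).comp
    (f := fun m : Plane => (s • a, s • m)) (by fun_prop)

theorem tendsto_gaussAvg {ι : Type*} {l : Filter ι} [l.IsCountablyGenerated] {k : ι → ℝ → ℝ}
    {k₀ : ℝ → ℝ} {C : ℝ} (hk : ∀ᶠ i in l, KernelBound (k i) C)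
    (hlim : ∀ x, 0 < x → Tendsto (fun i => k i x) l (𝓝 (k₀ x))) {s : ℝ} (hs : 0 ≤ s) (m : Plane) :
    Tendsto (fun i => gaussAvg (k i) s m) l (𝓝 (gaussAvg k₀ s m)) := by
  refine Tendsto.const_mul _ (tendsto_integral_filter_of_dominated_convergence _
    (hk.mono fun i hi => aestronglyMeasurable_gaussAvg_integrand continuous_gaussFun
      hi.measurable s m) (hk.mono fun i hi => Eventually.of_forall fun a =>
        abs_gaussAvg_integrand_le hi s m a) ((integrable_modulus_smul hs).const_mul _) ?_)
  filter_upwards [Measure.ae_ne volume (0 : Plane)] with a ha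
  exact (hlim _ (norm_pos_iff.2 ha)).mul_const _

theorem tendsto_gaussAvgDeriv {ι : Type*} {l : Filter ι} [l.IsCountablyGenerated] {k : ι → ℝ → ℝ}
    {k₀ : ℝ → ℝ} {C : ℝ} (hk : ∀ᶠ i in l, KernelBound (k i) C)
    (hlim : ∀ x, 0 < x → Tendsto (fun i => k i x) l (𝓝 (k₀ x))) {s : ℝ} (hs : 0 ≤ s) (m : Plane) :
    Tendsto (fun i => gaussAvgDeriv (k i) s m) l (𝓝 (gaussAvgDeriv k₀ s m)) := by
  refine Tendsto.const_smul (tendsto_integral_filter_of_dominated_convergence _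
    (hk.mono fun i hi => aestronglyMeasurable_gaussAvg_integrand continuous_gaussDeriv
      hi.measurable s m) (hk.mono fun i hi => Eventually.of_forall fun a =>
        norm_gaussAvgDeriv_integrand_le hi s m a) ((integrable_modulus_smul hs).const_mul _) ?_) _
  filter_upwards [Measure.ae_ne volume (0 : Plane)] with a ha
  exact (hlim _ (norm_pos_iff.2 ha)).smul_const _

/-! ### The Sobolev space -/

instance instSecondCountableTopologyH2 : SecondCountableTopology H2 :=
  haveI : Fact ((2 : ENNReal) ≠ ⊤) := ⟨ENNReal.ofNat_ne_top⟩
  Lp.SecondCountableTopology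

theorem eLpNorm_two_eq {α E : Type*} [MeasurableSpace α] [NormedAddCommGroup E] (f : α → E)
    (μ : Measure α) : eLpNorm f 2 μ = (∫⁻ x, ‖f x‖ₑ ^ 2 ∂μ) ^ (1 / 2 : ℝ) := by
  rw [eLpNorm_eq_lintegral_rpow_enorm_toReal two_ne_zero ENNReal.ofNat_ne_top]
  simp

theorem tendsto_eLpNorm_two_zero {α E ι : Type*} [MeasurableSpace α] [NormedAddCommGroup E]
    {l : Filter ι} {μ : Measure α} {f : ι → α → E}
    (h : Tendsto (fun i => ∫⁻ x, ‖f i x‖ₑ ^ 2 ∂μ) l (𝓝 0)) :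
    Tendsto (fun i => eLpNorm (f i) 2 μ) l (𝓝 0) := by
  simp_rw [eLpNorm_two_eq]
  have := (ENNReal.continuous_rpow_const (y := 1 / 2)).tendsto 0
  rw [ENNReal.zero_rpow_of_pos (by norm_num)] at this
  exact this.comp h

theorem tendsto_lintegral_sq_of_bounded {α E ι : Type*} [MeasurableSpace α] [NormedAddCommGroup E]
    {l : Filter ι} [l.IsCountablyGenerated] {μ : Measure α} [IsFiniteMeasure μ] {f : ι → α → E}
    {f₀ : α → E} {C : ℝ} (hf : ∀ᶠ i in l, AEStronglyMeasurable (f i) μ)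
    (hf₀ : AEStronglyMeasurable f₀ μ) (hb : ∀ᶠ i in l, ∀ x, ‖f i x‖ ≤ C) (hb₀ : ∀ x, ‖f₀ x‖ ≤ C)
    (hlim : ∀ᵐ x ∂μ, Tendsto (fun i => f i x) l (𝓝 (f₀ x))) :
    Tendsto (fun i => ∫⁻ x, ‖f i x - f₀ x‖ₑ ^ 2 ∂μ) l (𝓝 0) := by
  have h : Tendsto (fun i => ∫⁻ x, ‖f i x - f₀ x‖ₑ ^ 2 ∂μ) l (𝓝 (∫⁻ _, 0 ∂μ)) := by
    refine tendsto_lintegral_filter_of_dominated_convergence' (fun _ => ENNReal.ofReal (2 * C) ^ 2)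
      (hf.mono fun i hi => (hi.sub hf₀).enorm.pow_const 2) ?_ ?_ ?_
    · filter_upwards [hb] with i hi
      refine Eventually.of_forall fun x => pow_le_pow_left' ?_ 2
      rw [← ofReal_norm]
      refine ENNReal.ofReal_le_ofReal ((norm_sub_le _ _).trans ?_)
      linarith [hi x, hb₀ x]
    · rw [lintegral_const]
      exact ENNReal.mul_ne_top (by finiteness) (measure_ne_top μ _)
    · filter_upwards [hlim] with x hx
      have := (hx.sub_const (f₀ x)).enorm
      rw [sub_self, enorm_zero] at this
      have h2 := ((ENNReal.continuous_pow 2).tendsto 0).comp this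
      rw [zero_pow two_ne_zero] at h2
      exact h2
  simpa using h

theorem IsCylindrical.contDiff {F : H2 → ℝ} (hF : IsCylindrical F) : ContDiff ℝ (⊤ : ℕ∞) F := by
  obtain ⟨m, l, ψ, hψ, -, hF⟩ := hF
  have : F = ψ ∘ fun z => fun j => inner ℝ (l j) z := funext hF
  rw [this]
  exact hψ.comp (contDiff_pi.2 fun j => contDiff_const.inner ℝ contDiff_id)

theorem continuous_gradient {F : H2 → ℝ} (hF : ContDiff ℝ 1 F) : Continuous (gradient F) :=
  (InnerProductSpace.toDual ℝ H2).symm.continuous.comp (hF.continuous_fderiv one_ne_zero)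

theorem norm_gradient_sub (F G : H2 → ℝ) (z w : H2) :
    ‖gradient F z - gradient G w‖ = ‖fderiv ℝ F z - fderiv ℝ G w‖ := by
  rw [gradient, gradient, ← map_sub, LinearIsometryEquiv.norm_map]

theorem norm_gradient (F : H2 → ℝ) (z : H2) : ‖gradient F z‖ = ‖fderiv ℝ F z‖ := by
  rw [gradient, LinearIsometryEquiv.norm_map]

theorem HasSobolevGradient.of_tendsto {μ : Measure H2} {F : ℕ → H2 → ℝ} {D : ℕ → H2 → H2}
    {F₀ : H2 → ℝ} {D₀ : H2 → H2} (h : ∀ n, HasSobolevGradient μ (F n) (D n)) (hF₀ : MemLp F₀ 2 μ)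
    (hD₀ : MemLp D₀ 2 μ) (hF : Tendsto (fun n => eLpNorm (fun z => F n z - F₀ z) 2 μ) atTop (𝓝 0))
    (hD : Tendsto (fun n => eLpNorm (fun z => D n z - D₀ z) 2 μ) atTop (𝓝 0)) :
    HasSobolevGradient μ F₀ D₀ := by
  refine ⟨hF₀, hD₀, ?_⟩
  have key : ∀ n : ℕ, ∃ Φ, IsCylindrical Φ ∧
      eLpNorm (fun z => Φ z - F n z) 2 μ ≤ ((n : ENNReal) + 1)⁻¹ ∧
      eLpNorm (fun z => gradient Φ z - D n z) 2 μ ≤ ((n : ENNReal) + 1)⁻¹ := by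
    intro n
    obtain ⟨-, -, Φ, hΦ, h1, h2⟩ := h n
    have hpos : (0 : ENNReal) < ((n : ENNReal) + 1)⁻¹ := ENNReal.inv_pos.2 (by finiteness)
    obtain ⟨j, hj1, hj2⟩ := ((h1.eventually (ge_mem_nhds hpos)).and
      (h2.eventually (ge_mem_nhds hpos))).exists
    exact ⟨Φ j, hΦ j, hj1, hj2⟩
  choose Φ hΦ h1 h2 using key
  have hinv : Tendsto (fun n : ℕ => ((n : ENNReal) + 1)⁻¹) atTop (𝓝 0) := by
    have := (tendsto_add_atTop_iff_nat 1).2 ENNReal.tendsto_inv_nat_nhds_zero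
    simpa using this
  have hsm : ∀ n, ContDiff ℝ 1 (Φ n) := fun n => (hΦ n).contDiff.of_le (by exact_mod_cast le_top)
  refine ⟨Φ, hΦ, ?_, ?_⟩
  · refine tendsto_of_tendsto_of_tendsto_of_le_of_le tendsto_const_nhds
      (by simpa using hinv.add hF) (fun _ => zero_le) fun n => ?_
    refine le_trans ?_ (add_le_add_left (h1 n) _)
    have e : (fun z => Φ n z - F₀ z) = (fun z => Φ n z - F n z) + fun z => F n z - F₀ z := by
      funext z; simp
    rw [e]
    exact eLpNorm_add_le ((hsm n).continuous.aestronglyMeasurable.sub (h n).1.1)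
      ((h n).1.1.sub hF₀.1) one_le_two
  · refine tendsto_of_tendsto_of_tendsto_of_le_of_le tendsto_const_nhds
      (by simpa using hinv.add hD) (fun _ => zero_le) fun n => ?_
    refine le_trans ?_ (add_le_add_left (h2 n) _)
    have e : (fun z => gradient (Φ n) z - D₀ z) =
        (fun z => gradient (Φ n) z - D n z) + fun z => D n z - D₀ z := by
      funext z; simp
    rw [e]
    exact eLpNorm_add_le ((continuous_gradient (hsm n)).aestronglyMeasurable.sub (h n).2.1.1)
      ((h n).2.1.1.sub hD₀.1) one_le_two

theorem memLp_of_bounded {E : Type*} [NormedAddCommGroup E] {μ : Measure H2} [IsFiniteMeasure μ]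
    {f : H2 → E} (hf : AEStronglyMeasurable f μ) {C : ℝ} (hC : ∀ z, ‖f z‖ ≤ C) : MemLp f 2 μ :=
  MemLp.of_bound hf C (Eventually.of_forall hC)

theorem HasSobolevGradient.of_contDiff_of_tendsto {μ : Measure H2} [IsFiniteMeasure μ]
    {F : ℕ → H2 → ℝ} {F₀ : H2 → ℝ} (h : ∀ n, HasSobolevGradient μ (F n) (gradient (F n)))
    (hF₀ : ContDiff ℝ 1 F₀) {C C' : ℝ} (hC : ∀ n z, |F n z| ≤ C) (hC₀ : ∀ z, |F₀ z| ≤ C)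
    (hC' : ∀ n z, ‖fderiv ℝ (F n) z‖ ≤ C') (hC₀' : ∀ z, ‖fderiv ℝ F₀ z‖ ≤ C')
    (hlim : ∀ z, Tendsto (fun n => F n z) atTop (𝓝 (F₀ z)))
    (hlim' : ∀ z, Tendsto (fun n => gradient (F n) z) atTop (𝓝 (gradient F₀ z))) :
    HasSobolevGradient μ F₀ (gradient F₀) := by
  have m1 := hF₀.continuous.aestronglyMeasurable (μ := μ)
  have m2 := (continuous_gradient hF₀).aestronglyMeasurable (μ := μ)
  refine HasSobolevGradient.of_tendsto h (memLp_of_bounded m1 hC₀)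
    (memLp_of_bounded m2 fun z => (norm_gradient _ z).trans_le (hC₀' z)) ?_ ?_
  · exact tendsto_eLpNorm_two_zero (tendsto_lintegral_sq_of_bounded
      (Eventually.of_forall fun n => (h n).1.1) m1 (Eventually.of_forall hC) hC₀
      (Eventually.of_forall hlim))
  · exact tendsto_eLpNorm_two_zero (tendsto_lintegral_sq_of_bounded
      (Eventually.of_forall fun n => (h n).2.1.1) m2
      (Eventually.of_forall fun n z => (norm_gradient _ z).trans_le (hC' n z))
      (fun z => (norm_gradient _ z).trans_le (hC₀' z)) (Eventually.of_forall hlim'))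

theorem HasSobolevGradient.of_isCylindrical {μ : Measure H2} [IsFiniteMeasure μ] {F : H2 → ℝ}
    (hF : IsCylindrical F) {C C' : ℝ} (hC : ∀ z, |F z| ≤ C) (hC' : ∀ z, ‖fderiv ℝ F z‖ ≤ C') :
    HasSobolevGradient μ F (gradient F) := by
  have hsm : ContDiff ℝ 1 F := hF.contDiff.of_le (by exact_mod_cast le_top)
  refine ⟨memLp_of_bounded hsm.continuous.aestronglyMeasurable hC,
    memLp_of_bounded (continuous_gradient hsm).aestronglyMeasurable
      fun z => (norm_gradient _ z).trans_le (hC' z), fun _ => F, fun _ => hF, ?_, ?_⟩ <;> simp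

/-! ### Mollification of bounded functions -/

theorem exists_norm_iteratedFDeriv_convolution_le {G : Type} [NormedAddCommGroup G]
    [NormedSpace ℝ G] [FiniteDimensional ℝ G] [MeasurableSpace G] [BorelSpace G] {μ : Measure G}
    [μ.IsAddHaarMeasure] {g : G → ℝ} (hg : Continuous g) {C : ℝ} (hC : ∀ x, ‖g x‖ ≤ C) (n : ℕ) :
    ∀ {E F : Type} [NormedAddCommGroup E] [NormedSpace ℝ E] [NormedAddCommGroup F]
      [NormedSpace ℝ F] (L : E →L[ℝ] ℝ →L[ℝ] F) {f : G → E}, HasCompactSupport f →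
      ContDiff ℝ (⊤ : ℕ∞) f →
      ∃ B : ℝ, ∀ x, ‖iteratedFDeriv ℝ n (convolution f g L μ) x‖ ≤ B := by
  induction n with
  | zero =>
    intro E F _ _ _ _ L f hf hfs
    refine ⟨∫ t, ‖L‖ * ‖f t‖ * C ∂μ, fun x => ?_⟩
    rw [norm_iteratedFDeriv_zero, convolution]
    refine norm_integral_le_of_norm_le ?_ (Eventually.of_forall fun t => ?_)
    · exact (((hfs.continuous.integrable_of_hasCompactSupport hf).norm.const_mul _).mul_const _)
    · refine (L.le_opNorm₂ _ _).trans ?_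
      exact mul_le_mul_of_nonneg_left (hC _) (by positivity)
  | succ n ih =>
    intro E F _ _ _ _ L f hf hfs
    have e : fderiv ℝ (convolution f g L μ) = convolution (fderiv ℝ f) g (L.precompL G) μ :=
      funext fun x => (hf.hasFDerivAt_convolution_left L (hfs.of_le (by exact_mod_cast le_top))
        hg.locallyIntegrable x).fderiv
    obtain ⟨B, hB⟩ := ih (L.precompL G) (hf.fderiv ℝ)
      (hfs.fderiv_right (m := (⊤ : ℕ∞)) (by simp))
    exact ⟨B, fun x => by rw [← norm_iteratedFDeriv_fderiv, e]; exact hB x⟩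

theorem norm_convolution_normed_le {G E : Type*} [NormedAddCommGroup G] [NormedSpace ℝ G]
    [FiniteDimensional ℝ G] [HasContDiffBump G] [MeasurableSpace G] [BorelSpace G] {μ : Measure G}
    [μ.IsAddHaarMeasure] [NormedAddCommGroup E] [NormedSpace ℝ E] (φ : ContDiffBump (0 : G))
    {g : G → E} {C : ℝ} (hC : ∀ x, ‖g x‖ ≤ C) (x : G) :
    ‖convolution (φ.normed μ) g (ContinuousLinearMap.lsmul ℝ ℝ) μ x‖ ≤ C := by
  rw [convolution]
  refine (norm_integral_le_of_norm_le (g := fun t => φ.normed μ t * C)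
    (φ.integrable_normed.mul_const C) (Eventually.of_forall fun t => ?_)).trans (le_of_eq ?_)
  · rw [ContinuousLinearMap.lsmul_apply, norm_smul, Real.norm_of_nonneg (φ.nonneg_normed t)]
    exact mul_le_mul_of_nonneg_left (hC _) (φ.nonneg_normed t)
  · rw [integral_mul_const, φ.integral_normed, one_mul]

theorem hasFDerivAt_convolution_normed {G : Type*} [NormedAddCommGroup G] [NormedSpace ℝ G]
    [FiniteDimensional ℝ G] [HasContDiffBump G] [MeasurableSpace G] [BorelSpace G] {μ : Measure G}
    [μ.IsAddHaarMeasure] (φ : ContDiffBump (0 : G)) {g : G → ℝ} (hg : ContDiff ℝ 1 g) {C : ℝ}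
    (hC : ∀ x, ‖fderiv ℝ g x‖ ≤ C) (x : G) :
    HasFDerivAt (convolution (φ.normed μ) g (ContinuousLinearMap.lsmul ℝ ℝ) μ)
      (convolution (φ.normed μ) (fderiv ℝ g) (ContinuousLinearMap.lsmul ℝ ℝ) μ x) x := by
  have hm : Continuous (φ.normed μ) := φ.continuous_normed
  refine hasFDerivAt_integral_of_dominated_of_fderiv_le (s := univ)
    (bound := fun t => φ.normed μ t * C)
    (F' := fun x t => φ.normed μ t • fderiv ℝ g (x - t)) univ_mem
    (Eventually.of_forall fun x => ?_) ?_ ?_ ?_ (φ.integrable_normed.mul_const C) ?_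
  · exact (hm.smul (hg.continuous.comp (continuous_const.sub continuous_id))).aestronglyMeasurable
  · exact (hm.smul (hg.continuous.comp
      (continuous_const.sub continuous_id))).integrable_of_hasCompactSupport
        φ.hasCompactSupport_normed.smul_right
  · exact (hm.smul ((hg.continuous_fderiv one_ne_zero).comp
      (continuous_const.sub continuous_id))).aestronglyMeasurable
  · refine Eventually.of_forall fun t x _ => ?_
    rw [norm_smul, Real.norm_of_nonneg (φ.nonneg_normed t)]
    exact mul_le_mul_of_nonneg_left (hC _) (φ.nonneg_normed t)
  · refine Eventually.of_forall fun t x _ => ?_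
    have h := ((hg.differentiable one_ne_zero (x - t)).hasFDerivAt).comp x
      ((hasFDerivAt_id x).sub_const t)
    exact (h.const_smul (φ.normed μ t))

theorem gradient_comp_clm {m : ℕ} {ψ : (Fin m → ℝ) → ℝ} (hψ : Differentiable ℝ ψ)
    (L : H2 →L[ℝ] Fin m → ℝ) (z : H2) :
    gradient (fun z => ψ (L z)) z =
      (InnerProductSpace.toDual ℝ H2).symm ((fderiv ℝ ψ (L z)).comp L) := by
  rw [gradient, show (fun z => ψ (L z)) = ψ ∘ L from rfl, fderiv_comp z (hψ _) L.differentiableAt,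
    ContinuousLinearMap.fderiv]

theorem hasSobolevGradient_comp_inner {μ : Measure H2} [IsFiniteMeasure μ] {m : ℕ}
    (l : Fin m → H2) {ψ : (Fin m → ℝ) → ℝ} (hψ : ContDiff ℝ 1 ψ) {C C' : ℝ}
    (hC : ∀ x, ‖ψ x‖ ≤ C) (hC' : ∀ x, ‖fderiv ℝ ψ x‖ ≤ C') :
    HasSobolevGradient μ (fun z => ψ fun j => inner ℝ (l j) z)
      (gradient fun z => ψ fun j => inner ℝ (l j) z) := by
  let L : H2 →L[ℝ] Fin m → ℝ := ContinuousLinearMap.pi fun j => innerSL ℝ (l j)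
  let φ : ℕ → ContDiffBump (0 : Fin m → ℝ) := fun n =>
    ⟨(1 : ℝ) / (n + 1) / 2, 1 / (n + 1), by positivity, by
      have : (0 : ℝ) < 1 / (n + 1) := by positivity
      linarith⟩
  let ψn : ℕ → (Fin m → ℝ) → ℝ := fun n =>
    convolution ((φ n).normed volume) ψ (ContinuousLinearMap.lsmul ℝ ℝ) volume
  have hφ : Tendsto (fun n => (φ n).rOut) atTop (𝓝 0) := tendsto_one_div_add_atTop_nhds_zero_nat
  have hd : ∀ n x, HasFDerivAt (ψn n) (convolution ((φ n).normed volume) (fderiv ℝ ψ)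
      (ContinuousLinearMap.lsmul ℝ ℝ) volume x) x :=
    fun n x => hasFDerivAt_convolution_normed (φ n) hψ hC' x
  have hnorm : ∀ (A : (Fin m → ℝ) →L[ℝ] ℝ), ‖A‖ ≤ C' → ‖A.comp L‖ ≤ C' * ‖L‖ := fun A hA =>
    (A.opNorm_comp_le L).trans (mul_le_mul_of_nonneg_right hA (norm_nonneg _))
  have hfd : ∀ (χ : (Fin m → ℝ) → ℝ), Differentiable ℝ χ → (∀ x, ‖fderiv ℝ χ x‖ ≤ C') → ∀ z,
      ‖fderiv ℝ (fun z => χ (L z)) z‖ ≤ C' * ‖L‖ := by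
    intro χ hχ hb z
    rw [← norm_gradient, gradient_comp_clm hχ, LinearIsometryEquiv.norm_map]
    exact hnorm _ (hb _)
  have hb : ∀ n x, ‖fderiv ℝ (ψn n) x‖ ≤ C' := fun n x => by
    rw [(hd n x).fderiv]; exact norm_convolution_normed_le (φ n) hC' x
  have hdiff : ∀ n, Differentiable ℝ (ψn n) := fun n x => (hd n x).differentiableAt
  refine HasSobolevGradient.of_contDiff_of_tendsto (F := fun n z => ψn n (L z)) (C := C)
    (C' := C' * ‖L‖) (fun n => ?_) (hψ.comp L.contDiff) (fun n z => norm_convolution_normed_le _ hC _)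
    (fun z => hC _) (fun n => hfd _ (hdiff n) (hb n)) (hfd ψ (hψ.differentiable one_ne_zero) hC')
    (fun z => ?_) fun z => ?_
  · refine HasSobolevGradient.of_isCylindrical ⟨m, l, ψn n, ?_, fun j => ?_, fun z => rfl⟩
      (fun z => norm_convolution_normed_le _ hC _) (hfd _ (hdiff n) (hb n))
    · exact (φ n).hasCompactSupport_normed.contDiff_convolution_left _ (φ n).contDiff_normed
        hψ.continuous.locallyIntegrable
    · exact exists_norm_iteratedFDeriv_convolution_le hψ.continuous hC j _
        (φ n).hasCompactSupport_normed (φ n).contDiff_normed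
  · exact ContDiffBump.convolution_tendsto_right_of_continuous hφ hψ.continuous (L z)
  · have e : (fun z => ψ fun j => inner ℝ (l j) z) = fun z => ψ (L z) := rfl
    rw [e, gradient_comp_clm (hψ.differentiable one_ne_zero)]
    simp_rw [fun n => gradient_comp_clm (hdiff n) L z]
    refine ((InnerProductSpace.toDual ℝ H2).symm.continuous.tendsto _).comp ?_
    have h := ContDiffBump.convolution_tendsto_right_of_continuous (μ := volume) hφ
      (hψ.continuous_fderiv one_ne_zero) (L z)
    simp_rw [fun n => (hd n (L z)).fderiv]
    exact (((ContinuousLinearMap.compL ℝ H2 (Fin m → ℝ) ℝ).flip L).continuous.tendsto _).comp h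

theorem hasSobolevGradient_comp_starProjection {μ : Measure H2} [IsFiniteMeasure μ]
    (U : Submodule ℝ H2) [FiniteDimensional ℝ U] {F : H2 → ℝ} (hF : ContDiff ℝ 1 F) {C C' : ℝ}
    (hC : ∀ z, |F z| ≤ C) (hC' : ∀ z, ‖fderiv ℝ F z‖ ≤ C') :
    HasSobolevGradient μ (fun z => F (U.starProjection z))
      (gradient fun z => F (U.starProjection z)) := by
  let b := stdOrthonormalBasis ℝ U
  let T : (Fin (Module.finrank ℝ U) → ℝ) →L[ℝ] H2 :=
    ∑ j, (ContinuousLinearMap.proj j).smulRight (b j : H2)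
  have hT : ∀ z, F (U.starProjection z) = (fun x => F (T x)) fun j => inner ℝ (b j : H2) z := by
    intro z
    have : U.starProjection z = T fun j => inner ℝ (b j : H2) z := by
      rw [b.starProjection_eq_sum_rankOne]
      simp [T]
    simp only [this]
  have e : (fun z => F (U.starProjection z)) =
    fun z => (fun x => F (T x)) fun j => inner ℝ (b j : H2) z := funext hT
  rw [e]
  refine hasSobolevGradient_comp_inner (fun j => (b j : H2)) (hF.comp T.contDiff) (C := C)
    (C' := C' * ‖T‖) (fun x => hC _) fun x => ?_
  rw [fderiv_comp x (hF.differentiable one_ne_zero _) T.differentiableAt, ContinuousLinearMap.fderiv]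
  exact (ContinuousLinearMap.opNorm_comp_le _ _).trans
    (mul_le_mul_of_nonneg_right (hC' _) (norm_nonneg _))

theorem gradient_comp_starProjection (U : Submodule ℝ H2) [FiniteDimensional ℝ U] {F : H2 → ℝ}
    (hF : Differentiable ℝ F) (z : H2) :
    gradient (fun z => F (U.starProjection z)) z =
      U.starProjection (gradient F (U.starProjection z)) := by
  refine ext_inner_right ℝ fun w => ?_
  rw [Submodule.inner_starProjection_left_eq_right, gradient, gradient,
    InnerProductSpace.toDual_symm_apply, InnerProductSpace.toDual_symm_apply,
    show (fun z => F (U.starProjection z)) = F ∘ U.starProjection from rfl,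
    fderiv_comp z (hF _) U.starProjection.differentiableAt, ContinuousLinearMap.fderiv]
  rfl

/-- Bounded `C¹` functionals with bounded derivative belong to `W^{1,2}(μ)`. -/
theorem hasSobolevGradient_of_contDiff {μ : Measure H2} [IsFiniteMeasure μ] {F : H2 → ℝ}
    (hF : ContDiff ℝ 1 F) {C C' : ℝ} (hC : ∀ z, |F z| ≤ C) (hC' : ∀ z, ‖fderiv ℝ F z‖ ≤ C') :
    HasSobolevGradient μ F (gradient F) := by
  let U : ℕ → Submodule ℝ H2 := fun n =>
    Submodule.span ℝ (TopologicalSpace.denseSeq H2 '' Set.Iio n)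
  have : ∀ n, FiniteDimensional ℝ (U n) := fun n =>
    FiniteDimensional.span_of_finite ℝ ((Set.finite_Iio n).image _)
  have hmono : Monotone U := fun m n hmn =>
    Submodule.span_mono (Set.image_mono (Set.Iio_subset_Iio hmn))
  have htop : ⊤ ≤ (⨆ n, U n).topologicalClosure := by
    intro x _
    rw [← SetLike.mem_coe, Submodule.topologicalClosure_coe]
    refine closure_mono ?_ (TopologicalSpace.denseRange_denseSeq H2 x)
    rintro _ ⟨n, rfl⟩
    exact (le_iSup U (n + 1)) (Submodule.subset_span ⟨n, Nat.lt_succ_self n, rfl⟩)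
  have hlim := fun x => Submodule.starProjection_tendsto_self U hmono x htop
  have hd := hF.differentiable one_ne_zero
  have hP : ∀ n x, ‖(U n).starProjection x‖ ≤ ‖x‖ := fun n x => by
    simpa using ((U n).starProjection.le_opNorm x).trans
      (mul_le_mul_of_nonneg_right (U n).starProjection_norm_le (norm_nonneg x))
  refine HasSobolevGradient.of_contDiff_of_tendsto (F := fun n z => F ((U n).starProjection z))
    (fun n => hasSobolevGradient_comp_starProjection (U n) hF hC hC') hF (fun n z => hC _) hC
    (fun n z => ?_) hC' (fun z => ((hF.continuous.tendsto z).comp (hlim z))) fun z => ?_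
  · rw [← norm_gradient, gradient_comp_starProjection _ hd]
    exact (hP n _).trans ((norm_gradient _ _).trans_le (hC' _))
  · simp_rw [gradient_comp_starProjection _ hd]
    have h1 := (((continuous_gradient hF).tendsto z).comp (hlim z)).sub_const (gradient F z)
    rw [sub_self] at h1
    have h2 : Tendsto (fun n => (U n).starProjection
        (gradient F ((U n).starProjection z) - gradient F z)) atTop (𝓝 0) :=
      squeeze_zero_norm (fun n => hP n _) (tendsto_zero_iff_norm_tendsto_zero.1 h1)
    simpa using h2.add (hlim (gradient F z))

/-! ### Potentials of radial kernels and their truncations -/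

/-- `h` is continuous, bounded by `M`, and `sin² (π r) ≥ c > 0` where `h r ≠ 0`. -/
structure IsWeight (h : ℝ → ℝ) (M c : ℝ) : Prop where
  continuous : Continuous h
  abs_le : ∀ r, |h r| ≤ M
  pos : 0 < c
  sin_sq_ge : ∀ r, h r ≠ 0 → c ≤ Real.sin (Real.pi * r) ^ 2

theorem IsWeight.nonneg {h : ℝ → ℝ} {M c : ℝ} (hh : IsWeight h M c) : 0 ≤ M :=
  (abs_nonneg _).trans (hh.abs_le 0)

instance instSFiniteSpaceTime : SFinite spaceTime := by unfold spaceTime; infer_instance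

theorem ae_spaceTime_pos : ∀ᵐ p ∂spaceTime, 0 < p.1 := by
  have h : ∀ᵐ t ∂(volume.restrict (Ioi (0 : ℝ))), 0 < t := ae_restrict_mem measurableSet_Ioi
  exact Measure.quasiMeasurePreserving_fst.ae h

theorem integrable_spaceTime_fst {f : ℝ → ℝ} (hf : IntegrableOn f (Ioi 0)) :
    Integrable (fun p : ℝ × I => f p.1) spaceTime :=
  Integrable.comp_fst hf volume

/-- The integrand of the potential. -/
def potentialDensity (h k : ℝ → ℝ) (z : H2) (p : ℝ × I) : ℝ :=
  Real.exp (-p.1) * h p.2 * gaussAvg k (invStd p) (flowMap p z)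

/-- The potential of the radial kernel `k`, restricted to times greater than `δ`. -/
def truncPotential (h k : ℝ → ℝ) (δ : ℝ) (z : H2) : ℝ :=
  ∫ p in {p : ℝ × I | δ < p.1}, potentialDensity h k z p ∂spaceTime

/-- The derivative of `potentialDensity` along the flow. -/
def potentialField (h k : ℝ → ℝ) (z : H2) (p : ℝ × I) : Plane →L[ℝ] ℝ :=
  (Real.exp (-p.1) * h p.2) • gaussAvgDeriv k (invStd p) (flowMap p z)

theorem measurableSet_time (δ : ℝ) : MeasurableSet {p : ℝ × I | δ < p.1} :=
  measurableSet_lt measurable_const measurable_fst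

theorem aestronglyMeasurable_invStd_flow {μ : Measure (ℝ × I)} (hμ : ∀ᵐ p ∂μ, 0 < p.1) (z : H2) :
    AEMeasurable (fun p => (invStd p, flowMap p z)) μ :=
  (aemeasurable_invStd hμ).prodMk
    ((aestronglyMeasurable_flowMap hμ).apply_continuousLinearMap z).aemeasurable

theorem IsWeight.continuous_time {h : ℝ → ℝ} {M c : ℝ} (hh : IsWeight h M c) :
    Continuous fun p : ℝ × I => Real.exp (-p.1) * h p.2 := by
  have := hh.continuous
  fun_prop

theorem aestronglyMeasurable_potentialDensity {h k : ℝ → ℝ} {M c : ℝ} (hh : IsWeight h M c)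
    (hk : Measurable k) {μ : Measure (ℝ × I)} (hμ : ∀ᵐ p ∂μ, 0 < p.1) (z : H2) :
    AEStronglyMeasurable (potentialDensity h k z) μ :=
  hh.continuous_time.aestronglyMeasurable.mul ((stronglyMeasurable_gaussAvg hk).measurable.comp_aemeasurable
    (aestronglyMeasurable_invStd_flow hμ z)).aestronglyMeasurable

theorem aestronglyMeasurable_potentialField {h k : ℝ → ℝ} {M c : ℝ} (hh : IsWeight h M c)
    (hk : Measurable k) {μ : Measure (ℝ × I)} (hμ : ∀ᵐ p ∂μ, 0 < p.1) (z : H2) :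
    AEStronglyMeasurable (potentialField h k z) μ := by
  have hm := aestronglyMeasurable_invStd_flow hμ z
  have h1 := (stronglyMeasurable_gaussAvgDeriv hk).aestronglyMeasurable
    (μ := μ.map fun p => (invStd p, flowMap p z))
  have h2 : AEStronglyMeasurable (fun p => gaussAvgDeriv k (invStd p) (flowMap p z)) μ :=
    h1.comp_aemeasurable hm
  exact hh.continuous_time.aestronglyMeasurable.smul h2

theorem abs_mul_weight_le {h : ℝ → ℝ} {M c : ℝ} (hh : IsWeight h M c) (p : ℝ × I) :
    |Real.exp (-p.1) * h p.2| ≤ M * Real.exp (-p.1) := by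
  rw [abs_mul, abs_of_pos (Real.exp_pos _), mul_comm]
  exact mul_le_mul_of_nonneg_right (hh.abs_le _) (Real.exp_pos _).le

theorem max_one_pow_le {x : ℝ} (n : ℕ) : max 1 x ^ n ≤ 1 + |x| ^ n := by
  rcases le_total 1 x with h | h
  · rw [max_eq_right h, abs_of_nonneg (by linarith)]; linarith
  · rw [max_eq_left h, one_pow]; linarith [pow_nonneg (abs_nonneg x) n]

theorem abs_potentialDensity_le {h : ℝ → ℝ} {M c : ℝ} (hh : IsWeight h M c) :
    ∃ B : ℝ, 0 ≤ B ∧ ∀ {k : ℝ → ℝ} {C : ℝ}, KernelBound k C → ∀ z p, 0 < p.1 →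
      |potentialDensity h k z p| ≤ C * B * (Real.exp (-p.1) * (1 + p.1 ^ (-(3 / 4) : ℝ))) := by
  obtain ⟨S, hS, hinv⟩ := invStd_le hh.pos
  refine ⟨M * avgConst * S ^ 3, mul_nonneg (mul_nonneg hh.nonneg avgConst_nonneg) (by positivity),
    fun {k C} hk z p hp => ?_⟩
  have hx := Real.rpow_pos_of_pos hp (-(3 / 4))
  have hB : 0 ≤ C * avgConst := mul_nonneg hk.nonneg avgConst_nonneg
  by_cases hr : h p.2 = 0
  · rw [potentialDensity, hr, mul_zero, zero_mul, abs_zero]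
    have := mul_nonneg hh.nonneg avgConst_nonneg
    have := hk.nonneg
    positivity
  have h3 : invStd p ^ 3 ≤ S ^ 3 * (1 + p.1 ^ (-(3 / 4) : ℝ)) := by
    refine (pow_le_pow_left₀ (invStd_nonneg p) (hinv p hp (hh.sin_sq_ge _ hr)) 3).trans ?_
    rw [mul_pow]
    refine mul_le_mul_of_nonneg_left ((max_one_pow_le 3).trans (le_of_eq ?_)) (by positivity)
    rw [abs_of_pos (Real.rpow_pos_of_pos hp _), ← Real.rpow_natCast, ← Real.rpow_mul hp.le]
    norm_num
  rw [potentialDensity, abs_mul]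
  calc _ ≤ (M * Real.exp (-p.1)) * (C * avgConst * (S ^ 3 * (1 + p.1 ^ (-(3 / 4) : ℝ)))) :=
        mul_le_mul (abs_mul_weight_le hh p) ((abs_gaussAvg_le hk (invStd_nonneg p) _).trans
          (mul_le_mul_of_nonneg_left h3 hB)) (abs_nonneg _)
          (mul_nonneg hh.nonneg (Real.exp_pos _).le)
    _ = _ := by ring

theorem integrableOn_exp_mul_rpow {a : ℝ} (ha : -1 < a) :
    IntegrableOn (fun t : ℝ => Real.exp (-t) * t ^ a) (Ioi 0) := by
  have := Real.GammaIntegral_convergent (s := a + 1) (by linarith)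
  simpa using this

theorem integrable_potential_bound :
    Integrable (fun p : ℝ × I => Real.exp (-p.1) * (1 + p.1 ^ (-(3 / 4) : ℝ))) spaceTime := by
  refine integrable_spaceTime_fst (f := fun t => Real.exp (-t) * (1 + t ^ (-(3 / 4) : ℝ))) ?_
  simp_rw [mul_add, mul_one]
  exact (integrableOn_exp_neg_Ioi 0).add (integrableOn_exp_mul_rpow (by norm_num))

theorem integrable_potentialDensity {h k : ℝ → ℝ} {M c C : ℝ} (hh : IsWeight h M c)
    (hk : KernelBound k C) (z : H2) : Integrable (potentialDensity h k z) spaceTime := by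
  obtain ⟨B, -, hB⟩ := abs_potentialDensity_le hh
  refine (integrable_potential_bound.const_mul (C * B)).mono'
    (aestronglyMeasurable_potentialDensity hh hk.measurable ae_spaceTime_pos z) ?_
  filter_upwards [ae_spaceTime_pos] with p hp
  exact hB hk z p hp

theorem abs_truncPotential_le {h : ℝ → ℝ} {M c : ℝ} (hh : IsWeight h M c) :
    ∃ B : ℝ, 0 ≤ B ∧ ∀ {k : ℝ → ℝ} {C : ℝ}, KernelBound k C → ∀ δ z,
      |truncPotential h k δ z| ≤ C * B := by
  obtain ⟨B, hB0, hB⟩ := abs_potentialDensity_le hh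
  have hn : ∀ p : ℝ × I, 0 < p.1 → 0 ≤ Real.exp (-p.1) * (1 + p.1 ^ (-(3 / 4) : ℝ)) := fun p hp => by
    have := Real.rpow_pos_of_pos hp (-(3 / 4)); positivity
  refine ⟨B * ∫ p : ℝ × I, Real.exp (-p.1) * (1 + p.1 ^ (-(3 / 4) : ℝ)) ∂spaceTime,
    mul_nonneg hB0 (integral_nonneg_of_ae (ae_spaceTime_pos.mono hn)), fun {k C} hk δ z => ?_⟩
  rw [truncPotential, ← mul_assoc, ← integral_const_mul]
  refine (norm_integral_le_of_norm_le (f := potentialDensity h k z) (integrable_potential_bound.const_mul (C * B)).restrict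
    (ae_restrict_of_ae (ae_spaceTime_pos.mono fun p hp => hB hk z p hp))).trans ?_
  refine setIntegral_le_integral (integrable_potential_bound.const_mul _) ?_
  exact ae_spaceTime_pos.mono fun p hp => mul_nonneg (mul_nonneg hk.nonneg hB0) (hn p hp)

theorem tendsto_truncPotential {ι : Type*} {l : Filter ι} [l.IsCountablyGenerated] {h : ℝ → ℝ}
    {M c C : ℝ} (hh : IsWeight h M c) {k : ι → ℝ → ℝ} {k₀ : ℝ → ℝ}
    (hk : ∀ᶠ i in l, KernelBound (k i) C)
    (hlim : ∀ x, 0 < x → Tendsto (fun i => k i x) l (𝓝 (k₀ x))) (δ : ℝ) (z : H2) :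
    Tendsto (fun i => truncPotential h (k i) δ z) l (𝓝 (truncPotential h k₀ δ z)) := by
  obtain ⟨B, hB0, hB⟩ := abs_potentialDensity_le hh
  have hpos : ∀ᵐ p ∂(spaceTime.restrict {p : ℝ × I | δ < p.1}), 0 < p.1 :=
    ae_restrict_of_ae ae_spaceTime_pos
  refine tendsto_integral_filter_of_dominated_convergence
    (fun p => C * B * (Real.exp (-p.1) * (1 + p.1 ^ (-(3 / 4) : ℝ))))
    (hk.mono fun i hi => aestronglyMeasurable_potentialDensity hh hi.measurable hpos z)
    (hk.mono fun i hi => hpos.mono fun p hp => hB hi z p hp)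
    (integrable_potential_bound.const_mul _).restrict (Eventually.of_forall fun p => ?_)
  exact (tendsto_gaussAvg hk hlim (invStd_nonneg p) _).const_mul _

theorem tendsto_truncPotential_nat {h k : ℝ → ℝ} {M c C : ℝ} (hh : IsWeight h M c)
    (hk : KernelBound k C) (z : H2) :
    Tendsto (fun n : ℕ => truncPotential h k (1 / ((n : ℝ) + 1)) z) atTop
      (𝓝 (truncPotential h k 0 z)) := by
  have hi := integrable_potentialDensity hh hk z
  simp_rw [truncPotential, ← integral_indicator (measurableSet_time _)]
  refine tendsto_integral_of_dominated_convergence (fun p => ‖potentialDensity h k z p‖)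
    (fun n => hi.aestronglyMeasurable.indicator (measurableSet_time _)) hi.norm
    (fun n => Eventually.of_forall fun p => norm_indicator_le_norm_self _ _) ?_
  filter_upwards [ae_spaceTime_pos] with p hp
  refine tendsto_const_nhds.congr' ?_
  filter_upwards [(tendsto_one_div_add_atTop_nhds_zero_nat (𝕜 := ℝ)).eventually (gt_mem_nhds hp)]
    with n hn
  rw [indicator_of_mem (show p ∈ {p : ℝ × I | 0 < p.1} from hp),
    indicator_of_mem (show p ∈ {p : ℝ × I | 1 / ((n : ℝ) + 1) < p.1} from hn)]

theorem norm_potentialField_comp_le {h : ℝ → ℝ} {M c δ : ℝ} (hh : IsWeight h M c) (hδ : 0 < δ) :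
    ∃ B : ℝ, ∀ {k : ℝ → ℝ} {C : ℝ}, KernelBound k C → ∀ z p, δ < p.1 →
      ‖(potentialField h k z p).comp (flowMap p)‖ ≤ C * B * Real.exp (-p.1) := by
  obtain ⟨S, hS, hinv⟩ := invStd_le hh.pos
  obtain ⟨E, hE0, hE⟩ := norm_flowMap_le hδ
  have hM := hh.nonneg
  have hav := avgConst_nonneg
  refine ⟨M * avgConst * (S * max 1 (δ ^ (-(1 / 4) : ℝ))) ^ 4 * E, fun {k C} hk z p hp => ?_⟩
  have hC := hk.nonneg
  by_cases hr : h p.2 = 0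
  · rw [potentialField, hr, mul_zero, zero_smul, ContinuousLinearMap.zero_comp, norm_zero]
    positivity
  have h4 : invStd p ^ 4 ≤ (S * max 1 (δ ^ (-(1 / 4) : ℝ))) ^ 4 := by
    refine pow_le_pow_left₀ (invStd_nonneg p)
      ((hinv p (hδ.trans hp) (hh.sin_sq_ge _ hr)).trans ?_) 4
    refine mul_le_mul_of_nonneg_left (max_le_max_left _ ?_) hS.le
    exact Real.rpow_le_rpow_of_nonpos hδ hp.le (by norm_num)
  refine (ContinuousLinearMap.opNorm_comp_le _ _).trans ?_
  rw [potentialField, norm_smul, Real.norm_eq_abs]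
  calc _ ≤ (M * Real.exp (-p.1)) * (C * avgConst * (S * max 1 (δ ^ (-(1 / 4) : ℝ))) ^ 4) * E := by
        refine mul_le_mul (mul_le_mul (abs_mul_weight_le hh p)
          ((norm_gaussAvgDeriv_le hk (invStd_nonneg p) _).trans
          (mul_le_mul_of_nonneg_left h4 (by positivity))) (norm_nonneg _) (by positivity))
          (hE p hp.le) (norm_nonneg _) (by positivity)
    _ = _ := by ring

theorem integrable_exp_neg_spaceTime : Integrable (fun p : ℝ × I => Real.exp (-p.1)) spaceTime :=
  integrable_spaceTime_fst (f := fun t => Real.exp (-t)) (integrableOn_exp_neg_Ioi 0)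

theorem aestronglyMeasurable_potentialField_comp {h k : ℝ → ℝ} {M c : ℝ} (hh : IsWeight h M c)
    (hk : Measurable k) {μ : Measure (ℝ × I)} (hμ : ∀ᵐ p ∂μ, 0 < p.1) (z : H2) :
    AEStronglyMeasurable (fun p => (potentialField h k z p).comp (flowMap p)) μ :=
  (isBoundedBilinearMap_comp (𝕜 := ℝ) (E := H2) (F := Plane) (G := ℝ)).continuous.comp_aestronglyMeasurable
    ((aestronglyMeasurable_potentialField hh hk hμ z).prodMk (aestronglyMeasurable_flowMap hμ))

theorem ae_restrict_time (δ : ℝ) :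
    ∀ᵐ p ∂(spaceTime.restrict {p : ℝ × I | δ < p.1}), 0 < p.1 ∧ δ < p.1 :=
  (ae_restrict_of_ae ae_spaceTime_pos).and (ae_restrict_mem (measurableSet_time δ))

theorem hasFDerivAt_truncPotential {h k : ℝ → ℝ} {M c C δ : ℝ} (hh : IsWeight h M c) (hδ : 0 < δ)
    (hk : KernelBound k C) (z : H2) :
    HasFDerivAt (truncPotential h k δ)
      (∫ p in {p : ℝ × I | δ < p.1}, (potentialField h k z p).comp (flowMap p) ∂spaceTime) z := by
  obtain ⟨B, hB⟩ := norm_potentialField_comp_le hh hδ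
  have hpos := (ae_restrict_time δ).mono fun p hp => hp.1
  refine hasFDerivAt_integral_of_dominated_of_fderiv_le (s := univ)
    (F' := fun z p => (potentialField h k z p).comp (flowMap p))
    (bound := fun p => C * B * Real.exp (-p.1)) univ_mem
    (Eventually.of_forall fun z => aestronglyMeasurable_potentialDensity hh hk.measurable hpos z)
    (integrable_potentialDensity hh hk z).restrict
    (aestronglyMeasurable_potentialField_comp hh hk.measurable hpos z)
    ((ae_restrict_time δ).mono fun p hp z _ => hB hk z p hp.2)
    (integrable_exp_neg_spaceTime.const_mul _).restrict
    (Eventually.of_forall fun p z _ => ?_)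
  have h1 := (hasFDerivAt_gaussAvg hk (invStd_nonneg p) (flowMap p z)).comp z (flowMap p).hasFDerivAt
  refine (h1.const_mul (Real.exp (-p.1) * h p.2)).congr_fderiv ?_
  rw [potentialField, ContinuousLinearMap.smul_comp]

theorem continuous_integral_potentialField {h k : ℝ → ℝ} {M c C δ : ℝ} (hh : IsWeight h M c)
    (hδ : 0 < δ) (hk : KernelBound k C) : Continuous fun z =>
      ∫ p in {p : ℝ × I | δ < p.1}, (potentialField h k z p).comp (flowMap p) ∂spaceTime := by
  obtain ⟨B, hB⟩ := norm_potentialField_comp_le hh hδ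
  have hpos := (ae_restrict_time δ).mono fun p hp => hp.1
  refine continuous_of_dominated
    (fun z => aestronglyMeasurable_potentialField_comp hh hk.measurable hpos z)
    (fun z => (ae_restrict_time δ).mono fun p hp => hB hk z p hp.2)
    (integrable_exp_neg_spaceTime.const_mul _).restrict (Eventually.of_forall fun p => ?_)
  refine Continuous.clm_comp ?_ continuous_const
  exact ((continuous_gaussAvgDeriv hk (invStd_nonneg p)).comp
    (flowMap p).continuous).const_smul (Real.exp (-p.1) * h p.2)

theorem contDiff_truncPotential {h k : ℝ → ℝ} {M c C δ : ℝ} (hh : IsWeight h M c) (hδ : 0 < δ)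
    (hk : KernelBound k C) : ContDiff ℝ 1 (truncPotential h k δ) := by
  have hd := fun z => hasFDerivAt_truncPotential hh hδ hk z
  refine contDiff_one_iff_fderiv.2 ⟨fun z => (hd z).differentiableAt, ?_⟩
  rw [show fderiv ℝ (truncPotential h k δ) = _ from funext fun z => (hd z).fderiv]
  exact continuous_integral_potentialField hh hδ hk

theorem norm_fderiv_truncPotential_le {h k : ℝ → ℝ} {M c C δ : ℝ} (hh : IsWeight h M c)
    (hδ : 0 < δ) (hk : KernelBound k C) :
    ∃ B, ∀ z, ‖fderiv ℝ (truncPotential h k δ) z‖ ≤ B := by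
  obtain ⟨B, hB⟩ := norm_potentialField_comp_le hh hδ
  refine ⟨∫ p in {p : ℝ × I | δ < p.1}, C * B * Real.exp (-p.1) ∂spaceTime, fun z => ?_⟩
  rw [(hasFDerivAt_truncPotential hh hδ hk z).fderiv]
  exact norm_integral_le_of_norm_le (integrable_exp_neg_spaceTime.const_mul (C * B)).restrict
    ((ae_restrict_time δ).mono fun p hp => hB hk z p hp.2)

theorem hasSobolevGradient_truncPotential {μ : Measure H2} [IsFiniteMeasure μ] {h k : ℝ → ℝ}
    {M c C δ : ℝ} (hh : IsWeight h M c) (hδ : 0 < δ) (hk : KernelBound k C) :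
    HasSobolevGradient μ (truncPotential h k δ) (gradient (truncPotential h k δ)) := by
  obtain ⟨B, -, hB⟩ := abs_truncPotential_le hh
  obtain ⟨B', hB'⟩ := norm_fderiv_truncPotential_le hh hδ hk
  exact hasSobolevGradient_of_contDiff (contDiff_truncPotential hh hδ hk) (hB hk δ) hB'

/-! ### Energy estimates -/

/-- The weight `e^{-t} t^{-15/16}`. -/
def energyWeight (p : ℝ × I) : ENNReal := ENNReal.ofReal (Real.exp (-p.1) * p.1 ^ (-(15 / 16) : ℝ))

/-- The total mass of `energyWeight`. -/
def energyMass : ENNReal :=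
  ∫⁻ t in Ioi (0 : ℝ), ENNReal.ofReal (Real.exp (-t) * t ^ (-(15 / 16) : ℝ))

/-- The weighted square norm of a field. -/
def energy (c : ℝ × I → Plane →L[ℝ] ℝ) : ENNReal := ∫⁻ p, ‖c p‖ₑ ^ 2 / energyWeight p ∂spaceTime

theorem energyMass_ne_top : energyMass ≠ ⊤ :=
  (integrableOn_exp_mul_rpow (a := -(15 / 16)) (by norm_num)).lintegral_lt_top.ne

theorem energyWeight_ne_top (p : ℝ × I) : energyWeight p ≠ ⊤ := ENNReal.ofReal_ne_top

theorem energyWeight_ne_zero {p : ℝ × I} (hp : 0 < p.1) : energyWeight p ≠ 0 :=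
  (ENNReal.ofReal_pos.2 (mul_pos (Real.exp_pos _) (Real.rpow_pos_of_pos hp _))).ne'

theorem measurable_energyWeight : Measurable energyWeight := by
  unfold energyWeight; fun_prop

theorem lintegral_energyWeight_mul_flowMap_le (w : H2) :
    ∫⁻ p, energyWeight p * ‖flowMap p w‖ₑ ^ 2 ∂spaceTime ≤ energyMass * ‖w‖ₑ ^ 2 := by
  have hm : AEMeasurable (fun p => energyWeight p * ‖flowMap p w‖ₑ ^ 2) spaceTime :=
    measurable_energyWeight.aemeasurable.mul
      (((aestronglyMeasurable_flowMap ae_spaceTime_pos).apply_continuousLinearMap w).enorm.pow_const 2)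
  rw [spaceTime, lintegral_prod _ hm, energyMass, ← lintegral_mul_const _ (by fun_prop)]
  refine setLIntegral_mono (by fun_prop) fun t ht => ?_
  simp only [energyWeight]
  rw [lintegral_const_mul' _ _ ENNReal.ofReal_ne_top]
  exact mul_le_mul_right (lintegral_heatFlow_sq_le ht w) _

theorem lintegral_enorm_mul_flowMap_le {c : ℝ × I → Plane →L[ℝ] ℝ}
    (hc : AEStronglyMeasurable c spaceTime) (w : H2) :
    ∫⁻ p, ‖c p‖ₑ * ‖flowMap p w‖ₑ ∂spaceTime ≤
      (energyMass * energy c) ^ (1 / 2 : ℝ) * ‖w‖ₑ := by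
  have hflow := ((aestronglyMeasurable_flowMap ae_spaceTime_pos).apply_continuousLinearMap w).enorm
  have hw2 : Measurable fun p => energyWeight p ^ (1 / 2 : ℝ) := measurable_energyWeight.pow_const _
  have h := ENNReal.lintegral_mul_le_Lp_mul_Lq spaceTime Real.HolderConjugate.two_two
    (f := fun p => ‖c p‖ₑ / energyWeight p ^ (1 / 2 : ℝ))
    (g := fun p => energyWeight p ^ (1 / 2 : ℝ) * ‖flowMap p w‖ₑ)
    (hc.enorm.div hw2.aemeasurable) (hw2.aemeasurable.mul hflow)
  have hsq : ∀ x : ENNReal, (x ^ (1 / 2 : ℝ)) ^ 2 = x := fun x => by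
    rw [← ENNReal.rpow_natCast, ← ENNReal.rpow_mul]; norm_num
  have e1 : ∫⁻ p, ‖c p‖ₑ * ‖flowMap p w‖ₑ ∂spaceTime = ∫⁻ p, ((fun p => ‖c p‖ₑ /
      energyWeight p ^ (1 / 2 : ℝ)) * fun p => energyWeight p ^ (1 / 2 : ℝ) * ‖flowMap p w‖ₑ) p
      ∂spaceTime := by
    refine lintegral_congr_ae ?_
    filter_upwards [ae_spaceTime_pos] with p hp
    rw [Pi.mul_apply, ← mul_assoc, ENNReal.div_mul_cancel]
    · simpa using energyWeight_ne_zero hp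
    · simpa using energyWeight_ne_top p
  have e2 : ∀ p, (‖c p‖ₑ / energyWeight p ^ (1 / 2 : ℝ)) ^ (2 : ℝ) = ‖c p‖ₑ ^ 2 / energyWeight p := by
    intro p
    rw [ENNReal.div_rpow_of_nonneg _ _ zero_le_two, ENNReal.rpow_ofNat, ENNReal.rpow_ofNat, hsq]
  have e3 : ∀ p, (energyWeight p ^ (1 / 2 : ℝ) * ‖flowMap p w‖ₑ) ^ (2 : ℝ) =
      energyWeight p * ‖flowMap p w‖ₑ ^ 2 := by
    intro p
    rw [ENNReal.mul_rpow_of_nonneg _ _ zero_le_two, ENNReal.rpow_ofNat, ENNReal.rpow_ofNat, hsq]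
  rw [e1]
  refine h.trans ?_
  simp_rw [e2, e3]
  rw [mul_comm energyMass, ENNReal.mul_rpow_of_nonneg _ _ (by norm_num), mul_assoc, ← energy]
  gcongr
  refine (ENNReal.rpow_le_rpow (lintegral_energyWeight_mul_flowMap_le w) (by norm_num)).trans ?_
  rw [ENNReal.mul_rpow_of_nonneg _ _ (by norm_num), ← ENNReal.rpow_natCast, ← ENNReal.rpow_mul]
  norm_num

theorem enorm_integral_comp_flowMap_sq_le {c : ℝ × I → Plane →L[ℝ] ℝ}
    (hc : AEStronglyMeasurable c spaceTime) :
    ‖∫ p, (c p).comp (flowMap p) ∂spaceTime‖ₑ ^ 2 ≤ energyMass * energy c := by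
  by_cases hi : Integrable (fun p => (c p).comp (flowMap p)) spaceTime
  swap
  · rw [integral_undef hi, ← ofReal_norm, norm_zero, ENNReal.ofReal_zero, zero_pow two_ne_zero]; exact zero_le
  by_cases htop : energyMass * energy c = ⊤
  · rw [htop]; exact le_top
  set B := (energyMass * energy c) ^ (1 / 2 : ℝ) with hB
  have hBtop : B ≠ ⊤ := ENNReal.rpow_ne_top_of_nonneg (by norm_num) htop
  have hle : ‖∫ p, (c p).comp (flowMap p) ∂spaceTime‖ₑ ≤ B := by
    rw [← ofReal_norm, ENNReal.ofReal_le_iff_le_toReal hBtop]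
    refine ContinuousLinearMap.opNorm_le_bound _ ENNReal.toReal_nonneg fun w => ?_
    rw [ContinuousLinearMap.integral_apply hi]
    have h : ‖∫ p, ((c p).comp (flowMap p)) w ∂spaceTime‖ₑ ≤ B * ‖w‖ₑ := by
      refine (enorm_integral_le_lintegral_enorm _).trans (le_trans (lintegral_mono fun p => ?_)
        (lintegral_enorm_mul_flowMap_le hc w))
      exact (c p).le_opENorm _
    have h2 := ENNReal.toReal_mono (by finiteness) h
    rwa [ENNReal.toReal_mul, toReal_enorm, toReal_enorm] at h2
  calc _ ≤ B ^ 2 := pow_le_pow_left' hle 2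
    _ = _ := by rw [hB, ← ENNReal.rpow_natCast, ← ENNReal.rpow_mul]; norm_num

/-- The field of the truncated potential. -/
def truncField (h k : ℝ → ℝ) (δ : ℝ) (z : H2) : ℝ × I → Plane →L[ℝ] ℝ :=
  {p : ℝ × I | δ < p.1}.indicator (potentialField h k z)

theorem aestronglyMeasurable_truncField {h k : ℝ → ℝ} {M c : ℝ} (hh : IsWeight h M c)
    (hk : Measurable k) (δ : ℝ) (z : H2) : AEStronglyMeasurable (truncField h k δ z) spaceTime :=
  (aestronglyMeasurable_potentialField hh hk ae_spaceTime_pos z).indicator (measurableSet_time δ)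

theorem truncField_comp (h k : ℝ → ℝ) (δ : ℝ) (z : H2) :
    (fun p => (truncField h k δ z p).comp (flowMap p)) =
      {p : ℝ × I | δ < p.1}.indicator fun p => (potentialField h k z p).comp (flowMap p) := by
  funext p
  by_cases hp : p ∈ {p : ℝ × I | δ < p.1}
  · rw [truncField, indicator_of_mem hp, indicator_of_mem hp]
  · rw [truncField, indicator_of_notMem hp, indicator_of_notMem hp, ContinuousLinearMap.zero_comp]

theorem fderiv_truncPotential {h k : ℝ → ℝ} {M c C δ : ℝ} (hh : IsWeight h M c) (hδ : 0 < δ)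
    (hk : KernelBound k C) (z : H2) : fderiv ℝ (truncPotential h k δ) z =
      ∫ p, (truncField h k δ z p).comp (flowMap p) ∂spaceTime := by
  rw [(hasFDerivAt_truncPotential hh hδ hk z).fderiv, truncField_comp,
    integral_indicator (measurableSet_time δ)]

theorem integrable_truncField_comp {h k : ℝ → ℝ} {M c C δ : ℝ} (hh : IsWeight h M c) (hδ : 0 < δ)
    (hk : KernelBound k C) (z : H2) :
    Integrable (fun p => (truncField h k δ z p).comp (flowMap p)) spaceTime := by
  obtain ⟨B, hB⟩ := norm_potentialField_comp_le hh hδ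
  have hm : AEStronglyMeasurable (fun p => (truncField h k δ z p).comp (flowMap p)) spaceTime :=
    (isBoundedBilinearMap_comp (𝕜 := ℝ) (E := H2) (F := Plane)
      (G := ℝ)).continuous.comp_aestronglyMeasurable
      ((aestronglyMeasurable_truncField hh hk.measurable δ z).prodMk
        (aestronglyMeasurable_flowMap ae_spaceTime_pos))
  refine (integrable_exp_neg_spaceTime.const_mul |C * B|).mono' hm (Eventually.of_forall fun p => ?_)
  by_cases hp : p ∈ {p : ℝ × I | δ < p.1}
  · rw [truncField, indicator_of_mem hp]
    exact (hB hk z p hp).trans (mul_le_mul_of_nonneg_right (le_abs_self _) (Real.exp_pos _).le)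
  · rw [truncField, indicator_of_notMem hp, ContinuousLinearMap.zero_comp, norm_zero]
    positivity

theorem enorm_gradient_sub_sq_le {h k k' : ℝ → ℝ} {M c C C' δ δ' : ℝ} (hh : IsWeight h M c)
    (hδ : 0 < δ) (hδ' : 0 < δ') (hk : KernelBound k C) (hk' : KernelBound k' C') (z : H2) :
    ‖gradient (truncPotential h k δ) z - gradient (truncPotential h k' δ') z‖ₑ ^ 2 ≤
      energyMass * energy (fun p => truncField h k δ z p - truncField h k' δ' z p) := by
  rw [← ofReal_norm, norm_gradient_sub, ofReal_norm, fderiv_truncPotential hh hδ hk,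
    fderiv_truncPotential hh hδ' hk', ← integral_sub (integrable_truncField_comp hh hδ hk z)
      (integrable_truncField_comp hh hδ' hk' z)]
  simp_rw [← ContinuousLinearMap.sub_comp]
  exact enorm_integral_comp_flowMap_sq_le ((aestronglyMeasurable_truncField hh hk.measurable δ z).sub
    (aestronglyMeasurable_truncField hh hk'.measurable δ' z))

/-- The function dominating the energy density of all potential fields. -/
def dominant (h : ℝ → ℝ) (K : ℝ) (z : H2) (p : ℝ × I) : ENNReal :=
  ENNReal.ofReal (K * (Real.exp (-p.1) * (p.1 ^ (15 / 16 : ℝ) + p.1 ^ (-(15 / 16) : ℝ)))) *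
    (1 + {p : ℝ × I | p.1 ≤ 1 ∧ h p.2 ≠ 0}.indicator
      (fun p => ‖flowMap p z 0‖ₑ ^ (-(1 / 2) : ℝ)) p)

theorem sq_mul_rpow_le {a x n Q : ℝ} (ha : 0 ≤ a) (hx : 0 < x) (hn : 0 ≤ n)
    (h : (1 + a * x) ^ (1 / 4 : ℝ) * n ≤ Q * a ^ 4) (hn0 : a = 0 → n = 0) :
    n ^ 2 ≤ Q ^ 2 * a ^ (15 / 2 : ℝ) * x ^ (-(1 / 2) : ℝ) := by
  rcases ha.eq_or_lt with rfl | ha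
  · rw [hn0 rfl, Real.zero_rpow (by norm_num)]; simp
  have h1 : (a * x) ^ (1 / 4 : ℝ) * n ≤ Q * a ^ 4 := by
    refine le_trans ?_ h
    gcongr
    linarith
  have h2 := pow_le_pow_left₀ (by positivity) h1 2
  have e1 : ((a * x) ^ (1 / 4 : ℝ) * n) ^ 2 = a ^ (1 / 2 : ℝ) * x ^ (1 / 2 : ℝ) * n ^ 2 := by
    rw [mul_pow, Real.mul_rpow ha.le hx.le, mul_pow, ← Real.rpow_natCast, ← Real.rpow_natCast,
      ← Real.rpow_mul ha.le, ← Real.rpow_mul hx.le]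
    norm_num
  have e2 : (Q * a ^ 4) ^ 2 = a ^ (1 / 2 : ℝ) * (Q ^ 2 * a ^ (15 / 2 : ℝ)) := by
    have : a ^ (1 / 2 : ℝ) * a ^ (15 / 2 : ℝ) = a ^ 8 := by
      rw [← Real.rpow_add ha, ← Real.rpow_natCast]; norm_num
    rw [mul_left_comm, this]; ring
  rw [e1, e2, mul_assoc] at h2
  have h3 := le_of_mul_le_mul_left h2 (Real.rpow_pos_of_pos ha _)
  rw [Real.rpow_neg hx.le, ← div_eq_mul_inv, le_div_iff₀ (Real.rpow_pos_of_pos hx _)]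
  linarith

theorem gaussAvgDeriv_zero (k : ℝ → ℝ) (m : Plane) : gaussAvgDeriv k 0 m = 0 := by
  simp [gaussAvgDeriv]

theorem enorm_sq_div_energyWeight_le {E : Type*} [NormedAddCommGroup E] {v : E} {p : ℝ × I} {X : ℝ}
    (hp : 0 < p.1) (hX : ‖v‖ ^ 2 ≤ Real.exp (-p.1) ^ 2 * X) :
    ‖v‖ₑ ^ 2 / energyWeight p ≤ ENNReal.ofReal (X * (Real.exp (-p.1) * p.1 ^ (15 / 16 : ℝ))) := by
  have hw : 0 < Real.exp (-p.1) * p.1 ^ (-(15 / 16) : ℝ) :=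
    mul_pos (Real.exp_pos _) (Real.rpow_pos_of_pos hp _)
  rw [energyWeight, ← ofReal_norm, ← ENNReal.ofReal_pow (norm_nonneg _),
    ← ENNReal.ofReal_div_of_pos hw]
  refine ENNReal.ofReal_le_ofReal ?_
  rw [div_le_iff₀ hw]
  refine hX.trans (le_of_eq ?_)
  have : p.1 ^ (15 / 16 : ℝ) * p.1 ^ (-(15 / 16) : ℝ) = 1 := by
    rw [← Real.rpow_add hp]; norm_num
  linear_combination (-Real.exp (-p.1) ^ 2 * X) * this

theorem enorm_potentialField_sq_div_le {h : ℝ → ℝ} {M c : ℝ} (hh : IsWeight h M c) :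
    ∃ K : ℝ, 0 < K ∧ ∀ {k : ℝ → ℝ} {C : ℝ}, KernelBound k C → ∀ z p, 0 < p.1 →
      ‖potentialField h k z p‖ₑ ^ 2 / energyWeight p ≤ ENNReal.ofReal (C ^ 2) * dominant h K z p := by
  obtain ⟨S₀, hS₀, hinv₀⟩ := invStd_le hh.pos
  set S := S₀ + 1 with hSdef
  have hS1 : 1 ≤ S := by linarith
  have hS : 0 < S := by linarith
  have hinv : ∀ p : ℝ × I, 0 < p.1 → h p.2 ≠ 0 →
      invStd p ≤ S * max 1 (p.1 ^ (-(1 / 4) : ℝ)) := fun p hp hr =>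
    (hinv₀ p hp (hh.sin_sq_ge _ hr)).trans (mul_le_mul_of_nonneg_right (by linarith) (by positivity))
  have hM := hh.nonneg
  have hav := avgConst_nonneg
  refine ⟨(M * avgConst * S ^ 4) ^ 2 + 1, by positivity, fun {k C} hk z p hp => ?_⟩
  have hC := hk.nonneg
  have hσ := invStd_nonneg p
  by_cases hzero : potentialField h k z p = 0
  · rw [hzero, ← ofReal_norm, norm_zero, ENNReal.ofReal_zero, zero_pow two_ne_zero, ENNReal.zero_div]; exact zero_le
  have hr : h p.2 ≠ 0 := by
    rintro hr; exact hzero (by rw [potentialField, hr, mul_zero, zero_smul])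
  have hCpos : 0 < C := by
    refine lt_of_le_of_ne hC fun h0 => hzero ?_
    have := norm_gaussAvgDeriv_le hk hσ (flowMap p z)
    rw [← h0, zero_mul, zero_mul] at this
    rw [potentialField, norm_le_zero_iff.1 this, smul_zero]
  have hnorm : ‖potentialField h k z p‖ ≤
      M * Real.exp (-p.1) * ‖gaussAvgDeriv k (invStd p) (flowMap p z)‖ := by
    rw [potentialField, norm_smul]
    exact mul_le_mul_of_nonneg_right (abs_mul_weight_le hh p) (norm_nonneg _)
  have hnsq : ‖potentialField h k z p‖ ^ 2 ≤ Real.exp (-p.1) ^ 2 *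
      (M ^ 2 * ‖gaussAvgDeriv k (invStd p) (flowMap p z)‖ ^ 2) :=
    (pow_le_pow_left₀ (norm_nonneg _) hnorm 2).trans (le_of_eq (by ring))
  have ht1 := Real.rpow_pos_of_pos hp (15 / 16)
  have ht2 := Real.rpow_pos_of_pos hp (-(15 / 16))
  have hexp := Real.exp_pos (-p.1)
  by_cases ht : p.1 ≤ 1
  swap
  · have hσS : invStd p ≤ S := by
      refine (hinv p hp hr).trans (le_of_eq ?_)
      rw [max_eq_left, mul_one]
      exact Real.rpow_le_one_of_one_le_of_nonpos (le_of_lt (not_le.1 ht)) (by norm_num)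
    have h1 : ‖gaussAvgDeriv k (invStd p) (flowMap p z)‖ ^ 2 ≤ (C * avgConst * S ^ 4) ^ 2 := by
      refine pow_le_pow_left₀ (norm_nonneg _) ((norm_gaussAvgDeriv_le hk hσ _).trans ?_) 2
      gcongr
    refine (enorm_sq_div_energyWeight_le hp (hnsq.trans (mul_le_mul_of_nonneg_left
      (mul_le_mul_of_nonneg_left h1 (sq_nonneg M)) (by positivity)))).trans ?_
    rw [dominant, ← mul_assoc (ENNReal.ofReal (C ^ 2)), ← ENNReal.ofReal_mul (sq_nonneg C)]
    refine le_trans (ENNReal.ofReal_le_ofReal ?_) (le_mul_of_one_le_right zero_le le_self_add)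
    calc _ = C ^ 2 * ((M * avgConst * S ^ 4) ^ 2 * (Real.exp (-p.1) * p.1 ^ (15 / 16 : ℝ))) := by ring
      _ ≤ _ := by gcongr <;> linarith
  · have hmem : p ∈ {p : ℝ × I | p.1 ≤ 1 ∧ h p.2 ≠ 0} := ⟨ht, hr⟩
    rw [dominant, indicator_of_mem hmem]
    have hpos : 0 < ((M * avgConst * S ^ 4) ^ 2 + 1) * (Real.exp (-p.1) *
        (p.1 ^ (15 / 16 : ℝ) + p.1 ^ (-(15 / 16) : ℝ))) := by positivity
    by_cases hx0 : flowMap p z 0 = 0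
    · rw [hx0, enorm_zero, ENNReal.zero_rpow_of_neg (by norm_num), add_top, ENNReal.mul_top
        (ENNReal.ofReal_pos.2 hpos).ne', ENNReal.mul_top (ENNReal.ofReal_pos.2 (by positivity)).ne']
      exact le_top
    have hx : 0 < |flowMap p z 0| := abs_pos.2 hx0
    have hσS : invStd p ^ (15 / 2 : ℝ) ≤ S ^ 8 * p.1 ^ (-(15 / 8) : ℝ) := by
      have h1 : invStd p ≤ S * p.1 ^ (-(1 / 4) : ℝ) := by
        refine (hinv p hp hr).trans (le_of_eq ?_)
        rw [max_eq_right]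
        exact Real.one_le_rpow_of_pos_of_le_one_of_nonpos hp ht (by norm_num)
      refine (Real.rpow_le_rpow hσ h1 (by norm_num)).trans ?_
      rw [Real.mul_rpow hS.le (Real.rpow_nonneg hp.le _), ← Real.rpow_mul hp.le]
      have : S ^ (15 / 2 : ℝ) ≤ S ^ 8 := by
        rw [← Real.rpow_natCast]; exact Real.rpow_le_rpow_of_exponent_le hS1 (by norm_num)
      rw [show (-(1 / 4) : ℝ) * (15 / 2) = -(15 / 8) by norm_num]
      exact mul_le_mul_of_nonneg_right this (Real.rpow_nonneg hp.le _)
    have hcoord : |flowMap p z 0| ≤ ‖flowMap p z‖ := PiLp.norm_apply_le (flowMap p z) 0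
    have h1 := sq_mul_rpow_le hσ hx (norm_nonneg (gaussAvgDeriv k (invStd p) (flowMap p z)))
      (Q := C * avgConst) (le_trans (by gcongr) (rpow_mul_norm_gaussAvgDeriv_le hk hσ (flowMap p z)))
      (fun h0 => by rw [h0, gaussAvgDeriv_zero, norm_zero])
    have hxr := Real.rpow_pos_of_pos hx (-(1 / 2))
    have h2 : ‖gaussAvgDeriv k (invStd p) (flowMap p z)‖ ^ 2 ≤
        (C * avgConst) ^ 2 * (S ^ 8 * p.1 ^ (-(15 / 8) : ℝ)) * |flowMap p z 0| ^ (-(1 / 2) : ℝ) :=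
      h1.trans (by gcongr)
    refine (enorm_sq_div_energyWeight_le hp (hnsq.trans (mul_le_mul_of_nonneg_left
      (mul_le_mul_of_nonneg_left h2 (sq_nonneg M)) (by positivity)))).trans ?_
    have e : ‖flowMap p z 0‖ₑ ^ (-(1 / 2) : ℝ) =
        ENNReal.ofReal (|flowMap p z 0| ^ (-(1 / 2) : ℝ)) := by
      rw [← ofReal_norm, Real.norm_eq_abs, ENNReal.ofReal_rpow_of_pos hx]
    rw [← mul_assoc (ENNReal.ofReal (C ^ 2)), ← ENNReal.ofReal_mul (sq_nonneg C), e]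
    refine le_trans ?_ (mul_le_mul_right le_add_self _)
    rw [← ENNReal.ofReal_mul (by positivity)]
    refine ENNReal.ofReal_le_ofReal ?_
    have hpp : p.1 ^ (-(15 / 8) : ℝ) * p.1 ^ (15 / 16 : ℝ) = p.1 ^ (-(15 / 16) : ℝ) := by
      rw [← Real.rpow_add hp]; norm_num
    calc _ = C ^ 2 * ((M * avgConst * S ^ 4) ^ 2 * (Real.exp (-p.1) *
          (p.1 ^ (-(15 / 8) : ℝ) * p.1 ^ (15 / 16 : ℝ)))) * |flowMap p z 0| ^ (-(1 / 2) : ℝ) := by ring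
      _ ≤ _ := by
        rw [hpp]
        gcongr <;> linarith

/-! ### The potential of a radial kernel belongs to `W^{1,2}` -/

/-- `dominant h K` dominates the energy density of all potential fields. -/
def IsDominant (h : ℝ → ℝ) (K : ℝ) : Prop :=
  ∀ (k : ℝ → ℝ) (C : ℝ), KernelBound k C → ∀ z p, 0 < p.1 →
    ‖potentialField h k z p‖ₑ ^ 2 / energyWeight p ≤ ENNReal.ofReal (C ^ 2) * dominant h K z p

/-- The first coordinate of the heat flow has a negative moment of order `1/2` under `μ`, uniformly
for small times and places in the support of `h`. -/
def HasNegMoment (μ : Measure H2) (h : ℝ → ℝ) (A : ENNReal) : Prop :=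
  ∀ p : ℝ × I, 0 < p.1 → p.1 ≤ 1 → h p.2 ≠ 0 → ∫⁻ z, ‖flowMap p z 0‖ₑ ^ (-(1 / 2) : ℝ) ∂μ ≤ A

theorem ae_prod_pos (μ : Measure H2) : ∀ᵐ q ∂(μ.prod spaceTime), 0 < q.2.1 :=
  Measure.quasiMeasurePreserving_snd.ae ae_spaceTime_pos

theorem aestronglyMeasurable_flowMap_prod (μ : Measure H2) [SFinite μ] :
    AEStronglyMeasurable (fun q : H2 × (ℝ × I) => flowMap q.2 q.1) (μ.prod spaceTime) :=
  (isBoundedBilinearMap_apply (𝕜 := ℝ) (E := H2) (F := Plane)).continuous.comp_aestronglyMeasurable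
    ((aestronglyMeasurable_flowMap ae_spaceTime_pos).comp_snd.prodMk
      continuous_fst.aestronglyMeasurable)

theorem continuous_plane_apply : Continuous fun x : Plane => x 0 :=
  (EuclideanSpace.proj (0 : Fin 2) : Plane →L[ℝ] ℝ).continuous

theorem IsWeight.measurableSet {h : ℝ → ℝ} {M c : ℝ} (hh : IsWeight h M c) :
    MeasurableSet {p : ℝ × I | p.1 ≤ 1 ∧ h p.2 ≠ 0} := by
  have hm : Measurable fun p : ℝ × I => h p.2 := (hh.continuous.comp (by fun_prop)).measurable
  exact (measurableSet_le measurable_fst measurable_const).inter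
    (hm (measurableSet_singleton (0 : ℝ)).compl)

theorem aemeasurable_dominant_prod {h : ℝ → ℝ} {M c : ℝ} (hh : IsWeight h M c) (K : ℝ)
    (μ : Measure H2) [SFinite μ] :
    AEMeasurable (fun q : H2 × (ℝ × I) => dominant h K q.1 q.2) (μ.prod spaceTime) := by
  have h1 : Measurable fun q : H2 × (ℝ × I) => ENNReal.ofReal (K * (Real.exp (-q.2.1) *
      (q.2.1 ^ (15 / 16 : ℝ) + q.2.1 ^ (-(15 / 16) : ℝ)))) := by fun_prop
  have h2 : AEMeasurable (fun q : H2 × (ℝ × I) => ‖flowMap q.2 q.1 0‖ₑ ^ (-(1 / 2) : ℝ))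
      (μ.prod spaceTime) :=
    (continuous_plane_apply.comp_aestronglyMeasurable
      (aestronglyMeasurable_flowMap_prod μ)).enorm.pow_const _
  exact h1.aemeasurable.mul (aemeasurable_const.add
    (h2.indicator (measurable_snd hh.measurableSet)))

theorem aemeasurable_dominant {h : ℝ → ℝ} {M c : ℝ} (hh : IsWeight h M c) (K : ℝ) (z : H2) :
    AEMeasurable (dominant h K z) spaceTime := by
  have h1 : Measurable fun p : ℝ × I => ENNReal.ofReal (K * (Real.exp (-p.1) *
      (p.1 ^ (15 / 16 : ℝ) + p.1 ^ (-(15 / 16) : ℝ)))) := by fun_prop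
  have h2 : AEMeasurable (fun p => ‖flowMap p z 0‖ₑ ^ (-(1 / 2) : ℝ)) spaceTime :=
    (continuous_plane_apply.comp_aestronglyMeasurable
      ((aestronglyMeasurable_flowMap ae_spaceTime_pos).apply_continuousLinearMap z)).enorm.pow_const _
  exact h1.aemeasurable.mul (aemeasurable_const.add (h2.indicator hh.measurableSet))

theorem lintegral_dominant_ne_top {h : ℝ → ℝ} {M c : ℝ} (hh : IsWeight h M c) (K : ℝ)
    {μ : Measure H2} [IsFiniteMeasure μ] {A : ENNReal} (hA : A ≠ ⊤) (hμ : HasNegMoment μ h A) :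
    ∫⁻ q, dominant h K q.1 q.2 ∂(μ.prod spaceTime) ≠ ⊤ := by
  rw [lintegral_prod_symm _ (aemeasurable_dominant_prod hh K μ)]
  have hint : Integrable (fun p : ℝ × I => K * (Real.exp (-p.1) *
      (p.1 ^ (15 / 16 : ℝ) + p.1 ^ (-(15 / 16) : ℝ)))) spaceTime := by
    refine integrable_spaceTime_fst
      (f := fun t => K * (Real.exp (-t) * (t ^ (15 / 16 : ℝ) + t ^ (-(15 / 16) : ℝ)))) ?_
    simp_rw [mul_add]
    exact ((integrableOn_exp_mul_rpow (by norm_num)).const_mul K).add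
      ((integrableOn_exp_mul_rpow (by norm_num)).const_mul K)
  refine ne_top_of_le_ne_top (ENNReal.mul_ne_top hint.lintegral_lt_top.ne
    (show μ univ + A ≠ ⊤ by finiteness)) ?_
  rw [← lintegral_mul_const' _ _ (by finiteness)]
  refine lintegral_mono_ae (ae_spaceTime_pos.mono fun p hp => ?_)
  simp only [dominant]
  rw [lintegral_const_mul' _ _ ENNReal.ofReal_ne_top]
  refine mul_le_mul_right ?_ _
  rw [lintegral_add_left measurable_const, lintegral_one]
  refine add_le_add_right ?_ _
  by_cases hmem : p ∈ {p : ℝ × I | p.1 ≤ 1 ∧ h p.2 ≠ 0}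
  · simp only [indicator_of_mem hmem]
    exact hμ p hp hmem.1 hmem.2
  · simp only [indicator_of_notMem hmem, lintegral_zero]
    exact zero_le

/-- The contribution of times at most `1 / (n + 1)` to the integral of `dominant`. -/
def dominantTail (h : ℝ → ℝ) (K : ℝ) (n : ℕ) (z : H2) : ENNReal :=
  ∫⁻ p, {p : ℝ × I | p.1 ≤ 1 / ((n : ℝ) + 1)}.indicator (dominant h K z) p ∂spaceTime

theorem measurableSet_time_le (δ : ℝ) : MeasurableSet {p : ℝ × I | p.1 ≤ δ} :=
  measurableSet_le measurable_fst measurable_const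

theorem eventually_indicator_time_eq {f : ℝ × I → ENNReal} {p : ℝ × I} (hp : 0 < p.1) :
    ∀ᶠ n : ℕ in atTop, {p : ℝ × I | p.1 ≤ 1 / ((n : ℝ) + 1)}.indicator f p = 0 := by
  filter_upwards [(tendsto_one_div_add_atTop_nhds_zero_nat (𝕜 := ℝ)).eventually (gt_mem_nhds hp)]
    with n hn
  have hp' : p ∉ {p : ℝ × I | p.1 ≤ 1 / ((n : ℝ) + 1)} := not_le.2 hn
  exact indicator_of_notMem (M := ENNReal) hp' _

theorem tendsto_dominantTail {h : ℝ → ℝ} {M c : ℝ} (hh : IsWeight h M c) (K : ℝ) {z : H2}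
    (hz : ∫⁻ p, dominant h K z p ∂spaceTime ≠ ⊤) :
    Tendsto (fun n => dominantTail h K n z) atTop (𝓝 0) := by
  have h := tendsto_lintegral_of_dominated_convergence' (μ := spaceTime)
    (F := fun (n : ℕ) p => {p : ℝ × I | p.1 ≤ 1 / ((n : ℝ) + 1)}.indicator (dominant h K z) p)
    (f := fun _ => (0 : ENNReal)) (dominant h K z)
    (fun n => (aemeasurable_dominant hh K z).indicator (measurableSet_time_le _))
    (fun n => Eventually.of_forall fun p => indicator_le_self (M := ENNReal) _ _ _) hz
    (ae_spaceTime_pos.mono fun p hp => tendsto_const_nhds.congr'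
      ((eventually_indicator_time_eq hp).mono fun n hn => hn.symm))
  simpa [dominantTail] using h

theorem tendsto_lintegral_dominantTail {h : ℝ → ℝ} {M c : ℝ} (hh : IsWeight h M c) (K : ℝ)
    {μ : Measure H2} [IsFiniteMeasure μ] {A : ENNReal} (hA : A ≠ ⊤) (hμ : HasNegMoment μ h A) :
    Tendsto (fun n => ∫⁻ z, dominantTail h K n z ∂μ) atTop (𝓝 0) := by
  have hm : ∀ n : ℕ, AEMeasurable (fun q : H2 × (ℝ × I) =>
      {p : ℝ × I | p.1 ≤ 1 / ((n : ℝ) + 1)}.indicator (dominant h K q.1) q.2) (μ.prod spaceTime) :=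
    fun n => by
      have h1 : AEMeasurable ((Prod.snd ⁻¹' {p : ℝ × I | p.1 ≤ 1 / ((n : ℝ) + 1)}).indicator
          fun q : H2 × (ℝ × I) => dominant h K q.1 q.2) (μ.prod spaceTime) :=
        (aemeasurable_dominant_prod hh K μ).indicator
          (measurable_snd (measurableSet_time_le (1 / ((n : ℝ) + 1))))
      exact h1
  have h := tendsto_lintegral_of_dominated_convergence' (μ := μ.prod spaceTime)
    (f := fun _ => (0 : ENNReal)) (fun q => dominant h K q.1 q.2) hm
    (fun n => Eventually.of_forall fun q => indicator_le_self (M := ENNReal) _ _ _)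
    (lintegral_dominant_ne_top hh K hA hμ)
    ((ae_prod_pos μ).mono fun q hq => tendsto_const_nhds.congr'
      ((eventually_indicator_time_eq hq).mono fun n hn => hn.symm))
  simp_rw [fun n => lintegral_prod _ (hm n), lintegral_zero] at h
  exact h

theorem ae_lintegral_dominant_ne_top {h : ℝ → ℝ} {M c : ℝ} (hh : IsWeight h M c) (K : ℝ)
    {μ : Measure H2} [IsFiniteMeasure μ] {A : ENNReal} (hA : A ≠ ⊤) (hμ : HasNegMoment μ h A) :
    ∀ᵐ z ∂μ, ∫⁻ p, dominant h K z p ∂spaceTime ≠ ⊤ := by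
  have hm := aemeasurable_dominant_prod hh K μ
  have h := lintegral_dominant_ne_top hh K hA hμ
  rw [lintegral_prod _ hm] at h
  exact (ae_lt_top' hm.lintegral_prod_right' h).mono fun z hz => hz.ne

theorem energy_truncField_sub_le {h k : ℝ → ℝ} {C K : ℝ} (hK : IsDominant h K)
    (hk : KernelBound k C) {N m n : ℕ} (hm : N ≤ m) (hn : N ≤ n) (z : H2) :
    energy (fun p => truncField h k (1 / ((m : ℝ) + 1)) z p - truncField h k (1 / ((n : ℝ) + 1)) z p) ≤
      ENNReal.ofReal (C ^ 2) * dominantTail h K N z := by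
  rw [energy, dominantTail, ← lintegral_const_mul' _ _ ENNReal.ofReal_ne_top]
  refine lintegral_mono_ae (ae_spaceTime_pos.mono fun p hp => ?_)
  have hle : ∀ {j : ℕ}, N ≤ j → 1 / ((j : ℝ) + 1) ≤ 1 / ((N : ℝ) + 1) := fun hj =>
    one_div_le_one_div_of_le (by positivity) (by simpa using hj)
  by_cases hpN : p.1 ≤ 1 / ((N : ℝ) + 1)
  · rw [indicator_of_mem (show p ∈ {p : ℝ × I | p.1 ≤ 1 / ((N : ℝ) + 1)} from hpN)]
    refine le_trans (ENNReal.div_le_div_right (pow_le_pow_left' ?_ 2) _) (hK k C hk z p hp)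
    rw [enorm_le_iff_norm_le, truncField, truncField, indicator, indicator]
    split_ifs <;> simp
  · have h1 : ∀ {j : ℕ}, N ≤ j → p ∈ {p : ℝ × I | 1 / ((j : ℝ) + 1) < p.1} := fun hj =>
      (hle hj).trans_lt (not_le.1 hpN)
    rw [truncField, truncField, indicator_of_mem (h1 hm), indicator_of_mem (h1 hn), sub_self,
      ← ofReal_norm, norm_zero, ENNReal.ofReal_zero, zero_pow two_ne_zero, ENNReal.zero_div]
    exact zero_le

/-- The gradient of the potential of the radial kernel `k`. -/
def gradLimit (h k : ℝ → ℝ) (z : H2) : H2 :=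
  limUnder atTop fun n : ℕ => gradient (truncPotential h k (1 / ((n : ℝ) + 1))) z

theorem enorm_gradient_sub_sq_le_tail {h k : ℝ → ℝ} {M c C K : ℝ} (hh : IsWeight h M c)
    (hK : IsDominant h K) (hk : KernelBound k C) {N m n : ℕ} (hm : N ≤ m) (hn : N ≤ n) (z : H2) :
    ‖gradient (truncPotential h k (1 / ((m : ℝ) + 1))) z -
      gradient (truncPotential h k (1 / ((n : ℝ) + 1))) z‖ₑ ^ 2 ≤
      energyMass * (ENNReal.ofReal (C ^ 2) * dominantTail h K N z) :=
  (enorm_gradient_sub_sq_le hh (by positivity) (by positivity) hk hk z).trans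
    (mul_le_mul_right (energy_truncField_sub_le hK hk hm hn z) _)

theorem tendsto_gradLimit {h k : ℝ → ℝ} {M c C K : ℝ} (hh : IsWeight h M c)
    (hK : IsDominant h K) (hk : KernelBound k C) {z : H2}
    (hz : ∫⁻ p, dominant h K z p ∂spaceTime ≠ ⊤) :
    Tendsto (fun n : ℕ => gradient (truncPotential h k (1 / ((n : ℝ) + 1))) z) atTop
      (𝓝 (gradLimit h k z)) := by
  refine CauchySeq.tendsto_limUnder (EMetric.cauchySeq_iff_le_tendsto_0.2
    ⟨fun N => (energyMass * (ENNReal.ofReal (C ^ 2) * dominantTail h K N z)) ^ (1 / 2 : ℝ),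
      fun m n N hm hn => ?_, ?_⟩)
  · rw [edist_eq_enorm_sub]
    have h := ENNReal.rpow_le_rpow (z := 1 / 2) (enorm_gradient_sub_sq_le_tail hh hK hk hm hn z)
      (by norm_num)
    rwa [← ENNReal.rpow_natCast, ← ENNReal.rpow_mul, show ((2 : ℕ) : ℝ) * (1 / 2) = 1 by norm_num,
      ENNReal.rpow_one] at h
  · have h := (ENNReal.Tendsto.const_mul (ENNReal.Tendsto.const_mul (tendsto_dominantTail hh K hz)
      (Or.inr (ENNReal.ofReal_ne_top (r := C ^ 2)))) (Or.inr energyMass_ne_top))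
    rw [mul_zero, mul_zero] at h
    have h2 := (ENNReal.continuous_rpow_const (y := 1 / 2)).tendsto 0
    rw [ENNReal.zero_rpow_of_pos (by norm_num)] at h2
    exact h2.comp h

theorem enorm_gradient_sub_gradLimit_sq_le {h k : ℝ → ℝ} {M c C K : ℝ} (hh : IsWeight h M c)
    (hK : IsDominant h K) (hk : KernelBound k C) {z : H2}
    (hz : ∫⁻ p, dominant h K z p ∂spaceTime ≠ ⊤) (n : ℕ) :
    ‖gradient (truncPotential h k (1 / ((n : ℝ) + 1))) z - gradLimit h k z‖ₑ ^ 2 ≤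
      energyMass * (ENNReal.ofReal (C ^ 2) * dominantTail h K n z) := by
  refine le_of_tendsto (((ENNReal.continuous_pow 2).tendsto _).comp
    ((tendsto_gradLimit hh hK hk hz).const_sub _).enorm) ?_
  filter_upwards [eventually_ge_atTop n] with m hm
  exact enorm_gradient_sub_sq_le_tail hh hK hk le_rfl hm z

theorem enorm_gradLimit_sub_gradLimit_sq_le {h k k' : ℝ → ℝ} {M c C C' K : ℝ}
    (hh : IsWeight h M c) (hK : IsDominant h K) (hk : KernelBound k C) (hk' : KernelBound k' C')
    {z : H2} (hz : ∫⁻ p, dominant h K z p ∂spaceTime ≠ ⊤) :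
    ‖gradLimit h k z - gradLimit h k' z‖ₑ ^ 2 ≤
      energyMass * energy (fun p => potentialField h k z p - potentialField h k' z p) := by
  refine le_of_tendsto (((ENNReal.continuous_pow 2).tendsto _).comp
    ((tendsto_gradLimit hh hK hk hz).sub (tendsto_gradLimit hh hK hk' hz)).enorm)
    (Eventually.of_forall fun n => ?_)
  refine (enorm_gradient_sub_sq_le hh (by positivity) (by positivity) hk hk' z).trans
    (mul_le_mul_right (lintegral_mono fun p => ENNReal.div_le_div_right (pow_le_pow_left' ?_ 2) _) _)
  simp only [truncField]
  by_cases hp : p ∈ {p : ℝ × I | 1 / ((n : ℝ) + 1) < p.1}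
  · rw [indicator_of_mem hp, indicator_of_mem hp]
  · rw [indicator_of_notMem hp, indicator_of_notMem hp, sub_self, enorm_le_iff_norm_le, norm_zero]
    exact norm_nonneg _

theorem aestronglyMeasurable_gradLimit {h k : ℝ → ℝ} {M c C K : ℝ} (hh : IsWeight h M c)
    (hK : IsDominant h K) (hk : KernelBound k C) {μ : Measure H2} [IsFiniteMeasure μ] {A : ENNReal}
    (hA : A ≠ ⊤) (hμ : HasNegMoment μ h A) : AEStronglyMeasurable (gradLimit h k) μ :=
  aestronglyMeasurable_of_tendsto_ae atTop
    (fun n : ℕ => (continuous_gradient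
      (contDiff_truncPotential hh (by positivity : (0 : ℝ) < 1 / ((n : ℝ) + 1)) hk)).aestronglyMeasurable)
    ((ae_lintegral_dominant_ne_top hh K hA hμ).mono fun _ hz => tendsto_gradLimit hh hK hk hz)

theorem stronglyMeasurable_truncPotential_zero {h k : ℝ → ℝ} {M c C : ℝ} (hh : IsWeight h M c)
    (hk : KernelBound k C) : StronglyMeasurable (truncPotential h k 0) :=
  stronglyMeasurable_of_tendsto atTop
    (fun n : ℕ => (contDiff_truncPotential hh
      (by positivity : (0 : ℝ) < 1 / ((n : ℝ) + 1)) hk).continuous.stronglyMeasurable)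
    (tendsto_pi_nhds.2 fun z => tendsto_truncPotential_nat hh hk z)

theorem hasSobolevGradient_potential {h k : ℝ → ℝ} {M c C K : ℝ} (hh : IsWeight h M c)
    (hK : IsDominant h K) (hk : KernelBound k C) {μ : Measure H2} [IsFiniteMeasure μ] {A : ENNReal}
    (hA : A ≠ ⊤) (hμ : HasNegMoment μ h A) :
    HasSobolevGradient μ (truncPotential h k 0) (gradLimit h k) := by
  obtain ⟨B, -, hB⟩ := abs_truncPotential_le hh
  have hmV := (stronglyMeasurable_truncPotential_zero hh hk).aestronglyMeasurable (μ := μ)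
  have hmD := aestronglyMeasurable_gradLimit hh hK hk hA hμ
  have hs : ∀ n : ℕ, HasSobolevGradient μ (truncPotential h k (1 / ((n : ℝ) + 1)))
      (gradient (truncPotential h k (1 / ((n : ℝ) + 1)))) := fun n =>
    hasSobolevGradient_truncPotential hh (by positivity) hk
  have hD : Tendsto (fun n : ℕ => eLpNorm (fun z => gradient (truncPotential h k (1 / ((n : ℝ) + 1))) z -
      gradLimit h k z) 2 μ) atTop (𝓝 0) := by
    refine tendsto_eLpNorm_two_zero ?_
    have h := (ENNReal.Tendsto.const_mul (ENNReal.Tendsto.const_mul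
      (tendsto_lintegral_dominantTail hh K hA hμ)
      (Or.inr (ENNReal.ofReal_ne_top (r := C ^ 2)))) (Or.inr energyMass_ne_top))
    rw [mul_zero, mul_zero] at h
    refine tendsto_of_tendsto_of_tendsto_of_le_of_le tendsto_const_nhds h (fun _ => zero_le)
      fun n => ?_
    simp only
    rw [← lintegral_const_mul' _ _ ENNReal.ofReal_ne_top, ← lintegral_const_mul' _ _ energyMass_ne_top]
    exact lintegral_mono_ae ((ae_lintegral_dominant_ne_top hh K hA hμ).mono fun z hz =>
      enorm_gradient_sub_gradLimit_sq_le hh hK hk hz n)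
  have hDmem : MemLp (gradLimit h k) 2 μ := by
    obtain ⟨n, hn⟩ := (hD.eventually (gt_mem_nhds ENNReal.zero_lt_top)).exists
    have h1 : MemLp (fun z => gradient (truncPotential h k (1 / ((n : ℝ) + 1))) z - gradLimit h k z)
        2 μ := ⟨(hs n).2.1.1.sub hmD, hn⟩
    have h2 := (hs n).2.1.sub h1
    refine h2.congr_norm hmD (Eventually.of_forall fun z => ?_)
    simp
  refine HasSobolevGradient.of_tendsto hs (memLp_of_bounded hmV (hB hk 0)) hDmem ?_ hD
  exact tendsto_eLpNorm_two_zero (tendsto_lintegral_sq_of_bounded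
    (Eventually.of_forall fun n => (hs n).1.1) hmV (Eventually.of_forall fun n => hB hk _) (hB hk 0)
    (Eventually.of_forall fun z => tendsto_truncPotential_nat hh hk z))

theorem aestronglyMeasurable_potentialField_prod {h k : ℝ → ℝ} {M c : ℝ} (hh : IsWeight h M c)
    (hk : Measurable k) (μ : Measure H2) [SFinite μ] :
    AEStronglyMeasurable (fun q : H2 × (ℝ × I) => potentialField h k q.1 q.2)
      (μ.prod spaceTime) := by
  have hinv : AEMeasurable (fun q : H2 × (ℝ × I) => invStd q.2) (μ.prod spaceTime) :=
    (aemeasurable_invStd ae_spaceTime_pos).comp_snd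
  have hm := hinv.prodMk (aestronglyMeasurable_flowMap_prod μ).aemeasurable
  have h1 := (stronglyMeasurable_gaussAvgDeriv hk).aestronglyMeasurable
    (μ := (μ.prod spaceTime).map fun q => (invStd q.2, flowMap q.2 q.1))
  have h2 : AEStronglyMeasurable (fun q : H2 × (ℝ × I) =>
    gaussAvgDeriv k (invStd q.2) (flowMap q.2 q.1)) (μ.prod spaceTime) := h1.comp_aemeasurable hm
  exact (hh.continuous_time.comp continuous_snd).aestronglyMeasurable.smul h2

theorem energy_sub_eq_lintegral {h k k' : ℝ → ℝ} {M c : ℝ} (hh : IsWeight h M c)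
    (hk : Measurable k) (hk' : Measurable k') (μ : Measure H2) [SFinite μ] :
    ∫⁻ z, energy (fun p => potentialField h k z p - potentialField h k' z p) ∂μ =
      ∫⁻ q, ‖potentialField h k q.1 q.2 - potentialField h k' q.1 q.2‖ₑ ^ 2 / energyWeight q.2
        ∂(μ.prod spaceTime) := by
  rw [lintegral_prod]
  · rfl
  · exact (((aestronglyMeasurable_potentialField_prod hh hk μ).sub
      (aestronglyMeasurable_potentialField_prod hh hk' μ)).enorm.pow_const 2).div
        (measurable_energyWeight.comp measurable_snd).aemeasurable

theorem potentialField_sub {h k k' : ℝ → ℝ} {C C' : ℝ} (hk : KernelBound k C)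
    (hk' : KernelBound k' C') (z : H2) (p : ℝ × I) :
    potentialField h (fun x => k x - k' x) z p =
      potentialField h k z p - potentialField h k' z p := by
  have hs := invStd_nonneg p
  have h1 : gaussAvgDeriv (fun x => k x - k' x) (invStd p) (flowMap p z) =
      gaussAvgDeriv k (invStd p) (flowMap p z) - gaussAvgDeriv k' (invStd p) (flowMap p z) := by
    rw [gaussAvgDeriv, gaussAvgDeriv, gaussAvgDeriv, (integral_congr_ae (Eventually.of_forall
      fun a => by ext w; simp [sub_mul])).trans (integral_sub
        (integrable_gaussAvgDeriv_integrand hk hs (flowMap p z))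
        (integrable_gaussAvgDeriv_integrand hk' hs (flowMap p z)))]
    ext w
    simp only [smul_apply, sub_apply, smul_eq_mul, mul_sub]
  rw [potentialField, potentialField, potentialField, h1]
  ext w
  simp only [smul_apply, sub_apply, smul_eq_mul, mul_sub]

theorem tendsto_lintegral_energy_sub {ι : Type*} {l : Filter ι} [l.IsCountablyGenerated]
    {h : ℝ → ℝ} {M c C K : ℝ} (hh : IsWeight h M c)
    (hK : IsDominant h K) {k : ι → ℝ → ℝ} {k₀ : ℝ → ℝ} (hk : ∀ᶠ i in l, KernelBound (k i) C)
    (hk₀ : KernelBound k₀ C) (hlim : ∀ x, 0 < x → Tendsto (fun i => k i x) l (𝓝 (k₀ x)))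
    {μ : Measure H2} [IsFiniteMeasure μ] {A : ENNReal} (hA : A ≠ ⊤) (hμ : HasNegMoment μ h A) :
    Tendsto (fun i => ∫⁻ z, energy (fun p => potentialField h (k i) z p - potentialField h k₀ z p) ∂μ)
      l (𝓝 0) := by
  have h0 : ∫⁻ q : H2 × (ℝ × I), 0 ∂(μ.prod spaceTime) = (0 : ENNReal) := lintegral_zero
  rw [← h0]
  refine Tendsto.congr' (hk.mono fun i hi =>
    (energy_sub_eq_lintegral hh hi.measurable hk₀.measurable μ).symm) ?_
  refine tendsto_lintegral_filter_of_dominated_convergence'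
    (fun q => ENNReal.ofReal ((C + C) ^ 2) * dominant h K q.1 q.2) (hk.mono fun i hi => ?_)
    (hk.mono fun i hi => (ae_prod_pos μ).mono fun q hq => ?_) ?_ ((ae_prod_pos μ).mono fun q hq => ?_)
  · exact (((aestronglyMeasurable_potentialField_prod hh hi.measurable μ).sub
      (aestronglyMeasurable_potentialField_prod hh hk₀.measurable μ)).enorm.pow_const 2).div
        (measurable_energyWeight.comp measurable_snd).aemeasurable
  · rw [← potentialField_sub hi hk₀]
    exact hK _ _ (hi.sub hk₀) _ _ hq
  · rw [lintegral_const_mul' _ _ ENNReal.ofReal_ne_top]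
    exact ENNReal.mul_ne_top ENNReal.ofReal_ne_top (lintegral_dominant_ne_top hh K hA hμ)
  · have h1 : Tendsto (fun i => potentialField h (k i) q.1 q.2) l (𝓝 (potentialField h k₀ q.1 q.2)) :=
      (tendsto_gaussAvgDeriv hk hlim (invStd_nonneg q.2) (flowMap q.2 q.1)).const_smul
        (Real.exp (-q.2.1) * h q.2.2)
    have h2 := tendsto_iff_norm_sub_tendsto_zero.1 h1
    have h3 : Tendsto (fun i => ‖potentialField h (k i) q.1 q.2 - potentialField h k₀ q.1 q.2‖ₑ) l
        (𝓝 0) := by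
      simp_rw [← ofReal_norm]
      simpa using ENNReal.tendsto_ofReal h2
    have h4 := ((ENNReal.continuous_pow 2).tendsto 0).comp h3
    have h5 := ENNReal.Tendsto.div_const h4 (Or.inr (energyWeight_ne_zero hq))
    rw [zero_pow two_ne_zero, ENNReal.zero_div] at h5
    exact h5

theorem integral_sq_eq_toReal {E : Type*} [NormedAddCommGroup E] {μ : Measure H2} {f : H2 → E}
    (hf : AEStronglyMeasurable f μ) : ∫ z, ‖f z‖ ^ 2 ∂μ = (∫⁻ z, ‖f z‖ₑ ^ 2 ∂μ).toReal := by
  have hm : AEStronglyMeasurable (fun z => ‖f z‖ ^ 2) μ := hf.norm.pow 2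
  rw [integral_eq_lintegral_of_nonneg_ae (Eventually.of_forall fun z => by positivity) hm]
  congr 1
  refine lintegral_congr fun z => ?_
  rw [ENNReal.ofReal_pow (norm_nonneg _), ofReal_norm]

theorem tendstoInDirichletDomain_potential {h : ℝ → ℝ} {M c C K : ℝ} (hh : IsWeight h M c)
    (hK : IsDominant h K) {k : ℝ → ℝ → ℝ} {k₀ : ℝ → ℝ}
    (hk : ∀ᶠ s in 𝓝[>] (0 : ℝ), KernelBound (k s) C) (hk₀ : KernelBound k₀ C)
    (hlim : ∀ x, 0 < x → Tendsto (fun s => k s x) (𝓝[>] 0) (𝓝 (k₀ x)))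
    {μ : Measure H2} [IsFiniteMeasure μ] {A : ENNReal} (hA : A ≠ ⊤) (hμ : HasNegMoment μ h A) :
    TendstoInDirichletDomain μ (fun s => truncPotential h (k s) 0) (truncPotential h k₀ 0) := by
  refine ⟨fun s => gradLimit h (k s), gradLimit h k₀, hasSobolevGradient_potential hh hK hk₀ hA hμ,
    hk.mono fun s hs => hasSobolevGradient_potential hh hK hs hA hμ, ?_⟩
  obtain ⟨B, -, hB⟩ := abs_truncPotential_le hh
  have hmV : ∀ {k : ℝ → ℝ}, KernelBound k C → AEStronglyMeasurable (truncPotential h k 0) μ :=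
    fun hk => (stronglyMeasurable_truncPotential_zero hh hk).aestronglyMeasurable
  have hmD : ∀ {k : ℝ → ℝ}, KernelBound k C → AEStronglyMeasurable (gradLimit h k) μ :=
    fun hk => aestronglyMeasurable_gradLimit hh hK hk hA hμ
  have hV : Tendsto (fun s => ∫ z, (truncPotential h (k s) 0 z - truncPotential h k₀ 0 z) ^ 2 ∂μ)
      (𝓝[>] 0) (𝓝 0) := by
    have h1 := tendsto_lintegral_sq_of_bounded (μ := μ) (l := 𝓝[>] (0 : ℝ))
      (hk.mono fun s hs => hmV hs) (hmV hk₀)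
      (hk.mono fun s hs => hB hs 0) (hB hk₀ 0)
      (Eventually.of_forall fun z => tendsto_truncPotential hh hk hlim 0 z)
    have h2 := (ENNReal.tendsto_toReal ENNReal.zero_ne_top).comp h1
    refine h2.congr' (hk.mono fun s hs => ?_)
    rw [Function.comp_apply, ← integral_sq_eq_toReal
      (f := fun z => truncPotential h (k s) 0 z - truncPotential h k₀ 0 z) ((hmV hs).sub (hmV hk₀))]
    simp_rw [Real.norm_eq_abs, sq_abs]
  have hD : Tendsto (fun s => dirichletForm μ (fun z => gradLimit h (k s) z - gradLimit h k₀ z)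
      (fun z => gradLimit h (k s) z - gradLimit h k₀ z)) (𝓝[>] 0) (𝓝 0) := by
    have h1 := ENNReal.Tendsto.const_mul (tendsto_lintegral_energy_sub hh hK hk hk₀ hlim hA hμ)
      (Or.inr energyMass_ne_top)
    rw [mul_zero] at h1
    have h2 : Tendsto (fun s => ∫⁻ z, ‖gradLimit h (k s) z - gradLimit h k₀ z‖ₑ ^ 2 ∂μ)
        (𝓝[>] 0) (𝓝 0) := by
      refine tendsto_of_tendsto_of_tendsto_of_le_of_le' tendsto_const_nhds h1
        (Eventually.of_forall fun _ => zero_le) (hk.mono fun s hs => ?_)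
      rw [← lintegral_const_mul' _ _ energyMass_ne_top]
      exact lintegral_mono_ae ((ae_lintegral_dominant_ne_top hh K hA hμ).mono fun z hz =>
        enorm_gradLimit_sub_gradLimit_sq_le hh hK hs hk₀ hz)
    have h3 := ((ENNReal.tendsto_toReal ENNReal.zero_ne_top).comp h2).const_mul (1 / 2 : ℝ)
    rw [ENNReal.toReal_zero, mul_zero] at h3
    refine h3.congr' (hk.mono fun s hs => ?_)
    have h4 := integral_sq_eq_toReal (f := fun z => gradLimit h (k s) z - gradLimit h k₀ z)
      ((hmD hs).sub (hmD hk₀))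
    simp only [dirichletForm, real_inner_self_eq_norm_sq, h4, Function.comp_apply]
  simpa using hD.add hV

/-! ### Negative moments of the heat flow under the law of the Brownian bridge -/

theorem tendsto_riemannSum {F : ℝ → ℝ} (hF : Continuous F) :
    Tendsto (fun n : ℕ => ∑ k ∈ Finset.range (n + 1), 1 / ((n : ℝ) + 1) * F (k / ((n : ℝ) + 1)))
      atTop (𝓝 (∫ y in (0 : ℝ)..1, F y)) := by
  rw [Metric.tendsto_atTop]
  intro ε hε
  have hu := isCompact_Icc.uniformContinuousOn_of_continuous (hF.continuousOn (s := Icc (0 : ℝ) 1))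
  obtain ⟨δ, hδ, hδF⟩ := Metric.uniformContinuousOn_iff.1 hu (ε / 2) (half_pos hε)
  obtain ⟨N, hN⟩ := exists_nat_one_div_lt hδ
  refine ⟨N, fun n hn => ?_⟩
  have hn0 : (0 : ℝ) < (n : ℝ) + 1 := by positivity
  have hnδ : 1 / ((n : ℝ) + 1) < δ :=
    (one_div_le_one_div_of_le (by positivity) (by simpa using hn)).trans_lt hN
  have hsum : ∫ y in (0 : ℝ)..1, F y = ∑ k ∈ Finset.range (n + 1),
      ∫ y in ((k : ℝ) / ((n : ℝ) + 1))..(((k + 1 : ℕ) : ℝ) / ((n : ℝ) + 1)), F y := by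
    rw [intervalIntegral.sum_integral_adjacent_intervals (a := fun k : ℕ => (k : ℝ) / ((n : ℝ) + 1))
      fun k _ => hF.intervalIntegrable _ _]
    congr 1
    · simp
    · push_cast; field_simp
  have hk : ∀ k ∈ Finset.range (n + 1), ‖1 / ((n : ℝ) + 1) * F (k / ((n : ℝ) + 1)) -
      ∫ y in ((k : ℝ) / ((n : ℝ) + 1))..(((k + 1 : ℕ) : ℝ) / ((n : ℝ) + 1)), F y‖ ≤
      ε / 2 * (1 / ((n : ℝ) + 1)) := by
    intro k hk
    have hlen : ((k + 1 : ℕ) : ℝ) / ((n : ℝ) + 1) - k / ((n : ℝ) + 1) = 1 / ((n : ℝ) + 1) := by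
      push_cast; ring
    have hle : (k : ℝ) / ((n : ℝ) + 1) ≤ ((k + 1 : ℕ) : ℝ) / ((n : ℝ) + 1) := by
      have := one_div_pos.2 hn0
      linarith
    have h1 : ((k + 1 : ℕ) : ℝ) / ((n : ℝ) + 1) ≤ 1 := by
      rw [div_le_one hn0]
      exact_mod_cast Finset.mem_range.1 hk
    have h0 : (0 : ℝ) ≤ (k : ℝ) / ((n : ℝ) + 1) := by positivity
    have hc : 1 / ((n : ℝ) + 1) * F (k / ((n : ℝ) + 1)) =
        ∫ y in ((k : ℝ) / ((n : ℝ) + 1))..(((k + 1 : ℕ) : ℝ) / ((n : ℝ) + 1)),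
          F (k / ((n : ℝ) + 1)) := by
      rw [intervalIntegral.integral_const, hlen, smul_eq_mul]
    rw [hc, ← intervalIntegral.integral_sub (by simp) (hF.intervalIntegrable _ _)]
    refine (intervalIntegral.norm_integral_le_of_norm_le_const (C := ε / 2) fun y hy => ?_).trans ?_
    · rw [uIoc_of_le hle] at hy
      rw [← dist_eq_norm]
      refine (hδF _ ⟨h0, hle.trans h1⟩ y ⟨h0.trans hy.1.le, hy.2.trans h1⟩ ?_).le
      rw [dist_comm, Real.dist_eq, abs_of_nonneg (by linarith [hy.1])]
      linarith [hy.2]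
    · rw [hlen, abs_of_pos (by positivity)]
  rw [dist_eq_norm, hsum, ← Finset.sum_sub_distrib]
  refine (norm_sum_le_of_le _ hk).trans_lt ?_
  rw [Finset.sum_const, Finset.card_range, nsmul_eq_mul]
  push_cast
  field_simp
  linarith

/-- The integral of `|x|^{-1/2}` over `[-1, 1]`. -/
def rsqrtMass : ENNReal := ∫⁻ x in Icc (-1 : ℝ) 1, ‖x‖ₑ ^ (-(1 / 2) : ℝ)

theorem rsqrtMass_ne_top : rsqrtMass ≠ ⊤ := by
  have h1 : IntegrableOn (fun y : ℝ => y ^ (-(1 / 2) : ℝ)) (Ioc 0 1) :=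
    (intervalIntegrable_iff_integrableOn_Ioc_of_le zero_le_one).1
      (intervalIntegral.intervalIntegrable_rpow' (by norm_num))
  have h2 : Integrable (fun x : ℝ => (Iic (1 : ℝ)).indicator (fun y => y ^ (-(1 / 2) : ℝ)) ‖x‖) := by
    rw [integrable_fun_norm_addHaar]
    simp only [Module.finrank_self, Nat.sub_self, pow_zero, one_smul]
    rw [integrableOn_indicator_iff measurableSet_Iic, inter_comm, Ioi_inter_Iic]
    exact h1
  refine ne_top_of_le_ne_top h2.lintegral_lt_top.ne ?_
  rw [rsqrtMass, ← lintegral_indicator measurableSet_Icc]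
  have h0 : ∀ᵐ x : ℝ, x ≠ 0 := by simp [ae_iff]
  refine lintegral_mono_ae (h0.mono fun x hx => ?_)
  by_cases hm : x ∈ Icc (-1 : ℝ) 1
  · have hm' : ‖x‖ ∈ Iic (1 : ℝ) := abs_le.2 hm
    rw [indicator_of_mem hm, indicator_of_mem hm', ← ofReal_norm,
      ENNReal.ofReal_rpow_of_pos (norm_pos_iff.2 hx)]
  · rw [indicator_of_notMem hm]
    exact zero_le

theorem lintegral_enorm_rpow_neg_half_le (ν : Measure ℝ) {D : ENNReal} (hν : ν ≤ D • volume) :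
    ∫⁻ x, ‖x‖ₑ ^ (-(1 / 2) : ℝ) ∂ν ≤ ν univ + D * rsqrtMass := by
  have hle : ∀ x : ℝ, ‖x‖ₑ ^ (-(1 / 2) : ℝ) ≤
      1 + (Icc (-1 : ℝ) 1).indicator (fun x => ‖x‖ₑ ^ (-(1 / 2) : ℝ)) x := by
    intro x
    by_cases hm : x ∈ Icc (-1 : ℝ) 1
    · rw [indicator_of_mem hm]
      exact le_add_self
    · rw [indicator_of_notMem hm, add_zero]
      have h1 : 1 ≤ ‖x‖ₑ := by
        rw [← ofReal_norm, ENNReal.one_le_ofReal, Real.norm_eq_abs]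
        by_contra hlt
        exact hm (abs_le.1 (not_le.1 hlt).le)
      exact ENNReal.rpow_le_one_of_one_le_of_neg h1 (by norm_num)
  refine (lintegral_mono hle).trans ?_
  rw [lintegral_add_left measurable_const, lintegral_one]
  refine add_le_add_right ?_ _
  refine (lintegral_mono' hν le_rfl).trans ?_
  rw [lintegral_smul_measure, lintegral_indicator measurableSet_Icc, smul_eq_mul, rsqrtMass]

theorem gaussianReal_le_smul_volume {v₀ : ℝ} (hv₀ : 0 < v₀) {v : NNReal} (hv : v₀ ≤ v) :
    gaussianReal 0 v ≤ ENNReal.ofReal (√(2 * Real.pi * v₀))⁻¹ • (volume : Measure ℝ) := by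
  have hv0 : v ≠ 0 := by
    rintro rfl
    exact absurd hv (not_le.2 (by simpa using hv₀))
  rw [gaussianReal_of_var_ne_zero _ hv0, ← withDensity_const]
  refine withDensity_mono (Eventually.of_forall fun x => ENNReal.ofReal_le_ofReal ?_)
  rw [gaussianPDFReal]
  calc (√(2 * Real.pi * v))⁻¹ * Real.exp (-(x - 0) ^ 2 / (2 * v))
      ≤ (√(2 * Real.pi * v))⁻¹ * 1 := by
        refine mul_le_mul_of_nonneg_left (Real.exp_le_one_iff.2 ?_) (by positivity)
        exact div_nonpos_of_nonpos_of_nonneg (by nlinarith [sq_nonneg (x - 0)]) (by positivity)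
    _ ≤ (√(2 * Real.pi * v₀))⁻¹ := by
        rw [mul_one]
        have : 0 < √(2 * Real.pi * v₀) := by positivity
        gcongr

theorem lintegral_rpow_neg_half_le_of_gaussian {Ω : Type*} [MeasurableSpace Ω] {P : Measure Ω}
    {X : Ω → ℝ} (hX : HasGaussianLaw X P) (hX0 : ∫ ω, X ω ∂P = 0) {v₀ : ℝ} (hv₀ : 0 < v₀)
    (hvar : v₀ ≤ Var[X; P]) :
    ∫⁻ ω, ‖X ω‖ₑ ^ (-(1 / 2) : ℝ) ∂P ≤
      1 + ENNReal.ofReal (√(2 * Real.pi * v₀))⁻¹ * rsqrtMass := by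
  have h1 : ∫⁻ ω, ‖X ω‖ₑ ^ (-(1 / 2) : ℝ) ∂P = ∫⁻ x, ‖x‖ₑ ^ (-(1 / 2) : ℝ) ∂(P.map X) :=
    (lintegral_map' (f := fun x : ℝ => ‖x‖ₑ ^ (-(1 / 2) : ℝ))
      (by fun_prop) hX.aemeasurable).symm
  rw [h1, hX.map_eq_gaussianReal, hX0]
  refine (lintegral_enorm_rpow_neg_half_le _ (gaussianReal_le_smul_volume hv₀
    (hvar.trans (Real.le_coe_toNNReal _)))).trans ?_
  rw [measure_univ]

/-- The covariance function of the Brownian bridge. -/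
def bridgeCov (y r : ℝ) : ℝ := min y r - y * r

theorem continuous_bridgeCov (r : ℝ) : Continuous fun y => bridgeCov y r := by
  unfold bridgeCov; fun_prop

theorem integral_eigenfun_mul_bridgeCov (k : ℕ) {r : ℝ} (hr : r ∈ Icc (0 : ℝ) 1) :
    ∫ y in (0 : ℝ)..1, eigenfun (k + 1) y * bridgeCov y r =
      eigenfun (k + 1) r / eigenval (k + 1) := by
  set a : ℝ := ((k + 1 : ℕ) : ℝ) * Real.pi with ha
  have ha0 : 0 < a := by positivity
  have hsin : Real.sin a = 0 := Real.sin_nat_mul_pi (k + 1)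
  have hcont : Continuous fun y => eigenfun (k + 1) y * bridgeCov y r :=
    (continuous_eigenfun _).mul (continuous_bridgeCov r)
  rw [← intervalIntegral.integral_add_adjacent_intervals (hcont.intervalIntegrable 0 r)
    (hcont.intervalIntegrable r 1)]
  have hS : ∀ y, HasDerivAt (fun y => Real.sin (a * y) / a ^ 2 - y * Real.cos (a * y) / a)
      (y * Real.sin (a * y)) y := by
    intro y
    have h0 : HasDerivAt (fun y : ℝ => a * y) a y := by simpa using (hasDerivAt_id y).const_mul a
    have h := ((h0.sin.div_const (a ^ 2)).sub (((hasDerivAt_id y).mul h0.cos).div_const a))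
    refine h.congr_deriv ?_
    simp only [id]
    field_simp
    ring
  have hC : ∀ y, HasDerivAt (fun y => -Real.cos (a * y) / a) (Real.sin (a * y)) y := by
    intro y
    have h0 : HasDerivAt (fun y : ℝ => a * y) a y := by simpa using (hasDerivAt_id y).const_mul a
    refine (h0.cos.neg.div_const a).congr_deriv ?_
    field_simp
  have h1 : ∫ y in (0 : ℝ)..r, eigenfun (k + 1) y * bridgeCov y r = √2 * (1 - r) *
      (Real.sin (a * r) / a ^ 2 - r * Real.cos (a * r) / a) := by
    have h : ∫ y in (0 : ℝ)..r, y * Real.sin (a * y) =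
        Real.sin (a * r) / a ^ 2 - r * Real.cos (a * r) / a := by
      rw [intervalIntegral.integral_eq_sub_of_hasDerivAt (fun y _ => hS y)
        ((by fun_prop : Continuous fun y => y * Real.sin (a * y)).intervalIntegrable _ _)]
      simp
    rw [← h, ← intervalIntegral.integral_const_mul]
    refine intervalIntegral.integral_congr fun y hy => ?_
    rw [uIcc_of_le hr.1] at hy
    simp only [eigenfun, bridgeCov, min_eq_left hy.2]
    rw [← ha]
    ring
  have h2 : ∫ y in r..1, eigenfun (k + 1) y * bridgeCov y r = √2 * r *
      ((-Real.cos a / a + Real.cos (a * r) / a) -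
        (- Real.cos a / a - (Real.sin (a * r) / a ^ 2 - r * Real.cos (a * r) / a))) := by
    have hS' : ∫ y in r..1, y * Real.sin (a * y) =
        - Real.cos a / a - (Real.sin (a * r) / a ^ 2 - r * Real.cos (a * r) / a) := by
      rw [intervalIntegral.integral_eq_sub_of_hasDerivAt (fun y _ => hS y)
        ((by fun_prop : Continuous fun y => y * Real.sin (a * y)).intervalIntegrable _ _)]
      simp [hsin, neg_div]
    have hC' : ∫ y in r..1, Real.sin (a * y) = -Real.cos a / a + Real.cos (a * r) / a := by
      rw [intervalIntegral.integral_eq_sub_of_hasDerivAt (fun y _ => hC y)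
        ((by fun_prop : Continuous fun y => Real.sin (a * y)).intervalIntegrable _ _)]
      simp [neg_div]
    rw [← hS', ← hC', ← intervalIntegral.integral_sub
      ((by fun_prop : Continuous fun y => Real.sin (a * y)).intervalIntegrable _ _)
      ((by fun_prop : Continuous fun y => y * Real.sin (a * y)).intervalIntegrable _ _),
      ← intervalIntegral.integral_const_mul]
    refine intervalIntegral.integral_congr fun y hy => ?_
    rw [uIcc_of_le hr.2] at hy
    simp only [eigenfun, bridgeCov, min_eq_right hy.1]
    rw [← ha]
    ring
  have hval : eigenval (k + 1) = a ^ 2 := by rw [eigenval, ha, mul_pow]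
  rw [h1, h2, hval, eigenfun, ← ha]
  field_simp
  ring

theorem le_integral_heatKernel_mul_bridgeCov {t : ℝ} (ht : 0 < t) (ht1 : t ≤ 1) (r : I) :
    2 * Real.exp (-(Real.pi ^ 2 / 2)) * Real.sin (Real.pi * r) ^ 2 / Real.pi ^ 2 ≤
      ∫ y in (0 : ℝ)..1, heatKernel t r y * bridgeCov y r := by
  have h := hasSum_integral_heatKernel_smul ht r (w := fun y : I => bridgeCov y r)
    (integrable_of_continuous ((continuous_bridgeCov _).comp continuous_subtype_val))
  simp only [smul_eq_mul] at h
  rw [integral_unitInterval fun y => heatKernel t r y * bridgeCov y r] at h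
  simp_rw [fun k : ℕ => (integral_unitInterval fun y => eigenfun (k + 1) y * bridgeCov y r),
    integral_eigenfun_mul_bridgeCov _ r.2] at h
  have hterm : ∀ k : ℕ, heatCoef k t r * (eigenfun (k + 1) r / eigenval (k + 1)) =
      heatDecay k t * eigenfun (k + 1) r ^ 2 / eigenval (k + 1) := fun k => by
    rw [heatCoef]; ring
  simp_rw [hterm] at h
  refine le_trans ?_ (le_hasSum h 0 fun k _ => div_nonneg
    (mul_nonneg (heatDecay_pos k t).le (sq_nonneg _)) (eigenval_pos k).le)
  have hev : eigenval (0 + 1) = Real.pi ^ 2 := by simp [eigenval]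
  rw [eigenfun_sq, hev, heatDecay, hev]
  have he : Real.exp (-(Real.pi ^ 2 / 2)) ≤ Real.exp (-(Real.pi ^ 2 / 2) * t) := by
    rw [Real.exp_le_exp]
    nlinarith [sq_nonneg Real.pi]
  simp only [zero_add, Nat.cast_one, one_mul]
  have : 0 ≤ Real.sin (Real.pi * r) ^ 2 / Real.pi ^ 2 := by positivity
  calc _ = Real.exp (-(Real.pi ^ 2 / 2)) * (2 * (Real.sin (Real.pi * r) ^ 2 / Real.pi ^ 2)) := by ring
    _ ≤ Real.exp (-(Real.pi ^ 2 / 2) * t) * (2 * (Real.sin (Real.pi * r) ^ 2 / Real.pi ^ 2)) := by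
        gcongr
    _ = _ := by ring

/-- Riemann sums of `∫ G(y) B_y dy`. -/
def bridgeSum {Ω : Type*} (B : I → Ω → ℝ) (G : ℝ → ℝ) (n : ℕ) (ω : Ω) : ℝ :=
  ∑ k ∈ Finset.range (n + 1), 1 / ((n : ℝ) + 1) * (G (k / ((n : ℝ) + 1)) *
    B (projIcc 0 1 zero_le_one (k / ((n : ℝ) + 1))) ω)

theorem IsBrownianBridge.isProbabilityMeasure {Ω : Type*} [MeasurableSpace Ω] {P : Measure Ω}
    {B : I → Ω → ℝ} (hB : IsBrownianBridge B P) : IsProbabilityMeasure P :=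
  hB.isGaussianProcess.isProbabilityMeasure

theorem hasGaussianLaw_bridgeSum {Ω : Type*} [MeasurableSpace Ω] {P : Measure Ω}
    {B : I → Ω → ℝ} (hB : IsBrownianBridge B P) (G : ℝ → ℝ) (n : ℕ) :
    HasGaussianLaw (bridgeSum B G n) P := by
  have h : HasGaussianLaw (fun ω => ∑ k ∈ Finset.range (n + 1),
      (1 / ((n : ℝ) + 1) * G (k / ((n : ℝ) + 1))) •
        (B ∘ fun k : ℕ => projIcc 0 1 zero_le_one ((k : ℝ) / ((n : ℝ) + 1))) k ω) P :=
    ((hB.isGaussianProcess.comp_right fun k : ℕ =>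
    projIcc 0 1 zero_le_one ((k : ℝ) / ((n : ℝ) + 1))).smul
      fun k : ℕ => 1 / ((n : ℝ) + 1) * G (k / ((n : ℝ) + 1))).hasGaussianLaw_fun_sum
  refine h.congr (Eventually.of_forall fun ω => ?_)
  simp [bridgeSum, mul_assoc]

theorem integral_bridgeSum {Ω : Type*} [MeasurableSpace Ω] {P : Measure Ω}
    {B : I → Ω → ℝ} (hB : IsBrownianBridge B P) (G : ℝ → ℝ) (n : ℕ) :
    ∫ ω, bridgeSum B G n ω ∂P = 0 := by
  unfold bridgeSum
  rw [integral_finsetSum _ fun k _ =>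
    (((hB.isGaussianProcess.hasGaussianLaw_eval _).integrable).const_mul _).const_mul _]
  simp_rw [integral_const_mul, hB.integral_eq_zero, mul_zero, Finset.sum_const_zero]

theorem covariance_bridgeSum {Ω : Type*} [MeasurableSpace Ω] {P : Measure Ω}
    {B : I → Ω → ℝ} (hB : IsBrownianBridge B P) (G : ℝ → ℝ) (n : ℕ) (r : I) :
    cov[bridgeSum B G n, B r; P] = ∑ k ∈ Finset.range (n + 1), 1 / ((n : ℝ) + 1) *
      (G (k / ((n : ℝ) + 1)) * bridgeCov (k / ((n : ℝ) + 1)) r) := by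
  have := hB.isProbabilityMeasure
  unfold bridgeSum
  rw [covariance_fun_sum_left' (fun k _ =>
    (((hB.isGaussianProcess.hasGaussianLaw_eval _).memLp_two).const_mul _).const_mul _)
    (hB.isGaussianProcess.hasGaussianLaw_eval _).memLp_two]
  refine Finset.sum_congr rfl fun k hk => ?_
  have hmem : (k : ℝ) / ((n : ℝ) + 1) ∈ Icc (0 : ℝ) 1 := by
    refine ⟨by positivity, (div_le_one (by positivity)).2 ?_⟩
    exact_mod_cast (Finset.mem_range.1 hk).le
  rw [covariance_const_mul_left, covariance_const_mul_left, hB.covariance_eq,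
    projIcc_of_mem _ hmem, bridgeCov]

theorem covariance_sq_le_variance_mul_variance {Ω : Type*} [MeasurableSpace Ω] {P : Measure Ω}
    [IsProbabilityMeasure P] {X Y : Ω → ℝ} (hX : MemLp X 2 P) (hY : MemLp Y 2 P) :
    cov[X, Y; P] ^ 2 ≤ Var[X; P] * Var[Y; P] := by
  have h := fun s : ℝ => variance_nonneg (X + s • Y) P
  have h2 : ∀ s : ℝ, 0 ≤ Var[Y; P] * (s * s) + 2 * cov[X, Y; P] * s + Var[X; P] := fun s => by
    have := h s
    rw [variance_add hX (hY.const_smul s), variance_smul, covariance_smul_right] at this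
    linarith
  have := discrim_le_zero h2
  rw [discrim] at this
  nlinarith

theorem tendsto_bridgeSum {Ω : Type*} {B : I → Ω → ℝ} {G : ℝ → ℝ} (hG : Continuous G) {ω : Ω}
    (hω : Continuous fun r => B r ω) :
    Tendsto (fun n => bridgeSum B G n ω) atTop (𝓝 (∫ y : I, G y * B y ω)) := by
  have h := tendsto_riemannSum (F := fun y => G y * B (projIcc 0 1 zero_le_one y) ω)
    (hG.mul (hω.comp continuous_projIcc))
  rw [← integral_unitInterval fun y => G y * B (projIcc 0 1 zero_le_one y) ω] at h
  simp only [projIcc_val] at h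
  exact h

theorem lintegral_bridge_rpow_neg_half_le {Ω : Type*} [MeasurableSpace Ω] {P : Measure Ω}
    {B : I → Ω → ℝ} (hB : IsBrownianBridge B P) {G : ℝ → ℝ} (hG : Continuous G) {r : I} {l : ℝ}
    (hl : 0 < l) (hle : l < ∫ y in (0 : ℝ)..1, G y * bridgeCov y r) :
    ∫⁻ ω, ‖∫ y : I, G y * B y ω‖ₑ ^ (-(1 / 2) : ℝ) ∂P ≤
      1 + ENNReal.ofReal (√(2 * Real.pi * l ^ 2))⁻¹ * rsqrtMass := by
  have := hB.isProbabilityMeasure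
  have hbound : ∀ᶠ n in atTop, ∫⁻ ω, ‖bridgeSum B G n ω‖ₑ ^ (-(1 / 2) : ℝ) ∂P ≤
      1 + ENNReal.ofReal (√(2 * Real.pi * l ^ 2))⁻¹ * rsqrtMass := by
    have h := tendsto_riemannSum (hG.mul (continuous_bridgeCov r))
    filter_upwards [h.eventually (lt_mem_nhds hle)] with n hn
    have hc := covariance_sq_le_variance_mul_variance (hasGaussianLaw_bridgeSum hB G n).memLp_two
      (hB.isGaussianProcess.hasGaussianLaw_eval r).memLp_two
    rw [covariance_bridgeSum hB, ← covariance_self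
      (hB.isGaussianProcess.hasGaussianLaw_eval r).aemeasurable, hB.covariance_eq] at hc
    refine lintegral_rpow_neg_half_le_of_gaussian (hasGaussianLaw_bridgeSum hB G n)
      (integral_bridgeSum hB G n) (by positivity) ?_
    have hr0 := r.2.1
    have hr1 := r.2.2
    have hv := variance_nonneg (bridgeSum B G n) P
    rw [min_self] at hc
    have h1 : (r : ℝ) - r * r ≤ 1 := by nlinarith
    have h2 := pow_le_pow_left₀ hl.le hn.le 2
    calc l ^ 2 ≤ _ := h2
      _ ≤ _ := hc
      _ ≤ Var[bridgeSum B G n; P] * 1 := mul_le_mul_of_nonneg_left h1 hv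
      _ = _ := mul_one _
  have hlim : ∀ᵐ ω ∂P, ‖∫ y : I, G y * B y ω‖ₑ ^ (-(1 / 2) : ℝ) =
      liminf (fun n => ‖bridgeSum B G n ω‖ₑ ^ (-(1 / 2) : ℝ)) atTop :=
    hB.continuous_paths.mono fun ω hω =>
      ((ENNReal.continuous_rpow_const.tendsto _).comp (tendsto_bridgeSum hG hω).enorm).liminf_eq.symm
  rw [lintegral_congr_ae hlim]
  refine (lintegral_liminf_le' fun n => ?_).trans ?_
  · exact (hasGaussianLaw_bridgeSum hB G n).aemeasurable.enorm.pow_const _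
  · exact liminf_le_of_frequently_le' hbound.frequently

theorem pathClass_ae_eq {w : I → Plane} (hw : MemLp w 2 volume) : pathClass w =ᵐ[volume] w := by
  rw [pathClass, dif_pos hw]
  exact hw.coeFn_toLp

theorem flowMap_pathClass_zero {t : ℝ} (ht : 0 < t) (r : I) {w : I → Plane} (hw : Continuous w) :
    flowMap (t, r) (pathClass w) 0 = ∫ y : I, heatKernel t r y * w y 0 := by
  rw [flowMap_apply ht, heatFlow, integral_plane_apply
    (integrable_bdd_smul (integrable_coeFn _) (continuous_heatKernel ht r))]
  refine integral_congr_ae ((pathClass_ae_eq (memLp_of_continuous hw 2)).mono fun y hy => ?_)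
  simp only [PiLp.smul_apply, smul_eq_mul, hy]

theorem exists_hasNegMoment_lawH2 {Ω : Type*} [MeasurableSpace Ω] {P : Measure Ω}
    {β : Fin 2 → I → Ω → ℝ} (hβ : IsPlanarBrownianBridge β P) {h : ℝ → ℝ} {M c : ℝ}
    (hh : IsWeight h M c) : ∃ A : ENNReal, A ≠ ⊤ ∧ HasNegMoment (lawH2 β P) h A := by
  set l : ℝ := Real.exp (-(Real.pi ^ 2 / 2)) * c / Real.pi ^ 2 with hl
  have hl0 : 0 < l := by have := hh.pos; positivity
  refine ⟨1 + ENNReal.ofReal (√(2 * Real.pi * l ^ 2))⁻¹ * rsqrtMass, ?_, ?_⟩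
  · have := rsqrtMass_ne_top
    finiteness
  · rintro ⟨t, r⟩ ht ht1 hr
    simp only at ht ht1 hr
    refine (lintegral_map_le _ _).trans ?_
    have hs := hh.sin_sq_ge r hr
    have hlt : l < ∫ y in (0 : ℝ)..1, heatKernel t r y * bridgeCov y r := by
      refine lt_of_lt_of_le ?_ (le_integral_heatKernel_mul_bridgeCov ht ht1 r)
      calc l < 2 * l := by linarith
        _ = 2 * Real.exp (-(Real.pi ^ 2 / 2)) * c / Real.pi ^ 2 := by rw [hl]; ring
        _ ≤ _ := by gcongr
    refine le_trans (lintegral_mono_ae ?_) (lintegral_bridge_rpow_neg_half_le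
      (hβ.isBrownianBridge 0) (continuous_heatKernel ht r) hl0 hlt)
    filter_upwards [(hβ.isBrownianBridge 0).continuous_paths,
      (hβ.isBrownianBridge 1).continuous_paths] with ω h0 h1
    rw [flowMap_pathClass_zero ht r]
    · simp
    · refine (PiLp.continuous_toLp 2 _).comp (continuous_pi fun i => ?_)
      fin_cases i
      · exact h0
      · exact h1

/-! ### The weight and the radial kernels -/

theorem exists_isWeight {h : ℝ → ℝ} (hc : Continuous h) (hs : HasCompactSupport h)
    (hsub : tsupport h ⊆ Ioo 0 1) : ∃ M c, IsWeight h M c := by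
  obtain ⟨M, hM⟩ := hc.bounded_above_of_compact_support hs
  have hpos : ∀ r ∈ tsupport h, 0 < Real.sin (Real.pi * r) ^ 2 := fun r hr => by
    have h1 := hsub hr
    have := Real.sin_pos_of_pos_of_lt_pi (mul_pos Real.pi_pos h1.1)
      (by nlinarith [Real.pi_pos, h1.2])
    positivity
  rcases (tsupport h).eq_empty_or_nonempty with he | hne
  · refine ⟨M, 1, hc, hM, one_pos, fun r hr => ?_⟩
    exact absurd (subset_tsupport h hr) (by simp [he])
  · obtain ⟨r₀, hr₀, hmin⟩ := hs.exists_isMinOn hne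
      (by fun_prop : Continuous fun r : ℝ => Real.sin (Real.pi * r) ^ 2).continuousOn
    exact ⟨M, _, hc, hM, hpos r₀ hr₀, fun r hr => hmin (subset_tsupport h hr)⟩

theorem IsWeight.heatVar_pos {h : ℝ → ℝ} {M c : ℝ} (hh : IsWeight h M c) {t : ℝ} (ht : 0 < t)
    {r : ℝ} (hr : h r ≠ 0) : 0 < heatVar t r := by
  refine RandomString.heatVar_pos ht fun h0 => ?_
  have := hh.sin_sq_ge r hr
  rw [h0] at this
  linarith [hh.pos]

theorem truncPotential_zero_eq {h k : ℝ → ℝ} {M c C : ℝ} (hh : IsWeight h M c)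
    (hk : KernelBound k C) (z : H2) : truncPotential h k 0 z = ∫ t in Ioi (0 : ℝ), Real.exp (-t) *
      ∫ r : I, h r * gaussAvg k (√(heatVar t r))⁻¹ (heatFlow z t r) := by
  have hint := integrable_potentialDensity hh hk z
  have hpos : ∀ᵐ p ∂spaceTime, p ∈ {p : ℝ × I | 0 < p.1} := ae_spaceTime_pos
  rw [truncPotential, Measure.restrict_eq_self_of_ae_mem hpos]
  unfold spaceTime at hint ⊢
  rw [integral_prod _ hint]
  refine setIntegral_congr_fun measurableSet_Ioi fun t ht => ?_
  rw [← integral_const_mul]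
  refine integral_congr_ae (Eventually.of_forall fun r => ?_)
  simp only [potentialDensity, invStd]
  rw [flowMap_apply ht, mul_assoc]

theorem potential_eq_truncPotential {h k : ℝ → ℝ} {M c C : ℝ} (hh : IsWeight h M c)
    (hk : KernelBound k C) (z : H2) {J : ℝ → I → ℝ}
    (hJ : ∀ t (r : I), 0 < t → 0 < heatVar t r →
      gaussAvg k (√(heatVar t r))⁻¹ (heatFlow z t r) = 1 / (8 * Real.pi * heatVar t r) * J t r) :
    ∫ t in Ioi (0 : ℝ), Real.exp (-t) * ∫ r : I, h r / (8 * Real.pi * heatVar t r) * J t r =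
      truncPotential h k 0 z := by
  rw [truncPotential_zero_eq hh hk]
  refine setIntegral_congr_fun measurableSet_Ioi fun t ht => ?_
  congr 1
  refine integral_congr_ae (Eventually.of_forall fun r => ?_)
  beta_reduce
  by_cases hr : h r = 0
  · rw [hr, zero_div, zero_mul, zero_mul]
  · rw [hJ t r ht (hh.heatVar_pos ht hr), div_eq_mul_one_div, mul_assoc]

theorem gaussFun_inv_sqrt_smul {q : ℝ} (hq : 0 < q) (x : Plane) :
    gaussFun ((√q)⁻¹ • x) = Real.exp (-‖x‖ ^ 2 / (2 * q)) := by
  rw [gaussFun, norm_smul, mul_pow, norm_inv, Real.norm_of_nonneg (Real.sqrt_nonneg q), inv_pow,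
    Real.sq_sqrt hq.le]
  congr 1
  field_simp

theorem secDiff_gaussFun_eq {q : ℝ} (hq : 0 < q) (m a : Plane) :
    secDiff gaussFun ((√q)⁻¹ • a) ((√q)⁻¹ • m) = gaussDiff q m a + gaussDiff q m (-a) := by
  rw [secDiff, ← smul_sub, ← smul_add, gaussFun_inv_sqrt_smul hq, gaussFun_inv_sqrt_smul hq,
    gaussFun_inv_sqrt_smul hq, gaussDiff, gaussDiff, norm_sub_rev m a,
    show -a - m = -(m + a) by abel, norm_neg, smul_eq_mul]
  ring

theorem continuous_gaussDiff (q : ℝ) (m : Plane) : Continuous (gaussDiff q m) := by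
  unfold gaussDiff; fun_prop

theorem abs_gaussDiff_le {q : ℝ} (hq : 0 < q) (m a : Plane) : |gaussDiff q m a| ≤ 1 := by
  have h : ∀ x : Plane, Real.exp (-‖x‖ ^ 2 / (2 * q)) ≤ 1 := fun x =>
    Real.exp_le_one_iff.2 (div_nonpos_of_nonpos_of_nonneg (by nlinarith [sq_nonneg ‖x‖])
      (by positivity))
  rw [gaussDiff, abs_le]
  have := Real.exp_pos (-‖a - m‖ ^ 2 / (2 * q))
  have := Real.exp_pos (-‖m‖ ^ 2 / (2 * q))
  constructor <;> linarith [h (a - m), h m]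

theorem gaussAvg_eq_integral_gaussDiff {k : ℝ → ℝ} (hk : Integrable fun a : Plane => k ‖a‖) {q : ℝ}
    (hq : 0 < q) (m : Plane) : gaussAvg k (√q)⁻¹ m =
      1 / (2 * Real.pi * q) * ∫ a : Plane, k ‖a‖ * gaussDiff q m a := by
  have hint : Integrable fun a : Plane => k ‖a‖ * gaussDiff q m a :=
    hk.mul_bdd (c := 1) (continuous_gaussDiff q m).aestronglyMeasurable
      (Eventually.of_forall fun a => abs_gaussDiff_le hq m a)
  have hneg : ∫ a : Plane, k ‖a‖ * gaussDiff q m (-a) = ∫ a : Plane, k ‖a‖ * gaussDiff q m a := by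
    rw [← integral_neg_eq_self]
    simp
  have hint' : Integrable fun a : Plane => k ‖a‖ * gaussDiff q m (-a) := by
    simpa using hint.comp_neg
  rw [gaussAvg, inv_pow, Real.sq_sqrt hq.le]
  simp_rw [secDiff_gaussFun_eq hq, mul_add]
  rw [integral_add hint hint', hneg]
  field_simp
  ring

/-- The kernel `¼ 1_{x ≥ ε} / x³`. -/
def cutKernel (ε x : ℝ) : ℝ := 1 / 4 * (if ε ≤ x then 1 / x ^ 3 else 0)

/-- The kernel `¼ / x³`. -/
def cubeKernel (x : ℝ) : ℝ := 1 / 4 * (1 / x ^ 3)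

theorem measurable_cutKernel (ε : ℝ) : Measurable (cutKernel ε) :=
  (Measurable.ite measurableSet_Ici (by fun_prop) measurable_const).const_mul _

theorem kernelBound_cutKernel (ε : ℝ) : KernelBound (cutKernel ε) (1 / 4) := by
  refine ⟨measurable_cutKernel ε, fun x hx => ?_⟩
  rw [cutKernel, abs_mul, abs_of_pos (by norm_num : (0 : ℝ) < 1 / 4)]
  refine mul_le_mul_of_nonneg_left ?_ (by norm_num)
  split_ifs
  · rw [abs_of_nonneg (by positivity)]
  · rw [abs_zero]; positivity

theorem kernelBound_cubeKernel : KernelBound cubeKernel (1 / 4) := by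
  refine ⟨by unfold cubeKernel; fun_prop, fun x hx => ?_⟩
  rw [cubeKernel, abs_of_nonneg (by positivity)]

theorem KernelBound.mono {k : ℝ → ℝ} {C C' : ℝ} (hk : KernelBound k C) (hC : C ≤ C') :
    KernelBound k C' :=
  ⟨hk.measurable, fun x hx => (hk.abs_le x hx).trans
    (mul_le_mul_of_nonneg_right hC (by positivity))⟩

theorem tendsto_cutKernel {x : ℝ} (hx : 0 < x) :
    Tendsto (fun ε => cutKernel ε x) (𝓝[>] 0) (𝓝 (cubeKernel x)) := by
  refine tendsto_const_nhds.congr' ?_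
  filter_upwards [nhdsWithin_le_nhds (gt_mem_nhds hx)] with ε hε
  rw [cutKernel, if_pos hε.le, cubeKernel]

theorem integrableOn_mul_cutKernel {ε : ℝ} (hε : 0 < ε) :
    IntegrableOn (fun y => y * cutKernel ε y) (Ioi 0) ∧
      ∫ y in Ioi (0 : ℝ), y * cutKernel ε y = 1 / (4 * ε) := by
  have h0 : ∀ y, y * cutKernel ε y = (Ici ε).indicator (fun y => 1 / 4 * y ^ (-2 : ℝ)) y := by
    intro y
    by_cases hy : y ∈ Ici ε
    · have hy0 : 0 < y := hε.trans_le hy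
      rw [indicator_of_mem hy, cutKernel, if_pos (mem_Ici.1 hy), Real.rpow_neg hy0.le, Real.rpow_two]
      field_simp
    · rw [indicator_of_notMem hy, cutKernel, if_neg (mt mem_Ici.2 hy), mul_zero, mul_zero]
  have hsub : Ici ε ∩ Ioi 0 = Ici ε := inter_eq_left.2 fun y hy => hε.trans_le hy
  have hint : IntegrableOn (fun y : ℝ => 1 / 4 * y ^ (-2 : ℝ)) (Ici ε) := by
    rw [integrableOn_Ici_iff_integrableOn_Ioi]
    exact (integrableOn_Ioi_rpow_of_lt (by norm_num) hε).const_mul _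
  simp_rw [h0]
  constructor
  · rw [integrableOn_indicator_iff measurableSet_Ici, hsub]
    exact hint
  · rw [integral_indicator measurableSet_Ici, Measure.restrict_restrict measurableSet_Ici, hsub,
      integral_Ici_eq_integral_Ioi, integral_const_mul, integral_Ioi_rpow_of_lt (by norm_num) hε]
    norm_num
    rw [Real.rpow_neg_one]
    ring

theorem integrable_norm_plane_iff {f : ℝ → ℝ} :
    (Integrable fun a : Plane => f ‖a‖) ↔ IntegrableOn (fun y => y * f y) (Ioi 0) := by
  rw [integrable_fun_norm_addHaar]
  simp

theorem integral_norm_plane_eq_zero {f : ℝ → ℝ} (hf : ∫ y in Ioi (0 : ℝ), y * f y = 0) :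
    ∫ a : Plane, f ‖a‖ = 0 := by
  rw [integral_fun_norm_addHaar]
  simp [hf]

theorem integrable_cutKernel {ε : ℝ} (hε : 0 < ε) : Integrable fun a : Plane => cutKernel ε ‖a‖ :=
  integrable_norm_plane_iff.2 (integrableOn_mul_cutKernel hε).1

theorem VEps_eq_truncPotential {h : ℝ → ℝ} {M c : ℝ} (hh : IsWeight h M c) {ε : ℝ} (hε : 0 < ε) :
    VEps h ε = truncPotential h (cutKernel ε) 0 := by
  funext z
  refine potential_eq_truncPotential hh (kernelBound_cutKernel ε) z fun t r ht hq => ?_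
  rw [gaussAvg_eq_integral_gaussDiff (integrable_cutKernel hε) hq]
  simp_rw [cutKernel, mul_assoc, integral_const_mul]
  field_simp
  ring

/-! ### The four quadrants -/

theorem sum_signs (F : (Fin 2 → ℤˣ) → ℝ) :
    ∑ α, F α = F ![1, 1] + F ![1, -1] + F ![-1, 1] + F ![-1, -1] := by
  rw [← (finTwoArrowEquiv ℤˣ).symm.sum_comp, Fintype.sum_prod_type]
  simp only [UnitsInt.univ, finTwoArrowEquiv_symm_apply]
  rw [Finset.sum_pair (by decide), Finset.sum_pair (by decide), Finset.sum_pair (by decide)]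
  ring

/-- `flip α` as a linear isometry. -/
def flipIsometry (α : Fin 2 → ℤˣ) : Plane ≃ₗᵢ[ℝ] Plane where
  toLinearEquiv := LinearEquiv.ofInvolutive
    { toFun := flip α
      map_add' := fun a b => by ext i; fin_cases i <;> simp [flip, mul_add]
      map_smul' := fun s a => by ext i; fin_cases i <;> simp [flip, mul_left_comm] }
    (fun a => by
      have h : ∀ i, ((α i : ℤ) : ℝ) * ((α i : ℤ) : ℝ) = 1 := fun i => by
        rcases Int.units_eq_one_or (α i) with h | h <;> simp [h]
      ext i; fin_cases i <;> simp [flip, ← mul_assoc, h])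
  norm_map' := fun a => by
    have h : ∀ i, ((α i : ℤ) : ℝ) ^ 2 = 1 := fun i => by
      rcases Int.units_eq_one_or (α i) with h | h <;> simp [h]
    change ‖flip α a‖ = ‖a‖
    simp [EuclideanSpace.norm_eq, flip, mul_pow, h]

theorem coe_flipIsometry (α : Fin 2 → ℤˣ) : ⇑(flipIsometry α) = flip α := rfl

theorem norm_flip (α : Fin 2 → ℤˣ) (a : Plane) : ‖flip α a‖ = ‖a‖ := (flipIsometry α).norm_map a

theorem flip_neg_left (α : Fin 2 → ℤˣ) (a : Plane) : flip (-α) a = -flip α a := by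
  ext i; fin_cases i <;> simp [flip]

/-- The quadrant `ℝ₊²`. -/
def quadrant : Set Plane := {a | ∀ i, 0 ≤ a i}

theorem measurableSet_quadrant : MeasurableSet quadrant := by
  have : quadrant = ⋂ i : Fin 2, {a : Plane | 0 ≤ a i} := by ext a; simp [quadrant]
  rw [this]
  exact MeasurableSet.iInter fun i => measurableSet_le measurable_const
    (EuclideanSpace.proj i : Plane →L[ℝ] ℝ).continuous.measurable

theorem ae_plane_apply_ne_zero (i : Fin 2) : ∀ᵐ a : Plane, a i ≠ 0 := by
  have h := (PiLp.volume_preserving_ofLp (Fin 2)).quasiMeasurePreserving.ae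
    (p := fun x : Fin 2 → ℝ => x i ≠ 0) (Measure.ae_eval_ne (fun _ : Fin 2 => (volume : Measure ℝ)) i 0)
  exact h

theorem sum_indicator_quadrant_flip (f : Plane → ℝ) :
    ∀ᵐ a : Plane, ∑ α, (flip α ⁻¹' quadrant).indicator f a = f a := by
  filter_upwards [ae_plane_apply_ne_zero 0, ae_plane_apply_ne_zero 1] with a h0 h1
  rw [sum_signs]
  simp only [indicator, mem_preimage, quadrant, mem_ofPred_eq, Fin.forall_fin_two, flip]
  rcases lt_or_gt_of_ne h0 with h0 | h0 <;> rcases lt_or_gt_of_ne h1 with h1 | h1 <;>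
    simp [h0.le, h1.le, h0.not_ge, h1.not_ge]

theorem sum_setIntegral_quadrant_flip {f : Plane → ℝ} (hf : Integrable f) :
    ∑ α, ∫ a in quadrant, f (flip α a) = ∫ a, f a := by
  have h1 : ∀ α, ∫ a in quadrant, f (flip α a) =
      ∫ a, (flip α ⁻¹' quadrant).indicator f a := fun α => by
    have hinv : ∀ a, flip α (flip α a) = a := (flipIsometry α).left_inv
    rw [← integral_indicator measurableSet_quadrant,
      ← (flipIsometry α).measurePreserving.integral_comp
        (flipIsometry α).toHomeomorph.measurableEmbedding, coe_flipIsometry]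
    refine integral_congr_ae (Eventually.of_forall fun a => ?_)
    beta_reduce
    by_cases ha : flip α a ∈ quadrant
    · rw [indicator_of_mem ha, indicator_of_mem (show a ∈ flip α ⁻¹' quadrant from ha), hinv]
    · rw [indicator_of_notMem ha, indicator_of_notMem (show a ∉ flip α ⁻¹' quadrant from ha)]
  have hm : ∀ α, MeasurableSet (flip α ⁻¹' quadrant) := fun α =>
    (flipIsometry α).continuous.measurable measurableSet_quadrant
  simp_rw [h1]
  rw [← integral_finsetSum _ fun α _ => hf.indicator (hm α)]
  exact integral_congr_ae (sum_indicator_quadrant_flip f)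

theorem sum_gaussDiff_flip {q : ℝ} (hq : 0 < q) (m a : Plane) :
    ∑ α, gaussDiff q m (flip α a) =
      1 / 2 * ∑ α, secDiff gaussFun ((√q)⁻¹ • flip α a) ((√q)⁻¹ • m) := by
  have h : ∑ α, gaussDiff q m (-flip α a) = ∑ α, gaussDiff q m (flip α a) := by
    refine Fintype.sum_equiv (Equiv.neg (Fin 2 → ℤˣ)) _ _ fun α => ?_
    simp [flip_neg_left]
  simp_rw [secDiff_gaussFun_eq hq]
  rw [Finset.sum_add_distrib, h]
  ring

theorem gaussAvg_cubeKernel {q : ℝ} (hq : 0 < q) (m : Plane) : gaussAvg cubeKernel (√q)⁻¹ m =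
    1 / (8 * Real.pi * q) * ∫ a in quadrant, 1 / ‖a‖ ^ 3 * ∑ α, gaussDiff q m (flip α a) := by
  have hint := integrable_gaussAvg_integrand kernelBound_cubeKernel
    (inv_nonneg.2 (Real.sqrt_nonneg q)) m
  have h1 : ∀ a : Plane, 1 / ‖a‖ ^ 3 * ∑ α, gaussDiff q m (flip α a) =
      2 * ∑ α, cubeKernel ‖flip α a‖ * secDiff gaussFun ((√q)⁻¹ • flip α a) ((√q)⁻¹ • m) := by
    intro a
    simp_rw [norm_flip, ← Finset.mul_sum, sum_gaussDiff_flip hq, cubeKernel]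
    ring
  have h2 : ∀ α ∈ Finset.univ, IntegrableOn (fun a => cubeKernel ‖flip α a‖ *
      secDiff gaussFun ((√q)⁻¹ • flip α a) ((√q)⁻¹ • m)) quadrant := fun α _ =>
    ((flipIsometry α).measurePreserving.integrable_comp_of_integrable hint).integrableOn
  simp_rw [h1]
  rw [integral_const_mul, integral_finsetSum _ h2, sum_setIntegral_quadrant_flip hint, gaussAvg,
    inv_pow, Real.sq_sqrt hq.le]
  field_simp
  ring

theorem VLim_eq_truncPotential {h : ℝ → ℝ} {M c : ℝ} (hh : IsWeight h M c) :
    VLim h = truncPotential h cubeKernel 0 :=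
  funext fun z => potential_eq_truncPotential hh kernelBound_cubeKernel z fun _ _ _ hq =>
    gaussAvg_cubeKernel hq _

/-! ### The regularized kernel -/

/-- The hypotheses on the mollifier. -/
structure IsMollifier (ρ : ℝ → ℝ) (B : ℝ) : Prop where
  continuous : Continuous ρ
  eq_zero : ∀ y, 1 < |y| → ρ y = 0
  abs_le : ∀ y, |ρ y| ≤ B
  even : ∀ y, ρ (-y) = ρ y
  integral_eq_one : ∫ y in (-1 : ℝ)..1, ρ y = 1

theorem IsMollifier.nonneg {ρ : ℝ → ℝ} {B : ℝ} (hρ : IsMollifier ρ B) : 0 ≤ B :=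
  (abs_nonneg _).trans (hρ.abs_le 0)

theorem IsMollifier.integrable {ρ : ℝ → ℝ} {B : ℝ} (hρ : IsMollifier ρ B) : Integrable ρ := by
  refine hρ.continuous.integrable_of_hasCompactSupport
    (HasCompactSupport.of_support_subset_isCompact (isCompact_Icc (a := -1) (b := 1)) fun y hy => ?_)
  by_contra hn
  exact hy (hρ.eq_zero y (not_le.1 fun h => hn (_root_.abs_le.1 h)))

theorem IsMollifier.integral_Ioi {ρ : ℝ → ℝ} {B : ℝ} (hρ : IsMollifier ρ B) :
    ∫ y in Ioi (0 : ℝ), ρ y = 1 / 2 := by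
  have h1 := integral_comp_abs (f := ρ)
  have h2 : ∀ y, ρ |y| = ρ y := fun y => by
    rcases abs_choice y with h | h <;> rw [h]
    exact hρ.even y
  simp_rw [h2] at h1
  rw [← setIntegral_eq_integral_of_forall_compl_eq_zero (s := Icc (-1) 1) fun y hy =>
    hρ.eq_zero y (not_le.1 fun h => hy (_root_.abs_le.1 h)), integral_Icc_eq_integral_Ioc,
    ← intervalIntegral.integral_of_le (by norm_num), hρ.integral_eq_one] at h1
  linarith

theorem IsMollifier.integral_rescale_Ioi {ρ : ℝ → ℝ} {B η : ℝ} (hρ : IsMollifier ρ B) (hη : 0 < η) :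
    ∫ y in Ioi (0 : ℝ), rescale ρ η y = 1 / 2 := by
  have h := integral_comp_mul_left_Ioi ρ 0 (inv_pos.2 hη)
  rw [mul_zero, hρ.integral_Ioi, inv_inv, smul_eq_mul] at h
  have h2 : ∀ y, rescale ρ η y = 1 / η * ρ (η⁻¹ * y) := fun y => by
    rw [rescale, div_eq_inv_mul y]
  simp_rw [h2, integral_const_mul, h]
  field_simp

theorem IsMollifier.integrable_rescale {ρ : ℝ → ℝ} {B η : ℝ} (hρ : IsMollifier ρ B) (hη : 0 < η) :
    Integrable (rescale ρ η) :=
  (hρ.integrable.comp_div hη.ne').const_mul _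

theorem fReg_eq (ρ : ℝ → ℝ) (ε η x : ℝ) :
    fReg ρ ε η x = cutKernel ε x - 1 / (2 * ε) * (rescale ρ η x / x) := by
  rw [fReg, cutKernel]; ring

theorem IsMollifier.rescale_div_le {ρ : ℝ → ℝ} {B ε η x : ℝ} (hρ : IsMollifier ρ B) (hη : 0 < η)
    (hηε : η < ε) (hx : 0 ≤ x) : |1 / (2 * ε) * (rescale ρ η x / x)| ≤ B / 2 * (1 / x ^ 3) := by
  have hB := hρ.nonneg
  have hε := hη.trans hηε
  rcases hx.eq_or_lt with rfl | hx
  · simp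
  by_cases hxη : x ≤ η
  · rw [rescale, abs_mul, abs_of_pos (by positivity : 0 < 1 / (2 * ε)), abs_div, abs_mul,
      abs_of_pos hx, abs_of_pos (by positivity : 0 < 1 / η)]
    calc 1 / (2 * ε) * (1 / η * |ρ (x / η)| / x) ≤ 1 / (2 * x) * (1 / x * B / x) := by
          have := hρ.abs_le (x / η)
          have := hxη.trans hηε.le
          gcongr
      _ = B / 2 * (1 / x ^ 3) := by field_simp
  · rw [rescale, hρ.eq_zero (x / η), mul_zero, zero_div, mul_zero, abs_zero]
    · positivity
    · rw [abs_of_pos (by positivity), one_lt_div hη]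
      exact not_le.1 hxη

theorem IsMollifier.measurable_fReg {ρ : ℝ → ℝ} {B : ℝ} (hρ : IsMollifier ρ B) (ε η : ℝ) :
    Measurable (fReg ρ ε η) := by
  have h1 : Measurable (rescale ρ η) := (hρ.continuous.measurable.comp (by fun_prop)).const_mul _
  have h2 := (measurable_cutKernel ε).sub ((h1.div measurable_id).const_mul (1 / (2 * ε)))
  have h3 : fReg ρ ε η = fun x => cutKernel ε x - 1 / (2 * ε) * (rescale ρ η x / x) :=
    funext (fReg_eq ρ ε η)
  rw [h3]
  exact h2

theorem IsMollifier.kernelBound_fReg {ρ : ℝ → ℝ} {B ε η : ℝ} (hρ : IsMollifier ρ B) (hη : 0 < η)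
    (hηε : η < ε) : KernelBound (fReg ρ ε η) (1 / 4 + B / 2) := by
  refine ⟨hρ.measurable_fReg ε η, fun x hx => ?_⟩
  rw [fReg_eq, add_mul]
  exact (abs_sub _ _).trans (add_le_add ((kernelBound_cutKernel ε).abs_le x hx)
    (hρ.rescale_div_le hη hηε hx))

theorem IsMollifier.tendsto_fReg {ρ : ℝ → ℝ} {B : ℝ} (hρ : IsMollifier ρ B) (ε : ℝ) {x : ℝ}
    (hx : 0 < x) : Tendsto (fun η => fReg ρ ε η x) (𝓝[>] 0) (𝓝 (cutKernel ε x)) := by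
  refine tendsto_const_nhds.congr' ?_
  filter_upwards [nhdsWithin_le_nhds (gt_mem_nhds hx), self_mem_nhdsWithin] with η hη hη0
  have hη0 : 0 < η := hη0
  rw [fReg_eq, rescale, hρ.eq_zero (x / η), mul_zero, zero_div, mul_zero, sub_zero]
  rwa [abs_of_pos (by positivity), one_lt_div hη0]

theorem mul_fReg_eq {ρ : ℝ → ℝ} {ε η y : ℝ} (hy : 0 < y) :
    y * fReg ρ ε η y = y * cutKernel ε y - 1 / (2 * ε) * rescale ρ η y := by
  rw [fReg_eq]
  field_simp

theorem IsMollifier.integrable_fReg {ρ : ℝ → ℝ} {B ε η : ℝ} (hρ : IsMollifier ρ B) (hη : 0 < η)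
    (hε : 0 < ε) : Integrable fun a : Plane => fReg ρ ε η ‖a‖ := by
  rw [integrable_norm_plane_iff]
  refine IntegrableOn.congr_fun ((integrableOn_mul_cutKernel hε).1.sub
    ((hρ.integrable_rescale hη).integrableOn.const_mul (1 / (2 * ε))))
    (fun y hy => (mul_fReg_eq hy).symm) measurableSet_Ioi

theorem IsMollifier.integral_fReg {ρ : ℝ → ℝ} {B ε η : ℝ} (hρ : IsMollifier ρ B) (hη : 0 < η)
    (hε : 0 < ε) : ∫ a : Plane, fReg ρ ε η ‖a‖ = 0 := by
  refine integral_norm_plane_eq_zero ?_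
  rw [setIntegral_congr_fun measurableSet_Ioi fun y hy => mul_fReg_eq hy,
    integral_sub (integrableOn_mul_cutKernel hε).1
      ((hρ.integrable_rescale hη).integrableOn.const_mul _), (integrableOn_mul_cutKernel hε).2,
    integral_const_mul, hρ.integral_rescale_Ioi hη]
  ring

theorem IsMollifier.gaussAvg_fReg {ρ : ℝ → ℝ} {B ε η q : ℝ} (hρ : IsMollifier ρ B) (hη : 0 < η)
    (hε : 0 < ε) (hq : 0 < q) (m : Plane) : gaussAvg (fReg ρ ε η) (√q)⁻¹ m =
      ∫ a : Plane, 1 / (2 * Real.pi * q) * Real.exp (-‖a - m‖ ^ 2 / (2 * q)) * fReg ρ ε η ‖a‖ := by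
  have hf := hρ.integrable_fReg hη hε
  have hint : Integrable fun a : Plane => fReg ρ ε η ‖a‖ * gaussDiff q m a :=
    hf.mul_bdd (c := 1) (continuous_gaussDiff q m).aestronglyMeasurable
      (Eventually.of_forall fun a => abs_gaussDiff_le hq m a)
  rw [gaussAvg_eq_integral_gaussDiff hf hq]
  have h : ∫ a : Plane, fReg ρ ε η ‖a‖ * Real.exp (-‖m‖ ^ 2 / (2 * q)) = 0 := by
    rw [integral_mul_const, hρ.integral_fReg hη hε, zero_mul]
  rw [← add_zero (∫ a : Plane, fReg ρ ε η ‖a‖ * gaussDiff q m a), ← h,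
    ← integral_add hint (hf.mul_const _), ← integral_const_mul]
  refine integral_congr_ae (Eventually.of_forall fun a => ?_)
  simp only [gaussDiff]
  ring

/-! ### The law of the solution of the stochastic heat equation -/

/-- The density of the centred planar Gaussian with covariance `q Id`, translated by `m`. -/
def planeDensity (q : ℝ) (m a : Plane) : ℝ :=
  1 / (2 * Real.pi * q) * Real.exp (-‖a - m‖ ^ 2 / (2 * q))

theorem continuous_planeDensity (q : ℝ) (m : Plane) : Continuous (planeDensity q m) := by
  unfold planeDensity; fun_prop

theorem planeDensity_nonneg {q : ℝ} (hq : 0 < q) (m a : Plane) : 0 ≤ planeDensity q m a := by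
  unfold planeDensity; positivity

theorem planeDensity_le {q : ℝ} (hq : 0 < q) (m a : Plane) :
    planeDensity q m a ≤ 1 / (2 * Real.pi * q) := by
  refine mul_le_of_le_one_right (by positivity) (Real.exp_le_one_iff.2 ?_)
  exact div_nonpos_of_nonpos_of_nonneg (by nlinarith [sq_nonneg ‖a - m‖]) (by positivity)

theorem measurePreserving_planeTranslate (m : Plane) :
    MeasurePreserving (fun p : ℝ × ℝ => m + !₂[p.1, p.2]) volume volume :=
  (measurePreserving_add_left volume m).comp ((PiLp.volume_preserving_toLp (Fin 2)).comp
    (volume_preserving_finTwoArrow ℝ).symm)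

theorem gaussianPDF_mul_gaussianPDF {q : ℝ} (hq : 0 < q) (m : Plane) (p : ℝ × ℝ) :
    gaussianPDF 0 q.toNNReal p.1 * gaussianPDF 0 q.toNNReal p.2 =
      ENNReal.ofReal (planeDensity q m (m + !₂[p.1, p.2])) := by
  rw [gaussianPDF, gaussianPDF, ← ENNReal.ofReal_mul (gaussianPDFReal_nonneg _ _ _),
    gaussianPDFReal, gaussianPDFReal, planeDensity, Real.coe_toNNReal q hq.le, add_sub_cancel_left,
    EuclideanSpace.norm_sq_eq, Fin.sum_univ_two]
  congr 1
  have hs : (√(2 * Real.pi * q))⁻¹ * (√(2 * Real.pi * q))⁻¹ = 1 / (2 * Real.pi * q) := by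
    rw [← mul_inv, Real.mul_self_sqrt (by positivity), one_div]
  rw [mul_mul_mul_comm, hs, ← Real.exp_add]
  congr 2
  simp
  ring

theorem map_gaussian_plane {Ω : Type*} [MeasurableSpace Ω] {P : Measure Ω} [IsFiniteMeasure P]
    {X Y : Ω → ℝ} (hXm : AEMeasurable X P) (hYm : AEMeasurable Y P) (hXY : IndepFun X Y P) {q : ℝ}
    (hq : 0 < q) (hX : P.map X = gaussianReal 0 q.toNNReal)
    (hY : P.map Y = gaussianReal 0 q.toNNReal) (m : Plane) :
    P.map (fun ω => m + !₂[X ω, Y ω]) =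
      volume.withDensity fun a => ENNReal.ofReal (planeDensity q m a) := by
  have hpres := measurePreserving_planeTranslate m
  have hq0 : q.toNNReal ≠ 0 := by simpa using hq
  have hpair : P.map (fun ω => (X ω, Y ω)) = volume.withDensity
      fun p : ℝ × ℝ => ENNReal.ofReal (planeDensity q m (m + !₂[p.1, p.2])) := by
    rw [(indepFun_iff_map_prod_eq_prod_map_map hXm hYm).1 hXY, hX, hY,
      gaussianReal_of_var_ne_zero _ hq0, prod_withDensity (measurable_gaussianPDF _ _)
        (measurable_gaussianPDF _ _)]
    simp_rw [gaussianPDF_mul_gaussianPDF hq m]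
    rfl
  have hcomp : P.map (fun ω => m + !₂[X ω, Y ω]) =
      (P.map fun ω => (X ω, Y ω)).map fun p : ℝ × ℝ => m + !₂[p.1, p.2] :=
    (AEMeasurable.map_map_of_aemeasurable hpres.measurable.aemeasurable (hXm.prodMk hYm)).symm
  rw [hcomp, hpair]
  ext s hs
  rw [Measure.map_apply hpres.measurable hs, withDensity_apply _ (hpres.measurable hs),
    withDensity_apply _ hs]
  exact hpres.setLIntegral_comp_preimage hs
    (continuous_planeDensity q m).measurable.ennreal_ofReal

theorem inner_self_mildKernel {t : ℝ} (ht : 0 < t) {x : I} {φ : Lp ℝ 2 spaceTime}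
    (hφ : φ =ᵐ[spaceTime] fun p => if p.1 < t then heatKernel (t - p.1) x p.2 else 0) :
    inner ℝ φ φ = heatVar t x := by
  have h1 : (fun p => inner ℝ (φ p) (φ p)) =ᵐ[spaceTime]
      fun p => if p.1 < t then heatKernel (t - p.1) x p.2 ^ 2 else 0 :=
    hφ.mono fun p hp => by
      simp only [hp]
      split_ifs <;> simp [sq]
  have hint : Integrable (fun p : ℝ × I => if p.1 < t then heatKernel (t - p.1) x p.2 ^ 2 else 0)
      spaceTime := (L2.integrable_inner (𝕜 := ℝ) φ φ).congr h1
  rw [L2.inner_def, integral_congr_ae h1]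
  unfold spaceTime at hint ⊢
  rw [integral_prod _ hint]
  have h2 : ∀ s, ∫ y : I, (if s < t then heatKernel (t - s) x y ^ 2 else 0) =
      (Iio t).indicator (fun s => heatKernel (2 * (t - s)) x x) s := by
    intro s
    by_cases hs : s < t
    · rw [indicator_of_mem (mem_Iio.2 hs)]
      simp only [if_pos hs]
      exact integral_heatKernel_sq (sub_pos.2 hs) x
    · rw [indicator_of_notMem (mt mem_Iio.1 hs)]
      simp only [if_neg hs, integral_zero]
  simp only [h2]
  rw [integral_indicator measurableSet_Iio, Measure.restrict_restrict measurableSet_Iio, inter_comm,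
    Ioi_inter_Iio, ← integral_Ioc_eq_integral_Ioo, ← intervalIntegral.integral_of_le ht.le,
    intervalIntegral.integral_comp_sub_left (fun τ => heatKernel (2 * τ) x x) t, sub_self, sub_zero,
    heatVar]

section Noise

variable {Ω : Type*} [MeasurableSpace Ω] {P : Measure Ω} {ξ : Lp ℝ 2 spaceTime → Ω → ℝ}

theorem IsWhiteNoise.variance_eq (hξ : IsWhiteNoise ξ P) (φ : Lp ℝ 2 spaceTime) :
    Var[ξ φ; P] = inner ℝ φ φ := by
  rw [← covariance_self (hξ.measurable φ).aemeasurable, hξ.covariance_eq]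

theorem IsWhiteNoise.map_eq (hξ : IsWhiteNoise ξ P) (φ : Lp ℝ 2 spaceTime) :
    P.map (ξ φ) = gaussianReal 0 (inner ℝ φ φ : ℝ).toNNReal := by
  rw [(hξ.isGaussianProcess.hasGaussianLaw_eval φ).map_eq_gaussianReal, hξ.integral_eq_zero,
    hξ.variance_eq]

theorem IsWhiteNoise.integrable_sq (hξ : IsWhiteNoise ξ P) (φ : Lp ℝ 2 spaceTime) :
    Integrable (fun ω => ξ φ ω ^ 2) P :=
  (hξ.isGaussianProcess.hasGaussianLaw_eval φ).memLp_two.integrable_sq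

theorem IsWhiteNoise.integral_sq (hξ : IsWhiteNoise ξ P) (φ : Lp ℝ 2 spaceTime) :
    ∫ ω, ξ φ ω ^ 2 ∂P = inner ℝ φ φ := by
  rw [← hξ.variance_eq, variance_of_integral_eq_zero (hξ.measurable φ).aemeasurable
    (hξ.integral_eq_zero φ)]

end Noise

theorem IsWeight.exists_one_div_heatVar_le {h : ℝ → ℝ} {M c : ℝ} (hh : IsWeight h M c) {t : ℝ}
    (ht : 0 < t) :
    ∃ S : ℝ, 0 ≤ S ∧ ∀ r : I, h r ≠ 0 → 1 / (2 * Real.pi * heatVar t r) ≤ S := by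
  obtain ⟨S, hS, hinv⟩ := invStd_le hh.pos
  refine ⟨(S * max 1 (t ^ (-(1 / 4) : ℝ))) ^ 2, sq_nonneg _, fun r hr => ?_⟩
  have hq := hh.heatVar_pos ht hr
  have h1 : invStd (t, r) ^ 2 ≤ (S * max 1 (t ^ (-(1 / 4) : ℝ))) ^ 2 :=
    pow_le_pow_left₀ (invStd_nonneg _) (hinv (t, r) ht (hh.sin_sq_ge r hr)) 2
  have h2 : invStd (t, r) ^ 2 = 1 / heatVar t r := invStd_sq_mul (p := (t, r)) hq
  rw [h2] at h1
  exact (one_div_le_one_div_of_le hq (le_mul_of_one_le_left hq.le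
    (by linarith [Real.pi_gt_three]))).trans h1

section Mild

variable {Ω : Type*} [MeasurableSpace Ω] {P : Measure Ω}
  {ξ : Fin 2 → Lp ℝ 2 spaceTime → Ω → ℝ} {z : H2} {v : ℝ → I → Ω → Plane}

theorem IsMildSolution.exists_ae_eq (hv : IsMildSolution ξ P z v) {t : ℝ} (ht : 0 < t) (x : I) :
    ∃ φ : Lp ℝ 2 spaceTime, inner ℝ φ φ = heatVar t x ∧
      v t x =ᵐ[P] fun ω => heatFlow z t x + !₂[ξ 0 φ ω, ξ 1 φ ω] := by
  obtain ⟨φ, hφ, h⟩ := hv.mild t ht x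
  refine ⟨φ, inner_self_mildKernel ht hφ, ?_⟩
  filter_upwards [h 0, h 1] with ω h0 h1
  ext i
  fin_cases i
  · simpa using h0
  · simpa using h1

theorem IsMildSolution.measurable_apply (hv : IsMildSolution ξ P z v) {t : ℝ} (ht : 0 ≤ t) (x : I) :
    Measurable (v t x) := (hv.measurable t ht).comp measurable_prodMk_left

variable [IsProbabilityMeasure P]

theorem IsMildSolution.map_eq (hξ : IsPlanarWhiteNoise ξ P) (hv : IsMildSolution ξ P z v) {t : ℝ}
    (ht : 0 < t) {x : I} (hq : 0 < heatVar t x) : P.map (v t x) =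
      volume.withDensity fun a => ENNReal.ofReal (planeDensity (heatVar t x) (heatFlow z t x) a) := by
  obtain ⟨φ, hφ, h⟩ := hv.exists_ae_eq ht x
  have hm := fun i => ((hξ.isWhiteNoise i).measurable φ).aemeasurable (μ := P)
  have hlaw := fun i => (hξ.isWhiteNoise i).map_eq φ
  rw [hφ] at hlaw
  rw [Measure.map_congr h]
  exact map_gaussian_plane (hm 0) (hm 1)
    (hξ.indep.comp (measurable_pi_apply φ) (measurable_pi_apply φ)) hq (hlaw 0) (hlaw 1) _

theorem IsMildSolution.integrable_comp (hξ : IsPlanarWhiteNoise ξ P) (hv : IsMildSolution ξ P z v)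
    {t : ℝ} (ht : 0 < t) {x : I} (hq : 0 < heatVar t x) {f : Plane → ℝ} (hf : Integrable f) :
    Integrable (fun ω => f (v t x ω)) P := by
  have hd := (continuous_planeDensity (heatVar t x) (heatFlow z t x)).measurable.ennreal_ofReal
  have h : Integrable f (P.map (v t x)) := by
    rw [hv.map_eq hξ ht hq, integrable_withDensity_iff_integrable_smul' hd
      (Eventually.of_forall fun _ => ENNReal.ofReal_lt_top)]
    refine hf.bdd_smul (1 / (2 * Real.pi * heatVar t x)) hd.ennreal_toReal.aestronglyMeasurable
      (Eventually.of_forall fun a => ?_)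
    rw [ENNReal.toReal_ofReal (planeDensity_nonneg hq _ _),
      Real.norm_of_nonneg (planeDensity_nonneg hq _ _)]
    exact planeDensity_le hq _ _
  exact h.comp_measurable (hv.measurable_apply ht.le x)

theorem IsMildSolution.integral_comp (hξ : IsPlanarWhiteNoise ξ P) (hv : IsMildSolution ξ P z v)
    {t : ℝ} (ht : 0 < t) {x : I} (hq : 0 < heatVar t x) {f : Plane → ℝ} (hfm : Measurable f) :
    ∫ ω, f (v t x ω) ∂P = ∫ a, planeDensity (heatVar t x) (heatFlow z t x) a * f a := by
  have hd := (continuous_planeDensity (heatVar t x) (heatFlow z t x)).measurable.ennreal_ofReal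
  rw [← integral_map (f := f) (hv.measurable_apply ht.le x).aemeasurable hfm.aestronglyMeasurable,
    hv.map_eq hξ ht hq, integral_withDensity_eq_integral_toReal_smul hd
      (Eventually.of_forall fun _ => ENNReal.ofReal_lt_top)]
  simp_rw [ENNReal.toReal_ofReal (planeDensity_nonneg hq _ _), smul_eq_mul]

theorem IsMildSolution.integral_comp_le (hξ : IsPlanarWhiteNoise ξ P)
    (hv : IsMildSolution ξ P z v) {t : ℝ} (ht : 0 < t) {x : I} (hq : 0 < heatVar t x)
    {f : Plane → ℝ} (hf : Integrable f) (hfm : Measurable f) (hf0 : ∀ a, 0 ≤ f a) :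
    ∫ ω, f (v t x ω) ∂P ≤ 1 / (2 * Real.pi * heatVar t x) * ∫ a, f a := by
  rw [hv.integral_comp hξ ht hq hfm, ← integral_const_mul]
  exact integral_mono_of_nonneg
    (Eventually.of_forall fun a => mul_nonneg (planeDensity_nonneg hq _ _) (hf0 a))
    (hf.const_mul _)
    (Eventually.of_forall fun a => mul_le_mul_of_nonneg_right (planeDensity_le hq _ _) (hf0 a))

theorem exists_heatVar_le {t : ℝ} (ht : 0 ≤ t) : ∃ C : ℝ, ∀ x : ℝ, heatVar t x ≤ C := by
  refine ⟨∑' k : ℕ, 2 / eigenval (k + 1), fun x => ?_⟩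
  refine hasSum_le (fun k => ?_) (hasSum_heatVar ht x) summable_inv_eigenval.hasSum
  have h := eigenval_pos k
  have h1 := one_sub_exp_div_eigenval_nonneg k ht
  have h2 : (1 - Real.exp (-eigenval (k + 1) * t)) / eigenval (k + 1) ≤ 1 / eigenval (k + 1) := by
    have := Real.exp_pos (-eigenval (k + 1) * t)
    gcongr
    linarith
  have h3 : eigenfun (k + 1) x ^ 2 ≤ 2 := by
    rw [eigenfun_sq]
    linarith [Real.sin_sq_le_one (((k + 1 : ℕ) : ℝ) * Real.pi * x)]
  calc _ ≤ 1 / eigenval (k + 1) * 2 := mul_le_mul h2 h3 (sq_nonneg _) (by positivity)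
    _ = _ := by ring

theorem IsMildSolution.integrable_norm_sq (hξ : IsPlanarWhiteNoise ξ P)
    (hv : IsMildSolution ξ P z v) {t : ℝ} (ht : 0 < t) (x : I) :
    Integrable (fun ω => ‖v t x ω‖ ^ 2) P ∧
      ∫ ω, ‖v t x ω‖ ^ 2 ∂P ≤ 2 * ‖heatFlow z t x‖ ^ 2 + 4 * heatVar t x := by
  obtain ⟨φ, hφ, h⟩ := hv.exists_ae_eq ht x
  have hs := fun i => (hξ.isWhiteNoise i).integrable_sq φ
  have hsum : Integrable (fun ω => 2 * (ξ 0 φ ω ^ 2 + ξ 1 φ ω ^ 2)) P :=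
    ((hs 0).add (hs 1)).const_mul 2
  have hint : Integrable (fun ω => 2 * ‖heatFlow z t x‖ ^ 2 + 2 * (ξ 0 φ ω ^ 2 + ξ 1 φ ω ^ 2)) P :=
    (integrable_const _).add hsum
  have hle : ∀ᵐ ω ∂P, ‖v t x ω‖ ^ 2 ≤
      2 * ‖heatFlow z t x‖ ^ 2 + 2 * (ξ 0 φ ω ^ 2 + ξ 1 φ ω ^ 2) := by
    filter_upwards [h] with ω hω
    rw [hω]
    have h1 : ‖(!₂[ξ 0 φ ω, ξ 1 φ ω] : Plane)‖ ^ 2 = ξ 0 φ ω ^ 2 + ξ 1 φ ω ^ 2 := by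
      rw [EuclideanSpace.norm_sq_eq, Fin.sum_univ_two]
      simp
    rw [← h1, ← mul_add]
    refine (pow_le_pow_left₀ (norm_nonneg _) (norm_add_le _ _) 2).trans ?_
    nlinarith [sq_nonneg (‖heatFlow z t x‖ - ‖(!₂[ξ 0 φ ω, ξ 1 φ ω] : Plane)‖)]
  have hv2 : Integrable (fun ω => ‖v t x ω‖ ^ 2) P :=
    hint.mono' ((hv.measurable_apply ht.le x).norm.pow_const 2).aestronglyMeasurable
      (hle.mono fun ω hω => by rwa [Real.norm_of_nonneg (by positivity)])
  refine ⟨hv2, (integral_mono_ae hv2 hint hle).trans (le_of_eq ?_)⟩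
  rw [integral_add (integrable_const _) hsum, integral_const, integral_const_mul,
    integral_add (hs 0) (hs 1), (hξ.isWhiteNoise 0).integral_sq, (hξ.isWhiteNoise 1).integral_sq, hφ]
  simp
  ring

theorem IsMildSolution.ae_memLp (hξ : IsPlanarWhiteNoise ξ P) (hv : IsMildSolution ξ P z v) {t : ℝ}
    (ht : 0 < t) : ∀ᵐ ω ∂P, MemLp (fun x => v t x ω) 2 volume := by
  obtain ⟨C, hC0, hC⟩ := norm_flowMap_le ht
  obtain ⟨D, hD⟩ := exists_heatVar_le ht.le
  have hm : Measurable fun p : I × Ω => ‖v t p.1 p.2‖ ^ 2 := (hv.measurable t ht.le).norm.pow_const 2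
  have hint : Integrable (fun p : I × Ω => ‖v t p.1 p.2‖ ^ 2) (volume.prod P) := by
    rw [integrable_prod_iff hm.aestronglyMeasurable]
    refine ⟨Eventually.of_forall fun x => (hv.integrable_norm_sq hξ ht x).1, ?_⟩
    refine (integrable_const (2 * (C * ‖z‖) ^ 2 + 4 * D)).mono'
      hm.norm.stronglyMeasurable.integral_prod_right.aestronglyMeasurable
      (Eventually.of_forall fun x => ?_)
    have h1 := (hv.integrable_norm_sq hξ ht x).2
    have h2 : ‖heatFlow z t x‖ ≤ C * ‖z‖ := by
      rw [← flowMap_apply ht]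
      exact (flowMap (t, x)).le_of_opNorm_le (hC (t, x) le_rfl) z
    have h3 := pow_le_pow_left₀ (norm_nonneg _) h2 2
    simp only [norm_pow, norm_norm]
    rw [Real.norm_of_nonneg (integral_nonneg fun ω => by positivity)]
    linarith [hD x]
  filter_upwards [hint.prod_left_ae] with ω hω
  exact (memLp_two_iff_integrable_sq_norm
    ((hv.measurable t ht.le).comp measurable_prodMk_right).aestronglyMeasurable).2 hω

theorem IsMildSolution.semigroup_GReg {v : H2 → ℝ → I → Ω → Plane} (hξ : IsPlanarWhiteNoise ξ P)
    (hv : IsMildSolution ξ P z (v z)) {h : ℝ → ℝ} {M c : ℝ} (hh : IsWeight h M c) {ρ : ℝ → ℝ}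
    {B ε η : ℝ} (hρ : IsMollifier ρ B) (hη : 0 < η) (hε : 0 < ε) {t : ℝ} (ht : 0 < t) :
    semigroup P v t (GReg h ρ ε η) z =
      ∫ r : I, h r * gaussAvg (fReg ρ ε η) (√(heatVar t r))⁻¹ (heatFlow z t r) := by
  have hfm : Measurable fun a : Plane => fReg ρ ε η ‖a‖ :=
    (hρ.measurable_fReg ε η).comp measurable_norm
  have hf := hρ.integrable_fReg hη hε
  have hm : Measurable fun p : I × Ω => h p.1 * fReg ρ ε η ‖v z t p.1 p.2‖ :=
    (hh.continuous.measurable.comp (by fun_prop)).mul (hfm.comp (hv.measurable t ht.le))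
  obtain ⟨S, hS0, hS⟩ := hh.exists_one_div_heatVar_le ht
  have hcomp : ∀ r : I, Integrable (fun ω => h r * fReg ρ ε η ‖v z t r ω‖) P := fun r => by
    by_cases hr : h r = 0
    · simp [hr]
    · exact (hv.integrable_comp hξ ht (hh.heatVar_pos ht hr) hf).const_mul _
  have hint : Integrable (fun p : I × Ω => h p.1 * fReg ρ ε η ‖v z t p.1 p.2‖) (volume.prod P) := by
    rw [integrable_prod_iff hm.aestronglyMeasurable]
    refine ⟨Eventually.of_forall hcomp, ?_⟩
    refine (integrable_const (M * (S * ∫ a : Plane, ‖fReg ρ ε η ‖a‖‖))).mono'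
      hm.norm.stronglyMeasurable.integral_prod_right.aestronglyMeasurable
      (Eventually.of_forall fun r => ?_)
    have hF : 0 ≤ ∫ a : Plane, ‖fReg ρ ε η ‖a‖‖ := integral_nonneg fun a => norm_nonneg _
    have hM := hh.nonneg
    simp only [norm_mul]
    rw [integral_const_mul, Real.norm_of_nonneg
      (mul_nonneg (norm_nonneg _) (integral_nonneg fun ω => norm_nonneg _))]
    by_cases hr : h r = 0
    · rw [hr, norm_zero, zero_mul]
      positivity
    · have hq := hh.heatVar_pos ht hr
      have h1 := hv.integral_comp_le hξ ht hq hf.norm hfm.norm fun a => norm_nonneg _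
      have h2 := h1.trans (mul_le_mul_of_nonneg_right (hS r hr) hF)
      exact mul_le_mul (hh.abs_le r) h2 (integral_nonneg fun ω => norm_nonneg _) hM
  have h1 : semigroup P v t (GReg h ρ ε η) z = ∫ ω, (∫ r : I, h r * fReg ρ ε η ‖v z t r ω‖) ∂P := by
    refine integral_congr_ae ((hv.ae_memLp hξ ht).mono fun ω hω => ?_)
    refine integral_congr_ae ((pathClass_ae_eq hω).mono fun r hr => ?_)
    simp only [hr]
  rw [h1, ← integral_integral_swap (f := fun (r : I) ω => h r * fReg ρ ε η ‖v z t r ω‖) hint]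
  refine integral_congr_ae (Eventually.of_forall fun r => ?_)
  simp only
  rw [integral_const_mul]
  by_cases hr : h r = 0
  · rw [hr, zero_mul, zero_mul]
  · have hq := hh.heatVar_pos ht hr
    rw [hv.integral_comp hξ ht hq hfm, hρ.gaussAvg_fReg hη hε hq]
    rfl

theorem VReg_eq_truncPotential {v : H2 → ℝ → I → Ω → Plane} (hξ : IsPlanarWhiteNoise ξ P)
    (hv : ∀ z, IsMildSolution ξ P z (v z)) {h : ℝ → ℝ} {M c : ℝ} (hh : IsWeight h M c) {ρ : ℝ → ℝ}
    {B ε η : ℝ} (hρ : IsMollifier ρ B) (hη : 0 < η) (hηε : η < ε) :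
    VReg P v h ρ ε η = truncPotential h (fReg ρ ε η) 0 := by
  funext z
  rw [truncPotential_zero_eq hh (hρ.kernelBound_fReg hη hηε), VReg, onePotential]
  exact setIntegral_congr_fun measurableSet_Ioi fun t ht => by
    simp only [(hv z).semigroup_GReg hξ hh hρ hη (hη.trans hηε) ht]

end Mild

theorem TendstoInDirichletDomain.congr {μ : Measure H2} {F G : ℝ → H2 → ℝ} {F₀ : H2 → ℝ}
    (hF : TendstoInDirichletDomain μ F F₀) (hFG : ∀ᶠ s in 𝓝[>] (0 : ℝ), G s = F s) :
    TendstoInDirichletDomain μ G F₀ := by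
  obtain ⟨D, D₀, h0, hD, hlim⟩ := hF
  refine ⟨D, D₀, h0, ?_, hlim.congr' ?_⟩
  · filter_upwards [hD, hFG] with s h1 h2
    rwa [h2]
  · filter_upwards [hFG] with s h2
    rw [h2]

theorem exists_isMollifier {ρ : ℝ → ℝ} (hρ : Continuous ρ)
    (hρ_supp : Function.support ρ ⊆ Icc (-1) 1) (hρ_int : ∫ y in (-1 : ℝ)..1, ρ y = 1)
    (hρ_even : ∀ y, ρ (-y) = ρ y) : ∃ B, IsMollifier ρ B := by
  have hz : ∀ y, 1 < |y| → ρ y = 0 := fun y hy => by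
    by_contra hn
    exact absurd (abs_le.2 (hρ_supp hn)) (not_le.2 hy)
  obtain ⟨B, hB⟩ := hρ.bounded_above_of_compact_support
    (HasCompactSupport.of_support_subset_isCompact isCompact_Icc hρ_supp)
  exact ⟨B, hρ, hz, hB, hρ_even, hρ_int⟩

end RandomString

end

theorem mainTheorem5
    -- the law `μ₂` of the planar Brownian bridge is `lawH2 β P'`
    {Ω' : Type*} [MeasurableSpace Ω'] (P' : Measure Ω') [IsProbabilityMeasure P']
    (β : Fin 2 → unitInterval → Ω' → ℝ) (hβ : RandomString.IsPlanarBrownianBridge β P')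
    -- the solutions `v z` of the stochastic heat equation started from `z`
    {Ω : Type*} [MeasurableSpace Ω] (P : Measure Ω) [IsProbabilityMeasure P]
    (ξ : Fin 2 → Lp ℝ 2 RandomString.spaceTime → Ω → ℝ)
    (hξ : RandomString.IsPlanarWhiteNoise ξ P)
    (v : RandomString.H2 → ℝ → unitInterval → Ω → RandomString.Plane)
    (hv : ∀ z, RandomString.IsMildSolution ξ P z (v z))
    -- the test function `h ∈ C²_c(0,1)` and the mollifier `ρ`
    (h : ℝ → ℝ) (hh : ContDiff ℝ 2 h) (hh_supp : HasCompactSupport h)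
    (hh_sub : tsupport h ⊆ Ioo 0 1)
    (ρ : ℝ → ℝ) (hρ : ContDiff ℝ (⊤ : ℕ∞) ρ) (hρ_supp : Function.support ρ ⊆ Icc (-1) 1)
    (hρ_nonneg : ∀ y, 0 ≤ ρ y) (hρ_int : ∫ y in (-1 : ℝ)..1, ρ y = 1)
    (hρ_even : ∀ y, ρ (-y) = ρ y) :
    (∀ ε η : ℝ, 0 < η → η < ε →
      RandomString.MemDirichletDomain (RandomString.lawH2 β P')
        (RandomString.VReg P v h ρ ε η)) ∧
    (∀ ε : ℝ, 0 < ε →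
      RandomString.MemDirichletDomain (RandomString.lawH2 β P') (RandomString.VEps h ε)) ∧
    RandomString.MemDirichletDomain (RandomString.lawH2 β P') (RandomString.VLim h) ∧
    (∀ ε : ℝ, 0 < ε →
      RandomString.TendstoInDirichletDomain (RandomString.lawH2 β P')
        (fun η => RandomString.VReg P v h ρ ε η) (RandomString.VEps h ε)) ∧
    RandomString.TendstoInDirichletDomain (RandomString.lawH2 β P')
      (fun ε => RandomString.VEps h ε) (RandomString.VLim h) := by
  obtain ⟨M, c, hw⟩ := RandomString.exists_isWeight hh.continuous hh_supp hh_sub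
  obtain ⟨B, hm⟩ := RandomString.exists_isMollifier hρ.continuous hρ_supp hρ_int hρ_even
  obtain ⟨A, hA, hμ⟩ := RandomString.exists_hasNegMoment_lawH2 hβ hw
  obtain ⟨K, -, hK⟩ := RandomString.enorm_potentialField_sq_div_le hw
  have hK : RandomString.IsDominant h K := fun _ _ hk z p hp => hK hk z p hp
  have hfin : IsFiniteMeasure (RandomString.lawH2 β P') := by unfold RandomString.lawH2; infer_instance
  have hB := hm.nonneg
  have hcut := fun ε => (RandomString.kernelBound_cutKernel ε).mono (by linarith : (1 / 4 : ℝ) ≤ 1 / 4 + B / 2)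
  refine ⟨fun ε η hη hηε => ?_, fun ε hε => ?_, ?_, fun ε hε => ?_, ?_⟩
  · rw [RandomString.VReg_eq_truncPotential hξ hv hw hm hη hηε]
    exact ⟨_, RandomString.hasSobolevGradient_potential hw hK (hm.kernelBound_fReg hη hηε) hA hμ⟩
  · rw [RandomString.VEps_eq_truncPotential hw hε]
    exact ⟨_, RandomString.hasSobolevGradient_potential hw hK (RandomString.kernelBound_cutKernel ε) hA hμ⟩
  · rw [RandomString.VLim_eq_truncPotential hw]
    exact ⟨_, RandomString.hasSobolevGradient_potential hw hK RandomString.kernelBound_cubeKernel hA hμ⟩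
  · rw [RandomString.VEps_eq_truncPotential hw hε]
    have hev : ∀ᶠ η in 𝓝[>] (0 : ℝ), 0 < η ∧ η < ε := Ioo_mem_nhdsGT hε
    exact (RandomString.tendstoInDirichletDomain_potential hw hK
      (hev.mono fun η h => hm.kernelBound_fReg h.1 h.2) (hcut ε) (fun x => hm.tendsto_fReg ε)
      hA hμ).congr (hev.mono fun η h => RandomString.VReg_eq_truncPotential hξ hv hw hm h.1 h.2)
  · rw [RandomString.VLim_eq_truncPotential hw]
    exact (RandomString.tendstoInDirichletDomain_potential hw hK
      (Eventually.of_forall RandomString.kernelBound_cutKernel)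
      RandomString.kernelBound_cubeKernel
      (fun x => RandomString.tendsto_cutKernel) hA hμ).congr
      (by
        filter_upwards [self_mem_nhdsWithin] with ε hε
        exact RandomString.VEps_eq_truncPotential hw hε)
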